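/- **Setting.** Let $\varkappa\in\mathbb R\setminus\mathbb Q$, $q^a=e^{\pi i a/\varkappa}$ for $a\in\mathbb C$, $[a]=\frac{q^a-q^{-a}}{q-q^{-1}}$, $[k]!=[1]\cdots[k]$, $\ell\ge 0$, $\lambda_1,\dots,\lambda_n\in\mathbb C$, $\lambda=\sum_p\lambda_p$. Let $M_\mu$ be the Verma module of $U_q(sl(2))$ with basis $F^kv_\mu$ ($k\ge 0$), $q^HF^kv_\mu=q^{\mu-2k}F^kv_\mu$, $EF^kv_\mu=[k][\mu-k+1]F^{k-1}v_\mu$, and let $M_{\lambda_1}\otimes\dots\otimes M_{\lambda_n}[\lambda-2\ell]$ be the subspace on which $q^H\otimes\dots\otimes q^H$ acts by $q^{\lambda-2\ell}$. Put $\check R=P\,q^{H\otimes H/2}\sum_{k\ge0}q^{k(k-1)/2}\frac{(q-q^{-1})^k}{[k]!}E^k\otimes F^k$, where $P(v\otimes w)=w\otimes v$, and let $\check R_{i,i+1}$ be $\check R$ acting on the factors $i,i+1$. Write $s_i$ for the interchange of the entries $i,i+1$ of a list. Let $z_1,\dots,z_n\in\mathbb C$ with $\mathrm{Re}\,z_1<\dots<\mathrm{Re}\,z_n$,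 let $1\le i<n$, and suppose that no $z_j$ with $j\ne i,i+1$ lies in the closed disc with diameter $[z_i,z_{i+1}]$. Let $z_j(t)$, $0\le t\le1$, be the path $$z_i(t)=\tfrac12\big((z_i+z_{i+1})+(z_i-z_{i+1})e^{\pi it}\big),\qquad z_{i+1}(t)=\tfrac12\big((z_i+z_{i+1})+(z_{i+1}-z_i)e^{\pi it}\big),$$ and $z_j(t)=z_j$ for $j\ne i,i+1$. At $t=1$ the points carry, from left to right, the weights $s_i(\vec\lambda)$. Let $R$ be larger than all $\mathrm{Im}\,z_j(t)$. For points $\vec z$ with weights $\vec\lambda$ consider on $X_{\vec z}=\{x\in\mathbb C^\ell: x_j\ne x_l\ (j\neq l),\ x_j\ne z_p\}$ the local system whose flat sections are the constant multiples of the branches of $$\Psi_{\vec z}(x)=\prod_{j<l}(x_j-x_l)^{2/\varkappa}\prod_{j,p}(x_j-z_p)^{-\lambda_p/\varkappa}\prod_{p<r}(z_p-z_r)^{\lambda_p\lambda_r/(2\varkappa)},$$ and its twisted singular homology in degree $\ell$ relative to $\{x:\mathrm{Im}\,x_j\ge R\text{ for some }j\}$ (a neighbourhood of the hyperplanes $x_j=\infty$).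 For $r_1+\dots+r_n=\ell$ let $G^\ell_{r_1\dots r_n}(\vec z,\vec\lambda)$ be the antisymmetrization over the permutations of $x_1,\dots,x_\ell$ of the class of the product of $\ell$ pairwise disjoint contours, $r_p$ of them nested around $z_p$; each contour descends from height $R$ to the left of its point $z_p$, passes below $z_p$ (counter-clockwise) and ascends to height $R$ to the right of it, inside the vertical strip $|\mathrm{Re}\,x-\mathrm{Re}\,z_p|<\varepsilon$, where $\varepsilon>0$ is such that these strips are disjoint. The branch of $\Psi_{\vec z}$ on it is the continuation along the contours of the branch $\mathrm{Br}(\Psi_{\vec z})$ at their starting points, in which every factor $(a-b)^\rho$ is replaced by $e^{\rho\log(a-b)}$ if $\mathrm{Re}\,a>\mathrm{Re}\,b$ and by $e^{\rho\log(b-a)}$ if $\mathrm{Re}\,a<\mathrm{Re}\,b$, with the principal logarithm. Let $\mathcal S^{-\Sigma}_\ell(\vec z,\vec\lambda)$ be the span of these classes, and let $$\varphi_{\vec z}:M_{\lambda_1}\otimes\dots\otimes M_{\lambda_n}[\lambda-2\ell]\to\mathcal S^{-\Sigma}_\ell(\vec z,\vec\lambda),\qquad F^{k_1}v_{\lambda_1}\otimes\dots\otimes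 F^{k_n}v_{\lambda_n}\mapsto G^\ell_{k_1\dots k_n}(\vec z,\vec\lambda).$$ Let $\mathcal S^{-\Sigma}_\ell(s_i(\vec z),s_i(\vec\lambda))$ and $\varphi_{s_i(\vec z)}$ be the same space and map for the configuration at $t=1$, i.e. for the points with the weights $s_i(\vec\lambda)$ from left to right. **Statement.** There is exactly one linear map $\mathscr A_{i,i+1}:\mathcal S^{-\Sigma}_\ell(\vec z,\vec\lambda)\to\mathcal S^{-\Sigma}_\ell(s_i(\vec z),s_i(\vec\lambda))$ that is the monodromy along the path $\vec z(t)$, i.e. such that $c$ and $\mathscr A_{i,i+1}c$ become equal in the relative twisted homology of the family $\{(t,x):t\in[0,1],\ x\in X_{\vec z(t)}\}$ for every $c$. The operator $\check R_{i,i+1}$ maps $M_{\lambda_1}\otimes\dots\otimes M_{\lambda_n}[\lambda-2\ell]$ into the weight space $[\lambda-2\ell]$ of the tensor product with the factors $i,i+1$ interchanged, and $$\mathscr A_{i,i+1}\circ\varphi_{\vec z}=\varphi_{s_i(\vec z)}\circ\check R_{i,i+1}$$ on $M_{\lambda_1}\otimes\dots\otimes M_{\lambda_n}[\lambda-2\ell]$.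 -/

import Mathlib

namespace GomezSierra

noncomputable section

open scoped TensorProduct
open Module

/-! ### Quantum numbers, Verma modules and the R-matrix -/

/-- `q ^ a` for `q = exp (π i / κ)` and a complex exponent `a`. -/
def qPow (κ : ℝ) (a : ℂ) : ℂ := Complex.exp (Real.pi * Complex.I * a / κ)

/-- `[a] = (q ^ a - q ^ (-a)) / (q - q⁻¹)`. -/
def qNum (κ : ℝ) (a : ℂ) : ℂ := (qPow κ a - qPow κ (-a)) / (qPow κ 1 - qPow κ (-1))

/-- `[k]! = [1] [2] ⋯ [k]`. -/
def qFact (κ : ℝ) (k : ℕ) : ℂ := ∏ j ∈ Finset.range k, qNum κ ((j : ℂ) + 1)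

/-- The space of the Verma module `M_lam` of `U_q(sl(2))`, free on the vectors `F ^ k v_lam`. -/
abbrev Verma (_κ : ℝ) (_lam : ℂ) : Type := ℕ →₀ ℂ

/-- The basis `F ^ k v_lam` of `M_lam`. -/
def vermaBasis (κ : ℝ) (lam : ℂ) : Basis ℕ ℂ (Verma κ lam) := Finsupp.basisSingleOne

/-- The action of `F`. -/
def vermaF (κ : ℝ) (lam : ℂ) : Verma κ lam →ₗ[ℂ] Verma κ lam :=
  (vermaBasis κ lam).constr ℂ fun k => vermaBasis κ lam (k + 1)

/-- The action of `E`: `E F ^ k v = [k] [lam - k + 1] F ^ (k - 1) v`. -/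
def vermaE (κ : ℝ) (lam : ℂ) : Verma κ lam →ₗ[ℂ] Verma κ lam :=
  (vermaBasis κ lam).constr ℂ fun k =>
    (qNum κ k * qNum κ (lam - k + 1)) • vermaBasis κ lam (k - 1)

/-- The action of `q ^ H`. -/
def vermaK (κ : ℝ) (lam : ℂ) : Verma κ lam →ₗ[ℂ] Verma κ lam :=
  (vermaBasis κ lam).constr ℂ fun k => qPow κ (lam - 2 * k) • vermaBasis κ lam k

/-- The action of `q ^ (-H)`. -/
def vermaKInv (κ : ℝ) (lam : ℂ) : Verma κ lam →ₗ[ℂ] Verma κ lam :=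
  (vermaBasis κ lam).constr ℂ fun k => qPow κ (-(lam - 2 * k)) • vermaBasis κ lam k

theorem qPow_add (κ : ℝ) (a b : ℂ) : qPow κ (a + b) = qPow κ a * qPow κ b := by
  unfold qPow
  rw [← Complex.exp_add]
  congr 1
  ring

theorem qPow_zero (κ : ℝ) : qPow κ 0 = 1 := by simp [qPow]

theorem qPow_one_sub_ne_zero {κ : ℝ} (hκ : Irrational κ) : qPow κ 1 - qPow κ (-1) ≠ 0 := by
  have hk : (κ : ℂ) ≠ 0 := by exact_mod_cast hκ.ne_zero
  intro h
  have h' := sub_eq_zero.mp h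
  unfold qPow at h'
  rw [Complex.exp_eq_exp_iff_exists_int] at h'
  obtain ⟨m, hm⟩ := h'
  have hpi : (Real.pi : ℂ) ≠ 0 := by exact_mod_cast Real.pi_ne_zero
  have h2 : (1 : ℂ) = m * κ := by
    field_simp at hm
    have := mul_left_cancel₀ Complex.I_ne_zero (a := Complex.I) (b := 2) (c := 2 * m * κ)
      (by linear_combination hm * Complex.I)
    linear_combination this / 2
  have h3 : (1 : ℝ) = m * κ := by exact_mod_cast h2
  have hm0 : m ≠ 0 := by
    rintro rfl
    simp at h3
  exact (hκ.intCast_mul hm0).ne_one h3.symm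

/-- `q ^ H E = q ^ 2 E q ^ H` on `M_lam`. -/
theorem vermaK_comp_vermaE (κ : ℝ) (lam : ℂ) :
    vermaK κ lam ∘ₗ vermaE κ lam = qPow κ 2 • (vermaE κ lam ∘ₗ vermaK κ lam) := by
  refine (vermaBasis κ lam).ext fun k => ?_
  rcases k with _ | k
  · simp [vermaK, vermaE, qNum]
  · simp only [vermaK, vermaE, LinearMap.comp_apply, LinearMap.smul_apply, Basis.constr_basis,
      map_smul, smul_smul, Nat.add_sub_cancel]
    rw [show lam - 2 * (k : ℂ) = 2 + (lam - 2 * ((k + 1 : ℕ) : ℂ)) by push_cast; ring, qPow_add]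
    congr 1
    ring

/-- `q ^ H F = q ^ (-2) F q ^ H` on `M_lam`. -/
theorem vermaK_comp_vermaF (κ : ℝ) (lam : ℂ) :
    vermaK κ lam ∘ₗ vermaF κ lam = qPow κ (-2) • (vermaF κ lam ∘ₗ vermaK κ lam) := by
  refine (vermaBasis κ lam).ext fun k => ?_
  simp only [vermaK, vermaF, LinearMap.comp_apply, LinearMap.smul_apply, Basis.constr_basis,
    map_smul, smul_smul, ← qPow_add]
  congr 2
  push_cast
  ring

/-- `[E, F] = (q ^ H - q ^ (-H)) / (q - q⁻¹)` on `M_lam`. -/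
theorem vermaE_commutator_vermaF {κ : ℝ} (hκ : Irrational κ) (lam : ℂ) :
    vermaE κ lam ∘ₗ vermaF κ lam - vermaF κ lam ∘ₗ vermaE κ lam =
      (qPow κ 1 - qPow κ (-1))⁻¹ • (vermaK κ lam - vermaKInv κ lam) := by
  have hd := qPow_one_sub_ne_zero hκ
  refine (vermaBasis κ lam).ext fun k => ?_
  have e1 : qPow κ (k + 1) = qPow κ k * qPow κ 1 := qPow_add _ _ _
  have e2 : qPow κ (-(k + 1)) = qPow κ (-k) * qPow κ (-1) := by
    rw [← qPow_add]; congr 1; ring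
  have e3 : qPow κ (lam - k + 1) = qPow κ (lam - k) * qPow κ 1 := qPow_add _ _ _
  have e4 : qPow κ (-(lam - k + 1)) = qPow κ (-(lam - k)) * qPow κ (-1) := by
    rw [← qPow_add]; congr 1; ring
  have e5 : qPow κ (lam - 2 * k) = qPow κ (lam - k) * qPow κ (-k) := by
    rw [← qPow_add]; congr 1; ring
  have e6 : qPow κ (-(lam - 2 * k)) = qPow κ (-(lam - k)) * qPow κ k := by
    rw [← qPow_add]; congr 1; ring
  have u1 : qPow κ 1 * qPow κ (-1) = 1 := by rw [← qPow_add]; simp [qPow_zero]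
  have u2 : qPow κ k * qPow κ (-k) = 1 := by rw [← qPow_add]; simp [qPow_zero]
  have u3 : qPow κ (lam - k) * qPow κ (-(lam - k)) = 1 := by rw [← qPow_add]; simp [qPow_zero]
  have key : qNum κ (k + 1) * qNum κ (lam - k) - qNum κ k * qNum κ (lam - k + 1) =
      (qPow κ 1 - qPow κ (-1))⁻¹ * (qPow κ (lam - 2 * k) - qPow κ (-(lam - 2 * k))) := by
    simp only [qNum, e1, e2, e3, e4, e5, e6]
    field_simp
    ring
  rcases k with _ | k
  · simp only [vermaK, vermaKInv, vermaE, vermaF, LinearMap.comp_apply, LinearMap.smul_apply,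
      LinearMap.sub_apply, Basis.constr_basis, map_smul, smul_smul, Nat.add_sub_cancel, ← sub_smul]
    have q0 : qNum κ ((0 : ℕ) : ℂ) = 0 := by simp [qNum]
    rw [q0] at key ⊢
    simp only [zero_mul, zero_smul, sub_zero] at key ⊢
    rw [← key, show lam - ((0 + 1 : ℕ) : ℂ) + 1 = lam - ((0 : ℕ) : ℂ) by push_cast; ring,
      Nat.cast_succ]
  · simp only [vermaK, vermaKInv, vermaE, vermaF, LinearMap.comp_apply, LinearMap.smul_apply,
      LinearMap.sub_apply, Basis.constr_basis, map_smul, smul_smul, Nat.add_sub_cancel, ← sub_smul]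
    rw [← key, show lam - ((k + 1 + 1 : ℕ) : ℂ) + 1 = lam - ((k + 1 : ℕ) : ℂ) by push_cast; ring,
      Nat.cast_succ (k + 1)]

/-- `Θ = ∑ₖ q ^ (k (k - 1) / 2) (q - q⁻¹) ^ k / [k]! E ^ k ⊗ F ^ k`; on
`F ^ a v ⊗ F ^ b v` the terms with `k > a` vanish. -/
def theta (κ : ℝ) (l₁ l₂ : ℂ) :
    Verma κ l₁ ⊗[ℂ] Verma κ l₂ →ₗ[ℂ] Verma κ l₁ ⊗[ℂ] Verma κ l₂ :=
  ((vermaBasis κ l₁).tensorProduct (vermaBasis κ l₂)).constr ℂ fun ab =>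
    ∑ k ∈ Finset.range (ab.1 + 1),
      (qPow κ ((k : ℂ) * ((k : ℂ) - 1) / 2) * (qPow κ 1 - qPow κ (-1)) ^ k / qFact κ k) •
        (((vermaE κ l₁ ^ k) (vermaBasis κ l₁ ab.1)) ⊗ₜ[ℂ]
          ((vermaF κ l₂ ^ k) (vermaBasis κ l₂ ab.2)))

/-- `C = q ^ (H ⊗ H / 2)`. -/
def cartan (κ : ℝ) (l₁ l₂ : ℂ) :
    Verma κ l₁ ⊗[ℂ] Verma κ l₂ →ₗ[ℂ] Verma κ l₁ ⊗[ℂ] Verma κ l₂ :=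
  ((vermaBasis κ l₁).tensorProduct (vermaBasis κ l₂)).constr ℂ fun ab =>
    qPow κ ((l₁ - 2 * ab.1) * (l₂ - 2 * ab.2) / 2) •
      (vermaBasis κ l₁ ab.1 ⊗ₜ[ℂ] vermaBasis κ l₂ ab.2)

/-- `Ř = P R = P C Θ : M_{l₁} ⊗ M_{l₂} → M_{l₂} ⊗ M_{l₁}`. -/
def rCheck (κ : ℝ) (l₁ l₂ : ℂ) :
    Verma κ l₁ ⊗[ℂ] Verma κ l₂ →ₗ[ℂ] Verma κ l₂ ⊗[ℂ] Verma κ l₁ :=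
  (TensorProduct.comm ℂ (Verma κ l₁) (Verma κ l₂)).toLinearMap ∘ₗ cartan κ l₁ l₂ ∘ₗ theta κ l₁ l₂

/-- `M_{lam 0} ⊗ ⋯ ⊗ M_{lam (n - 1)}`. -/
abbrev VermaTensor (κ : ℝ) {n : ℕ} (lam : Fin n → ℂ) : Type :=
  PiTensorProduct ℂ fun p => Verma κ (lam p)

/-- The basis of the tensor product formed by the vectors `F ^ (k 0) v ⊗ ⋯ ⊗ F ^ (k (n - 1)) v`. -/
def vermaTensorBasis (κ : ℝ) {n : ℕ} (lam : Fin n → ℂ) :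
    Basis (Fin n → ℕ) ℂ (VermaTensor κ lam) :=
  Basis.piTensorProduct fun p => vermaBasis κ (lam p)

/-- The subspace `M_{lam 0} ⊗ ⋯ ⊗ M_{lam (n - 1)} [∑ lam - 2 ℓ]`, on which
`q ^ H ⊗ ⋯ ⊗ q ^ H` acts by `q ^ (∑ lam - 2 ℓ)`. -/
def weightSpace (κ : ℝ) {n : ℕ} (lam : Fin n → ℂ) (ℓ : ℕ) : Submodule ℂ (VermaTensor κ lam) :=
  LinearMap.eqLocus (PiTensorProduct.map fun p => vermaK κ (lam p))
    (qPow κ (∑ p, lam p - 2 * ℓ) • LinearMap.id)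

/-- The linear map that puts a tensor of two factors in the places `i, i + 1` and
`F ^ (k p) v` in every other place `p`. -/
def placeAt (κ : ℝ) {n : ℕ} (lam : Fin (n + 1) → ℂ) (i : Fin n) (k : Fin (n + 1) → ℕ) :
    Verma κ (lam i.castSucc) ⊗[ℂ] Verma κ (lam i.succ) →ₗ[ℂ] VermaTensor κ lam :=
  ((vermaBasis κ (lam i.castSucc)).tensorProduct (vermaBasis κ (lam i.succ))).constr ℂ fun ab =>
    vermaTensorBasis κ lam (Function.update (Function.update k i.castSucc ab.1) i.succ ab.2)

/-- `s_i` interchanges the entries of a list in the places `i, i + 1`. -/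
def swapAt {n : ℕ} (i : Fin n) : Equiv.Perm (Fin (n + 1)) := Equiv.swap i.castSucc i.succ

/-- `Ř_{i,i+1}`: `Ř` acting on the factors `i, i + 1`. -/
def rCheckAt (κ : ℝ) {n : ℕ} (lam : Fin (n + 1) → ℂ) (i : Fin n) :
    VermaTensor κ lam →ₗ[ℂ] VermaTensor κ (lam ∘ swapAt i) :=
  (vermaTensorBasis κ lam).constr ℂ fun k =>
    placeAt κ (lam ∘ swapAt i) i k
      (rCheck κ (lam i.castSucc) (lam i.succ)
        (vermaBasis κ (lam i.castSucc) (k i.castSucc) ⊗ₜ[ℂ] vermaBasis κ (lam i.succ) (k i.succ)))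

/-! ### Configuration spaces and twisted homology relative to infinity -/

/-- For a family `Z` of `n`-tuples of points over a base `B`: the pairs of a point `b` of the base
and a point `x` of `ℂ ^ ℓ` off the hyperplanes `x_j = x_l` and `x_j = Z_p(b)`. -/
abbrev Config {B : Type} {n : ℕ} (Z : B → Fin n → ℂ) (ℓ : ℕ) : Type :=
  {y : B × (Fin ℓ → ℂ) //
    (∀ j l, j ≠ l → y.2 j ≠ y.2 l) ∧ ∀ j p, y.2 j ≠ Z y.1 p}

/-- The standard `k`-cube. -/
abbrev Cube (k : ℕ) : Type := Fin k → unitInterval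

section Homology

variable {B B' : Type} [TopologicalSpace B] [TopologicalSpace B'] {n : ℕ}

/-- `s` is a flat section of the local system of `Ψ` along the singular cube `y`, that is, a
constant times a continuous branch along `y` of
`∏_{j<l} (x_j - x_l) ^ (2/κ) ∏_{j,p} (x_j - Z_p) ^ (-lam_p/κ)
  ∏_{p<r} (Z_p - Z_r) ^ (lam_p lam_r/(2κ))`. -/
def IsBranch (κ : ℝ) (lam : Fin n → ℂ) (Z : B → Fin n → ℂ) {ℓ k : ℕ}
    (y : C(Cube k, Config Z ℓ)) (s : Cube k → ℂ) : Prop :=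
  ∃ (c : ℂ) (L : Fin ℓ → Fin ℓ → Cube k → ℂ) (K : Fin ℓ → Fin n → Cube k → ℂ)
    (M : Fin n → Fin n → Cube k → ℂ),
    (∀ j l, j < l → Continuous (L j l) ∧
      ∀ u, Complex.exp (L j l u) = (y u).1.2 j - (y u).1.2 l) ∧
    (∀ j p, Continuous (K j p) ∧
      ∀ u, Complex.exp (K j p u) = (y u).1.2 j - Z (y u).1.1 p) ∧
    (∀ p r, p < r → Continuous (M p r) ∧
      ∀ u, Complex.exp (M p r u) = Z (y u).1.1 p - Z (y u).1.1 r) ∧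
    ∀ u, s u = c * Complex.exp
      ((∑ j, ∑ l ∈ Finset.Ioi j, 2 / (κ : ℂ) * L j l u) +
        (∑ j, ∑ p, -(lam p / (κ : ℂ)) * K j p u) +
        ∑ p, ∑ r ∈ Finset.Ioi p, lam p * lam r / (2 * (κ : ℂ)) * M p r u)

/-- Finite formal sums of pairs of a singular `k`-cube and a function on the cube; the twisted
chains form the subspace `chains` of it. -/
abbrev PreChain (Z : B → Fin n → ℂ) (ℓ k : ℕ) : Type :=
  C(Cube k, Config Z ℓ) →₀ (Cube k → ℂ)

/-- Twisted singular cubical `k`-chains. -/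
def chains (κ : ℝ) (lam : Fin n → ℂ) (Z : B → Fin n → ℂ) (ℓ k : ℕ) :
    Submodule ℂ (PreChain Z ℓ k) :=
  Submodule.span ℂ {c | ∃ y s, IsBranch κ lam Z y s ∧ c = Finsupp.single y s}

/-- A neighbourhood of the hyperplanes `x_j = ∞`, approached vertically upwards. -/
def infinity (Z : B → Fin n → ℂ) (ℓ : ℕ) (R : ℝ) : Set (Config Z ℓ) :=
  {y | ∃ j, R ≤ (y.1.2 j).im}

/-- Twisted chains in the neighbourhood of infinity. -/
def chainsAtInfinity (κ : ℝ) (lam : Fin n → ℂ) (Z : B → Fin n → ℂ) (ℓ : ℕ) (R : ℝ) (k : ℕ) :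
    Submodule ℂ (PreChain Z ℓ k) :=
  Submodule.span ℂ {c | ∃ y s, IsBranch κ lam Z y s ∧ (∀ u, y u ∈ infinity Z ℓ R) ∧
    c = Finsupp.single y s}

/-- Degenerate twisted chains, spanned by the cubes that do not depend on one of their
coordinates. -/
def degenerateChains (κ : ℝ) (lam : Fin n → ℂ) (Z : B → Fin n → ℂ) (ℓ k : ℕ) :
    Submodule ℂ (PreChain Z ℓ k) :=
  Submodule.span ℂ {c | ∃ y s, IsBranch κ lam Z y s ∧
    (∃ a : Fin k, ∀ u v : Cube k, (∀ b, b ≠ a → u b = v b) → y u = y v) ∧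
    c = Finsupp.single y s}

/-- The chains that are zero in the complex of the pair. -/
def trivialChains (κ : ℝ) (lam : Fin n → ℂ) (Z : B → Fin n → ℂ) (ℓ : ℕ) (R : ℝ) (k : ℕ) :
    Submodule ℂ (PreChain Z ℓ k) :=
  chainsAtInfinity κ lam Z ℓ R k ⊔ degenerateChains κ lam Z ℓ k

/-- The inclusion of the face `u_a = e` of a cube. -/
def faceIncl (k : ℕ) (a : Fin (k + 1)) (e : unitInterval) : C(Cube k, Cube (k + 1)) where
  toFun u := a.insertNth e u
  continuous_toFun := by fun_prop

/-- Restriction of a cube with a section to the face `u_a = e`. -/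
def face (Z : B → Fin n → ℂ) (ℓ k : ℕ) (a : Fin (k + 1)) (e : unitInterval) :
    PreChain Z ℓ (k + 1) →ₗ[ℂ] PreChain Z ℓ k :=
  Finsupp.lsum ℂ fun y =>
    Finsupp.lsingle (y.comp (faceIncl k a e)) ∘ₗ LinearMap.funLeft ℂ ℂ (faceIncl k a e)

/-- The boundary operator. -/
def boundary (Z : B → Fin n → ℂ) (ℓ k : ℕ) : PreChain Z ℓ (k + 1) →ₗ[ℂ] PreChain Z ℓ k :=
  ∑ a : Fin (k + 1), ((-1 : ℂ) ^ (a : ℕ)) • (face Z ℓ k a 1 - face Z ℓ k a 0)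

/-- Relative cycles. -/
def cycles (κ : ℝ) (lam : Fin n → ℂ) (Z : B → Fin n → ℂ) (ℓ : ℕ) (R : ℝ) :
    (k : ℕ) → Submodule ℂ (PreChain Z ℓ k)
  | 0 => chains κ lam Z ℓ 0
  | k + 1 => chains κ lam Z ℓ (k + 1) ⊓
      (trivialChains κ lam Z ℓ R k).comap (boundary Z ℓ k)

/-- Relative boundaries. -/
def boundaries (κ : ℝ) (lam : Fin n → ℂ) (Z : B → Fin n → ℂ) (ℓ : ℕ) (R : ℝ) (k : ℕ) :
    Submodule ℂ (PreChain Z ℓ k) :=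
  trivialChains κ lam Z ℓ R k ⊔ (chains κ lam Z ℓ (k + 1)).map (boundary Z ℓ k)

/-- The quotient of `p` by `q ⊓ p`. -/
abbrev Subquotient {V : Type} [AddCommGroup V] [Module ℂ V] (p q : Submodule ℂ V) : Type :=
  p ⧸ q.submoduleOf p

/-- The `k`-th homology of the configuration space relative to infinity, with coefficients in the
local system of `Ψ`. -/
abbrev Homology (κ : ℝ) (lam : Fin n → ℂ) (Z : B → Fin n → ℂ) (ℓ : ℕ) (R : ℝ) (k : ℕ) : Type :=
  Subquotient (cycles κ lam Z ℓ R k) (boundaries κ lam Z ℓ R k)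

/-! #### Functoriality -/

/-- A map of configuration spaces that carries flat sections to flat sections and infinity to
infinity. -/
structure IsTwistedMap (κ : ℝ) (lam lam' : Fin n → ℂ) (Z : B → Fin n → ℂ) (Z' : B' → Fin n → ℂ)
    (ℓ : ℕ) (R : ℝ) (g : C(Config Z ℓ, Config Z' ℓ)) : Prop where
  branch : ∀ (k : ℕ) (y : C(Cube k, Config Z ℓ)) (s : Cube k → ℂ),
    IsBranch κ lam Z y s → IsBranch κ lam' Z' (g.comp y) s
  infinity : ∀ y ∈ infinity Z ℓ R, g y ∈ infinity Z' ℓ R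

variable {κ : ℝ} {lam lam' : Fin n → ℂ} {Z : B → Fin n → ℂ} {Z' : B' → Fin n → ℂ} {ℓ : ℕ} {R : ℝ}

/-- Push-forward of chains. -/
def push (g : C(Config Z ℓ, Config Z' ℓ)) (k : ℕ) : PreChain Z ℓ k →ₗ[ℂ] PreChain Z' ℓ k :=
  Finsupp.lmapDomain (Cube k → ℂ) ℂ fun y => g.comp y

theorem push_single (g : C(Config Z ℓ, Config Z' ℓ)) (k : ℕ) (y : C(Cube k, Config Z ℓ))
    (s : Cube k → ℂ) : push g k (Finsupp.single y s) = Finsupp.single (g.comp y) s := by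
  simp [push]

theorem face_single (k : ℕ) (a : Fin (k + 1)) (e : unitInterval) (y : C(Cube (k + 1), Config Z ℓ))
    (s : Cube (k + 1) → ℂ) : face Z ℓ k a e (Finsupp.single y s) =
      Finsupp.single (y.comp (faceIncl k a e)) (s ∘ faceIncl k a e) := by
  simp [face]
  rfl

theorem push_boundary (g : C(Config Z ℓ, Config Z' ℓ)) (k : ℕ) (c : PreChain Z ℓ (k + 1)) :
    push g k (boundary Z ℓ k c) = boundary Z' ℓ k (push g (k + 1) c) := by
  induction c using Finsupp.induction_linear with
  | zero => simp
  | add c d hc hd => simp only [map_add, hc, hd]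
  | single y s =>
    simp only [boundary, LinearMap.sum_apply, LinearMap.smul_apply, LinearMap.sub_apply, map_sum,
      map_smul, map_sub, face_single, push_single]
    rfl

theorem push_mem_chains {g : C(Config Z ℓ, Config Z' ℓ)}
    (hg : IsTwistedMap κ lam lam' Z Z' ℓ R g) (k : ℕ) :
    chains κ lam Z ℓ k ≤ (chains κ lam' Z' ℓ k).comap (push g k) := by
  refine Submodule.span_le.2 ?_
  rintro _ ⟨y, s, hs, rfl⟩
  refine Submodule.mem_comap.2 (Submodule.subset_span ⟨g.comp y, s, hg.branch k y s hs, ?_⟩)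
  exact push_single g k y s

theorem push_mem_trivialChains {g : C(Config Z ℓ, Config Z' ℓ)}
    (hg : IsTwistedMap κ lam lam' Z Z' ℓ R g) (k : ℕ) :
    trivialChains κ lam Z ℓ R k ≤ (trivialChains κ lam' Z' ℓ R k).comap (push g k) := by
  refine sup_le (Submodule.span_le.2 ?_) (Submodule.span_le.2 ?_)
  · rintro _ ⟨y, s, hs, hy, rfl⟩
    refine Submodule.mem_comap.2 (Submodule.mem_sup_left (Submodule.subset_span
      ⟨g.comp y, s, hg.branch k y s hs, fun u => hg.infinity _ (hy u), push_single g k y s⟩))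
  · rintro _ ⟨y, s, hs, ⟨a, ha⟩, rfl⟩
    refine Submodule.mem_comap.2 (Submodule.mem_sup_right (Submodule.subset_span
      ⟨g.comp y, s, hg.branch k y s hs, ⟨a, fun u v huv => ?_⟩, push_single g k y s⟩))
    simp [ha u v huv]

theorem push_mem_cycles {g : C(Config Z ℓ, Config Z' ℓ)}
    (hg : IsTwistedMap κ lam lam' Z Z' ℓ R g) (k : ℕ) :
    ∀ c ∈ cycles κ lam Z ℓ R k, push g k c ∈ cycles κ lam' Z' ℓ R k := by
  rcases k with _ | k
  · exact fun c hc => push_mem_chains hg 0 hc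
  · rintro c ⟨hc, hc'⟩
    refine ⟨push_mem_chains hg (k + 1) hc, ?_⟩
    rw [SetLike.mem_coe, Submodule.mem_comap, ← push_boundary]
    exact push_mem_trivialChains hg k hc'

theorem push_mem_boundaries {g : C(Config Z ℓ, Config Z' ℓ)}
    (hg : IsTwistedMap κ lam lam' Z Z' ℓ R g) (k : ℕ) :
    boundaries κ lam Z ℓ R k ≤ (boundaries κ lam' Z' ℓ R k).comap (push g k) := by
  refine sup_le (fun c hc => Submodule.mem_sup_left (push_mem_trivialChains hg k hc)) ?_
  rintro _ ⟨c, hc, rfl⟩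
  refine Submodule.mem_sup_right ⟨push g (k + 1) c, push_mem_chains hg (k + 1) hc, ?_⟩
  exact (push_boundary g k c).symm

/-- The map induced on homology. -/
def homologyMap {g : C(Config Z ℓ, Config Z' ℓ)} (hg : IsTwistedMap κ lam lam' Z Z' ℓ R g)
    (k : ℕ) : Homology κ lam Z ℓ R k →ₗ[ℂ] Homology κ lam' Z' ℓ R k :=
  Submodule.mapQ _ _ ((push g k).restrict (push_mem_cycles hg k))
    fun c hc => push_mem_boundaries hg k (x := (c : PreChain Z ℓ k)) hc

/-- The map `(b, x) ↦ (β b, x ∘ σ)`, for a map `β` of the bases under which the points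
correspond to each other up to a relabelling `τ`. -/
def configMap (β : C(B, B')) (σ : Equiv.Perm (Fin ℓ)) (τ : Equiv.Perm (Fin n))
    (hZ : ∀ b p, Z' (β b) p = Z b (τ p)) : C(Config Z ℓ, Config Z' ℓ) where
  toFun y := ⟨(β y.1.1, fun j => y.1.2 (σ j)),
    fun j l hjl => y.2.1 (σ j) (σ l) fun h => hjl (σ.injective h),
    fun j p => by simpa only [hZ] using y.2.2 (σ j) (τ p)⟩
  continuous_toFun := by fun_prop

theorem sum_pairs_perm {m : ℕ} (σ : Equiv.Perm (Fin m)) (f : Fin m → Fin m → ℂ)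
    (hf : ∀ j l, f j l = f l j) :
    ∑ j, ∑ l ∈ Finset.Ioi j, f (σ j) (σ l) = ∑ j, ∑ l ∈ Finset.Ioi j, f j l := by
  have key : ∀ g : Fin m → Fin m → ℂ, (∀ j l, g j l = g l j) →
      2 * ∑ j, ∑ l ∈ Finset.Ioi j, g j l = ∑ j, ∑ l, g j l - ∑ j, g j j := by
    intro g hg
    have h1 : ∑ j, ∑ l ∈ Finset.Ioi j, g j l = ∑ j, ∑ l, if j < l then g j l else 0 := by
      refine Finset.sum_congr rfl fun j _ => ?_
      rw [← Finset.sum_filter]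
      congr 1
      ext l
      simp
    have h2 : ∑ j, ∑ l ∈ Finset.Ioi j, g j l = ∑ j, ∑ l, if l < j then g j l else 0 := by
      rw [h1, Finset.sum_comm]
      refine Finset.sum_congr rfl fun j _ => Finset.sum_congr rfl fun l _ => ?_
      rw [hg l j]
    have h3 : ∑ j, g j j = ∑ j, ∑ l, if j = l then g j l else 0 := by simp
    rw [two_mul]
    nth_rewrite 1 [h1]
    rw [h2, h3, ← Finset.sum_add_distrib, ← Finset.sum_sub_distrib]
    refine Finset.sum_congr rfl fun j _ => ?_
    rw [← Finset.sum_add_distrib, ← Finset.sum_sub_distrib]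
    refine Finset.sum_congr rfl fun l _ => ?_
    rcases lt_trichotomy j l with h | h | h
    · simp [h, h.not_gt, h.ne]
    · simp [h]
    · simp [h, h.not_gt, h.ne']
  have h := key (fun j l => f (σ j) (σ l)) fun j l => hf _ _
  have h' := key f hf
  have e1 : ∑ j, ∑ l, f (σ j) (σ l) = ∑ j, ∑ l, f j l := by
    rw [← Equiv.sum_comp σ (fun j => ∑ l, f j l)]
    exact Finset.sum_congr rfl fun j _ => Equiv.sum_comp σ (fun l => f (σ j) l)
  have e2 : ∑ j, f (σ j) (σ j) = ∑ j, f j j := Equiv.sum_comp σ fun j => f j j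
  rw [e1, e2, ← h'] at h
  exact mul_left_cancel₀ two_ne_zero h

/-- Logarithms of the differences `x_{σ j} - x_{σ l}`, `j < l`, from those of `x_j - x_l`,
`j < l`; they have the same weighted sum up to a constant. -/
theorem exists_logs_perm {m k : ℕ} (σ : Equiv.Perm (Fin m)) (w : Fin m → Fin m → ℂ)
    (hw : ∀ j l, w j l = w l j) (x : Cube k → Fin m → ℂ) (L : Fin m → Fin m → Cube k → ℂ)
    (hL : ∀ j l, j < l → Continuous (L j l) ∧ ∀ u, Complex.exp (L j l u) = x u j - x u l) :
    ∃ (d : ℂ) (L' : Fin m → Fin m → Cube k → ℂ),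
      (∀ j l, j < l → Continuous (L' j l) ∧
        ∀ u, Complex.exp (L' j l u) = x u (σ j) - x u (σ l)) ∧
      ∀ u, ∑ j, ∑ l ∈ Finset.Ioi j, w j l * L j l u =
        d + ∑ j, ∑ l ∈ Finset.Ioi j, w (σ j) (σ l) * L' j l u := by
  refine ⟨-∑ j, ∑ l ∈ Finset.Ioi j,
      w (σ j) (σ l) * (if σ j < σ l then 0 else Real.pi * Complex.I),
    fun j l u => if σ j < σ l then L (σ j) (σ l) u else
      L (σ l) (σ j) u + Real.pi * Complex.I, ?_, ?_⟩
  · intro j l hjl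
    by_cases h : σ j < σ l
    · simpa [h] using hL _ _ h
    · have h' : σ l < σ j :=
        lt_of_le_of_ne (not_lt.1 h) fun e => hjl.ne' (σ.injective e)
      have := hL _ _ h'
      refine ⟨?_, fun u => ?_⟩
      · simp only [h, if_false]
        exact this.1.add continuous_const
      · simp [h, Complex.exp_add, this.2 u]
  · intro u
    have hs := sum_pairs_perm σ
      (fun j l => w j l * if j < l then L j l u else L l j u) (fun j l => by
        rcases lt_trichotomy j l with h | h | h
        · simp [h, h.not_gt, hw j l]
        · simp [h]
        · simp [h, h.not_gt, hw j l])
    have h1 : ∑ j, ∑ l ∈ Finset.Ioi j, w j l * L j l u =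
        ∑ j, ∑ l ∈ Finset.Ioi j, w j l * (if j < l then L j l u else L l j u) := by
      refine Finset.sum_congr rfl fun j _ => Finset.sum_congr rfl fun l hl => ?_
      rw [if_pos (Finset.mem_Ioi.1 hl)]
    rw [h1, ← hs, neg_add_eq_sub, ← Finset.sum_sub_distrib]
    refine Finset.sum_congr rfl fun j _ => ?_
    rw [← Finset.sum_sub_distrib]
    refine Finset.sum_congr rfl fun l _ => ?_
    by_cases h : σ j < σ l <;> simp only [h, if_true, if_false] <;> ring

theorem isTwistedMap_configMap (β : C(B, B')) (σ : Equiv.Perm (Fin ℓ)) (τ : Equiv.Perm (Fin n))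
    (hZ : ∀ b p, Z' (β b) p = Z b (τ p)) (hlam : ∀ p, lam' p = lam (τ p)) :
    IsTwistedMap κ lam lam' Z Z' ℓ R (configMap β σ τ hZ) where
  infinity := by
    rintro y ⟨j, hj⟩
    exact ⟨σ.symm j, by simpa [configMap] using hj⟩
  branch := by
    rintro k y s ⟨c, L, K, M, hL, hK, hM, hs⟩
    obtain ⟨d, L', hL', hLs⟩ := exists_logs_perm σ (fun _ _ => 2 / (κ : ℂ)) (fun _ _ => rfl)
      (fun u => (y u).1.2) L hL
    obtain ⟨e, M', hM', hMs⟩ := exists_logs_perm τ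
      (fun p r => lam p * lam r / (2 * (κ : ℂ))) (fun p r => by ring)
      (fun u => Z (y u).1.1) M hM
    refine ⟨c * Complex.exp (d + e), L', fun j p => K (σ j) (τ p), M', hL', ?_, ?_, ?_⟩
    · intro j p
      refine ⟨(hK _ _).1, fun u => ?_⟩
      rw [(hK _ _).2 u]
      simp [configMap, hZ]
    · intro p r hpr
      refine ⟨(hM' p r hpr).1, fun u => ?_⟩
      rw [(hM' p r hpr).2 u]
      simp [configMap, hZ]
    · intro u
      have hKs : ∑ j, ∑ p, -(lam p / (κ : ℂ)) * K j p u =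
          ∑ j, ∑ p, -(lam' p / (κ : ℂ)) * K (σ j) (τ p) u := by
        rw [← Equiv.sum_comp σ (fun j => ∑ p, -(lam p / (κ : ℂ)) * K j p u)]
        refine Finset.sum_congr rfl fun j _ => ?_
        rw [← Equiv.sum_comp τ (fun p => -(lam p / (κ : ℂ)) * K (σ j) p u)]
        simp only [hlam]
      rw [hs u, hLs u, hMs u, hKs, mul_assoc, ← Complex.exp_add]
      simp only [hlam]
      congr 2
      ring

theorem IsBranch.comp {k m : ℕ} {y : C(Cube m, Config Z ℓ)} {s : Cube m → ℂ}
    (h : IsBranch κ lam Z y s) (f : C(Cube k, Cube m)) :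
    IsBranch κ lam Z (y.comp f) (s ∘ f) := by
  obtain ⟨c, L, K, M, hL, hK, hM, hs⟩ := h
  exact ⟨c, fun j l u => L j l (f u), fun j p u => K j p (f u), fun p r u => M p r (f u),
    fun j l h => ⟨(hL j l h).1.comp f.continuous, fun u => (hL j l h).2 (f u)⟩,
    fun j p => ⟨(hK j p).1.comp f.continuous, fun u => (hK j p).2 (f u)⟩,
    fun p r h => ⟨(hM p r h).1.comp f.continuous, fun u => (hM p r h).2 (f u)⟩,
    fun u => hs (f u)⟩

end Homology

/-! ### Gomez-Sierra contours -/

/-- The branch of the logarithm cut along `-i [0, ∞)` that is the principal one on the right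
half-plane. -/
def brLog (d : ℂ) : ℂ := Complex.log (-Complex.I * d) + Real.pi / 2 * Complex.I

theorem brLog_of_re_pos {d : ℂ} (hd : 0 < d.re) : brLog d = Complex.log d := by
  have hd0 : d ≠ 0 := by
    rintro rfl
    simp at hd
  have h1 := Complex.abs_arg_lt_pi_div_two_iff.2 (Or.inl hd)
  rw [abs_lt] at h1
  have h2 : Complex.log (-Complex.I * d) = Complex.log (-Complex.I) + Complex.log d := by
    refine (Complex.log_mul_eq_add_log_iff (by simp) hd0).2 ?_
    rw [Complex.arg_neg_I]
    constructor <;> linarith [Real.pi_pos]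
  rw [brLog, h2, Complex.log_neg_I]
  ring

theorem exp_brLog {d : ℂ} (hd : d ≠ 0) : Complex.exp (brLog d) = d := by
  rw [brLog, Complex.exp_add, Complex.exp_log (by simpa using hd),
    Complex.exp_pi_div_two_mul_I]
  linear_combination -d * Complex.I_mul_I

/-- The difference `d` is off the cut `-i [0, ∞)`. -/
def OffCut (d : ℂ) : Prop := d.re ≠ 0 ∨ 0 < d.im

theorem OffCut.ne_zero {d : ℂ} (hd : OffCut d) : d ≠ 0 := by
  rintro rfl
  simp [OffCut] at hd

theorem OffCut.continuous_brLog {k : ℕ} {f : Cube k → ℂ} (hf : Continuous f)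
    (h : ∀ u, OffCut (f u)) : Continuous fun u => brLog (f u) := by
  unfold brLog
  refine Continuous.add (Continuous.clog (continuous_const.mul hf) fun u => ?_) continuous_const
  rw [Complex.mem_slitPlane_iff]
  rcases h u with h | h
  · right
    simpa using h
  · left
    simpa using h

/-- The contour that descends from height `R` to the left of the point `a`, passes below `a` and
ascends to height `R` to the right of it, at distance `w` from `a`. -/
def contour (a : ℂ) (w R t : ℝ) : ℂ :=
  ⟨a.re + w * max (-1) (min 1 (6 * t - 3)),
    (a.im - w) + (R - (a.im - w)) * (max 0 (|6 * t - 3| - 1) / 2)⟩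

/-- The half-width of the `b`-th contour around a point, counted from the innermost one. -/
def width (ε : ℝ) (b : ℕ) : ℝ := ε * ((b + 1) / (b + 2))

/-- The vertical strips of half-width `ε` around the points are ordered from left to right and do
not overlap, and the points lie below the height `R`. -/
structure Admissible {n : ℕ} (z : Fin n → ℂ) (R ε : ℝ) : Prop where
  pos : 0 < ε
  gap : ∀ p r, p < r → (z p).re + 2 * ε ≤ (z r).re
  below : ∀ p, (z p).im < R

section Contours

variable {n : ℕ} {z : Fin n → ℂ} {R ε : ℝ}

theorem width_pos (h : 0 < ε) (b : ℕ) : 0 < width ε b := by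
  unfold width
  positivity

theorem width_lt (h : 0 < ε) (b : ℕ) : width ε b < ε := by
  unfold width
  have : ((b : ℝ) + 1) / (b + 2) < 1 := by
    rw [div_lt_one (by positivity)]
    linarith
  nlinarith

theorem width_strictMono (h : 0 < ε) {b c : ℕ} (hbc : b < c) : width ε b < width ε c := by
  unfold width
  have hbc' : (b : ℝ) < c := by exact_mod_cast hbc
  refine mul_lt_mul_of_pos_left ?_ h
  rw [div_lt_div_iff₀ (by positivity) (by positivity)]
  nlinarith

theorem contour_re_mem (a : ℂ) {w : ℝ} (hw : 0 ≤ w) (R t : ℝ) :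
    a.re - w ≤ (contour a w R t).re ∧ (contour a w R t).re ≤ a.re + w := by
  have h1 : (-1 : ℝ) ≤ max (-1) (min 1 (6 * t - 3)) := le_max_left _ _
  have h2 : max (-1) (min 1 (6 * t - 3)) ≤ (1 : ℝ) := max_le (by norm_num) (min_le_left _ _)
  simp only [contour]
  constructor <;> nlinarith

theorem le_contour_im (a : ℂ) {w R : ℝ} (hR : a.im - w ≤ R) (t : ℝ) :
    a.im - w ≤ (contour a w R t).im := by
  have : 0 ≤ max 0 (|6 * t - 3| - 1) / 2 := by positivity
  simp only [contour]
  nlinarith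

/-- The part of a contour strictly inside its strip is at the bottom. -/
theorem contour_im_eq (a : ℂ) {w : ℝ} (hw : 0 < w) (R t : ℝ)
    (h1 : a.re - w < (contour a w R t).re) (h2 : (contour a w R t).re < a.re + w) :
    (contour a w R t).im = a.im - w := by
  simp only [contour] at h1 h2 ⊢
  have h1' : (-1 : ℝ) < max (-1) (min 1 (6 * t - 3)) := by nlinarith
  have h2' : max (-1) (min 1 (6 * t - 3)) < (1 : ℝ) := by nlinarith
  have h3 : (-1 : ℝ) < 6 * t - 3 := by
    rcases lt_max_iff.1 h1' with h | h
    · exact absurd h (lt_irrefl _)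
    · exact (lt_min_iff.1 h).2
  have h4 : 6 * t - 3 < (1 : ℝ) := by
    rcases min_lt_iff.1 (max_lt_iff.1 h2').2 with h | h
    · exact absurd h (lt_irrefl _)
    · exact h
  have h5 : |6 * t - 3| - 1 ≤ 0 := by
    have := abs_lt.2 ⟨h3, h4⟩
    linarith
  rw [max_eq_left h5]
  ring

/-- The `j`-th contour of the family with `r p` nested contours around the `p`-th point: the point
it goes around and its number, counted from the innermost contour. -/
def label {ℓ : ℕ} (r : Fin n → ℕ) (hr : ∑ p, r p = ℓ) (j : Fin ℓ) : (p : Fin n) × Fin (r p) :=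
  finSigmaFinEquiv.symm (Fin.cast hr.symm j)

/-- The point with parameter `t` on the contour with label `e`. -/
def contourPt (z : Fin n → ℂ) (R ε : ℝ) {r : Fin n → ℕ} (e : (p : Fin n) × Fin (r p)) (t : ℝ) : ℂ :=
  contour (z e.1) (width ε e.2) R t

/-- The contour `e` starts to the left of the contour `f`. -/
def StartsLeft {r : Fin n → ℕ} (e f : (p : Fin n) × Fin (r p)) : Prop :=
  e.1 < f.1 ∨ (e.1 = f.1 ∧ (f.2 : ℕ) < e.2)

instance {r : Fin n → ℕ} (e f : (p : Fin n) × Fin (r p)) : Decidable (StartsLeft e f) :=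
  inferInstanceAs (Decidable (_ ∨ _))

theorem startsLeft_total {r : Fin n → ℕ} {e f : (p : Fin n) × Fin (r p)} (h : e ≠ f) :
    StartsLeft e f ∨ StartsLeft f e := by
  obtain ⟨p, b⟩ := e
  obtain ⟨p', b'⟩ := f
  rcases lt_trichotomy p p' with h1 | h1 | h1
  · exact Or.inl (Or.inl h1)
  · subst h1
    rcases lt_trichotomy (b : ℕ) b' with h2 | h2 | h2
    · exact Or.inr (Or.inr ⟨rfl, h2⟩)
    · exact absurd (by rw [Fin.ext h2]) h
    · exact Or.inl (Or.inr ⟨rfl, h2⟩)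
  · exact Or.inr (Or.inl h1)

theorem offCut_contourPt (hz : Admissible z R ε) {r : Fin n → ℕ} {e f : (p : Fin n) × Fin (r p)}
    (h : StartsLeft e f) (t t' : ℝ) : OffCut (contourPt z R ε f t' - contourPt z R ε e t) := by
  have we := width_pos hz.pos e.2
  have wf := width_pos hz.pos f.2
  have we' := width_lt hz.pos e.2
  have wf' := width_lt hz.pos f.2
  have he := contour_re_mem (z e.1) we.le R t
  have hf := contour_re_mem (z f.1) wf.le R t'
  unfold contourPt
  rcases h with h | ⟨h, hb⟩
  · left
    have := hz.gap _ _ h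
    rw [Complex.sub_re]
    exact (by linarith : _ < _).ne'
  · have hw := width_strictMono hz.pos hb
    have hze : z f.1 = z e.1 := by rw [h]
    rw [hze] at hf ⊢
    by_cases hre : (contour (z e.1) (width ε f.2) R t' - contour (z e.1) (width ε e.2) R t).re = 0
    · right
      rw [Complex.sub_re] at hre
      have h1 := contour_im_eq (z e.1) we R t (by linarith) (by linarith)
      have h2 := le_contour_im (z e.1) (w := width ε f.2) (R := R)
        (by linarith [hz.below e.1]) t'
      rw [Complex.sub_im, h1]
      linarith
    · exact Or.inl hre

theorem offCut_contourPt_point (hz : Admissible z R ε) {r : Fin n → ℕ}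
    (e : (p : Fin n) × Fin (r p)) (p : Fin n) (h : e.1 ≤ p) (t : ℝ) :
    OffCut (z p - contourPt z R ε e t) := by
  have we := width_pos hz.pos e.2
  have we' := width_lt hz.pos e.2
  have he := contour_re_mem (z e.1) we.le R t
  unfold contourPt
  rcases h.lt_or_eq with h | h
  · left
    have := hz.gap _ _ h
    rw [Complex.sub_re]
    exact (by linarith : _ < _).ne'
  · rw [← h]
    by_cases hre : (z e.1 - contour (z e.1) (width ε e.2) R t).re = 0
    · right
      rw [Complex.sub_re] at hre
      have h1 := contour_im_eq (z e.1) we R t (by linarith) (by linarith)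
      rw [Complex.sub_im, h1]
      linarith
    · exact Or.inl hre

theorem offCut_point_contourPt (hz : Admissible z R ε) {r : Fin n → ℕ}
    (e : (p : Fin n) × Fin (r p)) (p : Fin n) (h : p < e.1) (t : ℝ) :
    OffCut (contourPt z R ε e t - z p) := by
  have he := contour_re_mem (z e.1) (width_pos hz.pos e.2).le R t
  have := hz.gap _ _ h
  have := width_lt hz.pos e.2
  have := hz.pos
  left
  unfold contourPt
  rw [Complex.sub_re]
  exact (by linarith : _ < _).ne'

theorem label_injective {ℓ : ℕ} (r : Fin n → ℕ) (hr : ∑ p, r p = ℓ) :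
    Function.Injective (label r hr) := fun j l h => by
  simpa [label] using h

theorem continuous_contourPt {r : Fin n → ℕ} (e : (p : Fin n) × Fin (r p)) :
    Continuous (contourPt z R ε e) := by
  have : contourPt z R ε e = fun t => Complex.equivRealProdCLM.symm
      ((contour (z e.1) (width ε e.2) R t).re, (contour (z e.1) (width ε e.2) R t).im) := by
    funext t
    apply Complex.ext <;> simp [contourPt]
  rw [this]
  refine Complex.equivRealProdCLM.symm.continuous.comp ?_
  simp only [contour]
  fun_prop

/-- The product of the contours, `x_j` running over the `j`-th one. -/
def gsCell (hz : Admissible z R ε) {ℓ : ℕ} (r : Fin n → ℕ) (hr : ∑ p, r p = ℓ) :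
    C(Cube ℓ, Config (fun _ : Unit => z) ℓ) where
  toFun u := ⟨((), fun j => contourPt z R ε (label r hr j) (u j)), by
    refine ⟨fun j l hjl => ?_, fun j p => ?_⟩
    · rcases startsLeft_total ((label_injective r hr).ne hjl) with h | h
      · exact (sub_ne_zero.1 (offCut_contourPt hz h _ _).ne_zero).symm
      · exact sub_ne_zero.1 (offCut_contourPt hz h _ _).ne_zero
    · rcases le_or_gt (label r hr j).1 p with h | h
      · exact (sub_ne_zero.1 (offCut_contourPt_point hz _ p h _).ne_zero).symm
      · exact sub_ne_zero.1 (offCut_point_contourPt hz _ p h _).ne_zero⟩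
  continuous_toFun := by
    refine Continuous.subtype_mk (continuous_const.prodMk (continuous_pi fun j => ?_)) _
    exact (continuous_contourPt _).comp (continuous_subtype_val.comp (continuous_apply j))

/-- The branch of `Ψ` along the product of the contours. At the starting points of the contours it
is `Br(Ψ)`: every factor is the power of (right point) - (left point) given by the principal
logarithm. From there it is continued along the contours; a contour passes below all contours
and points that are to the right of its starting point and that it meets in real part, so
(right point) - (left point) stays off `-i [0, ∞)`. -/
def gsSection (κ : ℝ) (lam : Fin n → ℂ) (z : Fin n → ℂ) (R ε : ℝ) {ℓ : ℕ} (r : Fin n → ℕ)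
    (hr : ∑ p, r p = ℓ) (u : Cube ℓ) : ℂ :=
  Complex.exp
    ((∑ j, ∑ l ∈ Finset.Ioi j, 2 / (κ : ℂ) *
      brLog (if StartsLeft (label r hr j) (label r hr l)
        then contourPt z R ε (label r hr l) (u l) - contourPt z R ε (label r hr j) (u j)
        else contourPt z R ε (label r hr j) (u j) - contourPt z R ε (label r hr l) (u l))) +
    (∑ j, ∑ p, -(lam p / (κ : ℂ)) *
      brLog (if (label r hr j).1 ≤ p
        then z p - contourPt z R ε (label r hr j) (u j)
        else contourPt z R ε (label r hr j) (u j) - z p)) +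
    ∑ p, ∑ s ∈ Finset.Ioi p, lam p * lam s / (2 * (κ : ℂ)) * brLog (z s - z p))

theorem exp_brLog_add {d : ℂ} (hd : d ≠ 0) :
    Complex.exp (brLog d + Real.pi * Complex.I) = -d := by
  rw [Complex.exp_add, exp_brLog hd, Complex.exp_pi_mul_I, mul_neg_one]

theorem isBranch_gsSection (κ : ℝ) (lam : Fin n → ℂ) (hz : Admissible z R ε) {ℓ : ℕ}
    (r : Fin n → ℕ) (hr : ∑ p, r p = ℓ) :
    IsBranch κ lam (fun _ : Unit => z) (gsCell hz r hr) (gsSection κ lam z R ε r hr) := by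
  have hc : ∀ j : Fin ℓ, Continuous fun u : Cube ℓ => contourPt z R ε (label r hr j) (u j) :=
    fun j => (continuous_contourPt _).comp (continuous_subtype_val.comp (continuous_apply j))
  let dL : Fin ℓ → Fin ℓ → ℂ := fun j l =>
    if StartsLeft (label r hr j) (label r hr l) then Real.pi * Complex.I else 0
  let dK : Fin ℓ → Fin n → ℂ := fun j p =>
    if (label r hr j).1 ≤ p then Real.pi * Complex.I else 0
  let D : ℂ := (∑ j, ∑ l ∈ Finset.Ioi j, 2 / (κ : ℂ) * dL j l) +
    (∑ j, ∑ p, -(lam p / (κ : ℂ)) * dK j p) +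
    ∑ p, ∑ s ∈ Finset.Ioi p, lam p * lam s / (2 * (κ : ℂ)) * (Real.pi * Complex.I)
  refine ⟨Complex.exp (-D), fun j l u =>
      brLog (if StartsLeft (label r hr j) (label r hr l)
        then contourPt z R ε (label r hr l) (u l) - contourPt z R ε (label r hr j) (u j)
        else contourPt z R ε (label r hr j) (u j) - contourPt z R ε (label r hr l) (u l)) + dL j l,
    fun j p u => brLog (if (label r hr j).1 ≤ p
        then z p - contourPt z R ε (label r hr j) (u j)
        else contourPt z R ε (label r hr j) (u j) - z p) + dK j p,
    fun p s u => brLog (z s - z p) + Real.pi * Complex.I, ?_, ?_, ?_, ?_⟩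
  · intro j l hjl
    by_cases h : StartsLeft (label r hr j) (label r hr l)
    · simp only [dL, h, if_true]
      refine ⟨(OffCut.continuous_brLog ((hc l).sub (hc j)) fun u =>
        offCut_contourPt hz h _ _).add continuous_const, fun u => ?_⟩
      rw [exp_brLog_add (offCut_contourPt hz h _ _).ne_zero, neg_sub]
      rfl
    · have h' := (startsLeft_total ((label_injective r hr).ne hjl.ne)).resolve_left h
      simp only [dL, h, if_false, add_zero]
      refine ⟨OffCut.continuous_brLog ((hc j).sub (hc l)) fun u =>
        offCut_contourPt hz h' _ _, fun u => ?_⟩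
      rw [exp_brLog (offCut_contourPt hz h' _ _).ne_zero]
      rfl
  · intro j p
    by_cases h : (label r hr j).1 ≤ p
    · simp only [dK, h, if_true]
      refine ⟨(OffCut.continuous_brLog (continuous_const.sub (hc j)) fun u =>
        offCut_contourPt_point hz _ p h _).add continuous_const, fun u => ?_⟩
      rw [exp_brLog_add (offCut_contourPt_point hz _ p h _).ne_zero, neg_sub]
      rfl
    · simp only [dK, h, if_false, add_zero]
      refine ⟨OffCut.continuous_brLog ((hc j).sub continuous_const) fun u =>
        offCut_point_contourPt hz _ p (not_le.1 h) _, fun u => ?_⟩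
      rw [exp_brLog (offCut_point_contourPt hz _ p (not_le.1 h) _).ne_zero]
      rfl
  · intro p s hps
    refine ⟨continuous_const, fun u => ?_⟩
    have hne : z s - z p ≠ 0 := by
      intro h
      have h1 := hz.gap p s hps
      have h2 : (z s - z p).re = 0 := by rw [h]; simp
      rw [Complex.sub_re] at h2
      linarith [hz.pos]
    rw [exp_brLog_add hne, neg_sub]
  · intro u
    rw [gsSection, ← Complex.exp_add]
    congr 1
    simp only [mul_add, Finset.sum_add_distrib, D]
    ring

theorem gs_mem_cycles (κ : ℝ) (lam : Fin n → ℂ) (hz : Admissible z R ε) {ℓ : ℕ}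
    (r : Fin n → ℕ) (hr : ∑ p, r p = ℓ) :
    Finsupp.single (gsCell hz r hr) (gsSection κ lam z R ε r hr) ∈
      cycles κ lam (fun _ : Unit => z) ℓ R ℓ := by
  have hb := isBranch_gsSection κ lam hz r hr
  rcases ℓ with _ | k
  · exact Submodule.subset_span ⟨_, _, hb, rfl⟩
  · refine ⟨Submodule.subset_span ⟨_, _, hb, rfl⟩, ?_⟩
    rw [SetLike.mem_coe, Submodule.mem_comap]
    simp only [boundary, LinearMap.sum_apply, LinearMap.smul_apply, LinearMap.sub_apply,
      face_single]
    have key : ∀ (a : Fin (k + 1)) (e : unitInterval), |6 * (e : ℝ) - 3| = 3 →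
        Finsupp.single ((gsCell hz r hr).comp (faceIncl k a e))
          (gsSection κ lam z R ε r hr ∘ faceIncl k a e) ∈
            trivialChains κ lam (fun _ : Unit => z) (k + 1) R k := by
      intro a e he
      refine Submodule.mem_sup_left (Submodule.subset_span ⟨_, _, hb.comp _, fun u => ⟨a, ?_⟩, rfl⟩)
      have : (((gsCell hz r hr).comp (faceIncl k a e)) u).1.2 a =
          contourPt z R ε (label r hr a) e := by
        simp [gsCell, faceIncl]
      rw [this]
      simp only [contourPt, contour, he]
      norm_num
    refine Submodule.sum_mem _ fun a _ => Submodule.smul_mem _ _ (Submodule.sub_mem _ ?_ ?_)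
    · exact key a 1 (by norm_num)
    · exact key a 0 (by norm_num)

/-- Antisymmetrization over the permutations of the coordinates `x_j`. -/
def antisymmetrize (κ : ℝ) (lam : Fin n → ℂ) (z : Fin n → ℂ) (R : ℝ) (ℓ : ℕ) :
    Homology κ lam (fun _ : Unit => z) ℓ R ℓ →ₗ[ℂ] Homology κ lam (fun _ : Unit => z) ℓ R ℓ :=
  ∑ σ : Equiv.Perm (Fin ℓ), ((Equiv.Perm.sign σ : ℤ) : ℂ) •
    homologyMap (isTwistedMap_configMap (κ := κ) (lam := lam) (lam' := lam)
      (Z := fun _ : Unit => z) (Z' := fun _ : Unit => z) (R := R) (ContinuousMap.id Unit) σ 1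
      (fun _ _ => rfl) (fun _ => rfl)) ℓ

/-- The antisymmetrized Gomez-Sierra chain `G_{r_1,…,r_n}`. -/
def gsChain (κ : ℝ) (lam : Fin n → ℂ) (hz : Admissible z R ε) {ℓ : ℕ} (r : Fin n → ℕ)
    (hr : ∑ p, r p = ℓ) : Homology κ lam (fun _ : Unit => z) ℓ R ℓ :=
  antisymmetrize κ lam z R ℓ
    (Submodule.Quotient.mk ⟨_, gs_mem_cycles κ lam hz r hr⟩)

/-- The space spanned by the antisymmetrized Gomez-Sierra chains with `ℓ` contours. -/
def contourSpace (κ : ℝ) (lam : Fin n → ℂ) (hz : Admissible z R ε) (ℓ : ℕ) :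
    Submodule ℂ (Homology κ lam (fun _ : Unit => z) ℓ R ℓ) :=
  Submodule.span ℂ {c | ∃ (r : Fin n → ℕ) (hr : ∑ p, r p = ℓ), c = gsChain κ lam hz r hr}

/-- The map `φ_z` from the weight space `[∑ lam - 2 ℓ]` to the span of the chains, which sends
`F ^ (k 1) v ⊗ ⋯ ⊗ F ^ (k n) v`, `∑ k = ℓ`, to `G_{k_1,…,k_n}`. -/
def phi (κ : ℝ) (lam : Fin n → ℂ) (hz : Admissible z R ε) (ℓ : ℕ) :
    weightSpace κ lam ℓ →ₗ[ℂ] contourSpace κ lam hz ℓ :=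
  ((vermaTensorBasis κ lam).constr ℂ fun k =>
    if h : ∑ p, k p = ℓ then
      (⟨gsChain κ lam hz k h, Submodule.subset_span ⟨k, h, rfl⟩⟩ : contourSpace κ lam hz ℓ)
    else 0) ∘ₗ (weightSpace κ lam ℓ).subtype

end Contours

/-! ### The monodromy operator -/

section Monodromy

variable {n : ℕ}

/-- The path along which the points `i` and `i + 1` are interchanged by a half-turn. -/
def exchangePath (i : Fin n) (z : Fin (n + 1) → ℂ) (t : unitInterval) (p : Fin (n + 1)) : ℂ :=
  if p = i.castSucc then
    1 / 2 * ((z i.castSucc + z i.succ) +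
      (z i.castSucc - z i.succ) * Complex.exp (Real.pi * Complex.I * (t : ℝ)))
  else if p = i.succ then
    1 / 2 * ((z i.castSucc + z i.succ) +
      (z i.succ - z i.castSucc) * Complex.exp (Real.pi * Complex.I * (t : ℝ)))
  else z p

theorem exchangePath_zero (i : Fin n) (z : Fin (n + 1) → ℂ) (p : Fin (n + 1)) :
    exchangePath i z 0 p = z p := by
  unfold exchangePath
  split_ifs with h1 h2
  · rw [h1]; simp; ring
  · rw [h2]; simp; ring
  · rfl

theorem exchangePath_one (i : Fin n) (z : Fin (n + 1) → ℂ) (p : Fin (n + 1)) :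
    exchangePath i z 1 p = z (swapAt i p) := by
  unfold exchangePath swapAt
  split_ifs with h1 h2
  · rw [h1]; simp; ring
  · rw [h2]; simp; ring
  · rw [Equiv.swap_apply_of_ne_of_ne h1 h2]

variable (κ : ℝ) (lam z : Fin (n + 1) → ℂ) (R : ℝ) (ℓ : ℕ) (i : Fin n)

/-- The homology of the fibre at the start of the path maps to the homology of the family of
configuration spaces over the path. -/
def inclStart : Homology κ lam (fun _ : Unit => z) ℓ R ℓ →ₗ[ℂ]
    Homology κ lam (exchangePath i z) ℓ R ℓ :=
  homologyMap (isTwistedMap_configMap (lam := lam) (lam' := lam)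
    (ContinuousMap.const Unit (0 : unitInterval)) 1 1
    (fun _ p => exchangePath_zero i z p) (fun _ => rfl)) ℓ

/-- The same for the fibre at the end of the path; there the point with weight `lam (i + 1)` is in
the place of `z i` and the point with weight `lam i` in the place of `z (i + 1)`. -/
def inclEnd : Homology κ (lam ∘ swapAt i) (fun _ : Unit => z) ℓ R ℓ →ₗ[ℂ]
    Homology κ lam (exchangePath i z) ℓ R ℓ :=
  homologyMap (isTwistedMap_configMap (lam := lam ∘ swapAt i) (lam' := lam)
    (ContinuousMap.const Unit (1 : unitInterval)) 1 (swapAt i)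
    (fun _ p => exchangePath_one i z p) (fun p => by simp [swapAt])) ℓ

/-- `A` is the monodromy (parallel transport) along the path: a class and its image under `A`
agree in the homology of the family over the path. -/
def IsMonodromy {κ : ℝ} {lam z : Fin (n + 1) → ℂ} {R ε : ℝ} {hz : Admissible z R ε} {ℓ : ℕ}
    (i : Fin n)
    (A : contourSpace κ lam hz ℓ →ₗ[ℂ] contourSpace κ (lam ∘ swapAt i) hz ℓ) : Prop :=
  ∀ c, inclEnd κ lam z R ℓ i (A c) = inclStart κ lam z R ℓ i c

end Monodromy

end

end GomezSierra

/-! Over the path the configuration spaces form a family, and the fibre over `t = 1` is a retract of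
it: turn the disc through the remaining angle `π (1 - t)` and damp this twist to zero in a collar
that stays below height `R` and contains no other point in its interior. Hence `inclEnd` is
injective (`pushClass_end_injective`) and a monodromy operator is unique. Its existence and the
formula both follow once the class of each `G` at the start is written, in the homology of the
family, as the combination of chains at the end that `Ř` prescribes (`startClass_eq_sum`). No linear
independence of the chains is needed.

This is proved by induction on the number `a` of contours around the left point `z_i`.

For `a = 0` the contours around `z_{i+1}` are carried along rigidly: the right point passes above
the left one, which slips through below its contours. The strips of the other points could be hit on
the way, so these points are first moved apart, and the horizontal map `closeMap` brings everything
back over the true path. Only a phase appears, one `πi` for each difference whose order from left to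
right is reversed (`pushClass_start_gsClass_of_eq_zero`).

For the step, a new variable is let run around all points and all other variables. This operation is
defined on the whole family and commutes with the inclusions of both end fibres. In a fibre the big
contour can be cut between the points, and after antisymmetrization the pieces carry the
coefficients of the iterated coproduct of `F` (`antiClass_addContourClass_gsClass`). At the start
this relation is solved for the chain with `a + 1` contours around `z_i`: its coefficient is
invertible, and all other terms have only `a` contours there. The matrix of `Ř` satisfies the same
recursion, because `Ř` intertwines the coproducts of `F` (`rCoeff_add_one_succ`), and it has the
same initial values.

The computations take place in `ChainClass`, all chains modulo relative boundaries, so that no cycle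
condition has to be carried along; homology embeds in it. Orientations cause no signs: permuting the
parameters of a cube gives the sign of the permutation, which cancels the sign from
antisymmetrization, so an antisymmetrized product depends only on its set of contours
(`labelClass_congr`). -/

namespace GomezSierra

noncomputable section

open scoped TensorProduct
open Module

/-! ### Classes of chains modulo relative boundaries -/

section Classes

variable {B B' : Type} [TopologicalSpace B] [TopologicalSpace B'] {n : ℕ}
  {κ : ℝ} {lam lam' : Fin n → ℂ} {Z : B → Fin n → ℂ} {Z' : B' → Fin n → ℂ} {ℓ : ℕ} {R : ℝ}

/-- Chains modulo relative boundaries; this contains the homology. -/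
abbrev ChainClass (κ : ℝ) (lam : Fin n → ℂ) (Z : B → Fin n → ℂ) (ℓ : ℕ) (R : ℝ) (k : ℕ) : Type :=
  PreChain Z ℓ k ⧸ boundaries κ lam Z ℓ R k

/-- The class of a singular cube with a section. -/
def cubeClass (κ : ℝ) (lam : Fin n → ℂ) (R : ℝ) {k : ℕ} (y : C(Cube k, Config Z ℓ))
    (s : Cube k → ℂ) : ChainClass κ lam Z ℓ R k :=
  (boundaries κ lam Z ℓ R k).mkQ (Finsupp.single y s)

theorem cubeClass_smul {k : ℕ} (y : C(Cube k, Config Z ℓ)) (c : ℂ) (s : Cube k → ℂ) :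
    cubeClass κ lam R y (c • s) = c • cubeClass κ lam R y s := by
  rw [cubeClass, cubeClass, ← map_smul, Finsupp.smul_single]

theorem cubeClass_eq_zero_of_infinity {k : ℕ} {y : C(Cube k, Config Z ℓ)} {s : Cube k → ℂ}
    (h : IsBranch κ lam Z y s) (hy : ∀ u, y u ∈ infinity Z ℓ R) :
    cubeClass κ lam R y s = 0 :=
  (Submodule.Quotient.mk_eq_zero _).2 (Submodule.mem_sup_left (Submodule.mem_sup_left
    (Submodule.subset_span ⟨y, s, h, hy, rfl⟩)))

theorem cubeClass_eq_zero_of_degenerate {k : ℕ} {y : C(Cube k, Config Z ℓ)} {s : Cube k → ℂ}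
    (h : IsBranch κ lam Z y s) (a : Fin k)
    (hy : ∀ u v : Cube k, (∀ b, b ≠ a → u b = v b) → y u = y v) :
    cubeClass κ lam R y s = 0 :=
  (Submodule.Quotient.mk_eq_zero _).2 (Submodule.mem_sup_left (Submodule.mem_sup_right
    (Submodule.subset_span ⟨y, s, h, ⟨a, hy⟩, rfl⟩)))

/-- The class of the face `u_a = e`. -/
def faceClass (κ : ℝ) (lam : Fin n → ℂ) (R : ℝ) {k : ℕ} (y : C(Cube (k + 1), Config Z ℓ))
    (s : Cube (k + 1) → ℂ) (a : Fin (k + 1)) (e : unitInterval) : ChainClass κ lam Z ℓ R k :=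
  cubeClass κ lam R (y.comp (faceIncl k a e)) (s ∘ faceIncl k a e)

/-- The signed sum is the class of the boundary of the cube, a relative boundary because the section
is flat. All deformations and cuttings of contours below are instances of this relation. -/
theorem sum_faceClass {k : ℕ} {y : C(Cube (k + 1), Config Z ℓ)} {s : Cube (k + 1) → ℂ}
    (h : IsBranch κ lam Z y s) :
    ∑ a : Fin (k + 1), ((-1 : ℂ) ^ (a : ℕ)) •
      (faceClass κ lam R y s a 1 - faceClass κ lam R y s a 0) = 0 := by
  have key : (boundaries κ lam Z ℓ R k).mkQ (boundary Z ℓ k (Finsupp.single y s)) = 0 :=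
    (Submodule.Quotient.mk_eq_zero _).2 (Submodule.mem_sup_right
      ⟨_, Submodule.subset_span ⟨y, s, h, rfl⟩, rfl⟩)
  rw [← key]
  simp only [boundary, LinearMap.sum_apply, LinearMap.smul_apply, LinearMap.sub_apply,
    face_single, map_sum, map_smul, map_sub]
  rfl

theorem faceIncl_self (k : ℕ) (a : Fin (k + 1)) (e : unitInterval) (u : Cube k) :
    faceIncl k a e u a = e := by
  simp [faceIncl]

theorem faceIncl_zero_succ (k : ℕ) (e : unitInterval) (u : Cube k) (j : Fin k) :
    faceIncl k 0 e u j.succ = u j := by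
  simp [faceIncl]

theorem faceIncl_one_zero (k : ℕ) (e : unitInterval) (u : Cube (k + 1)) :
    faceIncl (k + 1) 1 e u 0 = u 0 := by
  have := Fin.insertNth_apply_succAbove (α := fun _ => unitInterval) (1 : Fin (k + 2)) e u 0
  simpa [faceIncl] using this

theorem faceIncl_one_succ (k : ℕ) (e : unitInterval) (u : Cube (k + 1)) (j : Fin k) :
    faceIncl (k + 1) 1 e u j.succ.succ = u j.succ := by
  have := Fin.insertNth_apply_succAbove (α := fun _ => unitInterval) (1 : Fin (k + 2)) e u j.succ
  have h1 : (1 : Fin (k + 2)).succAbove j.succ = j.succ.succ := by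
    rw [show (1 : Fin (k + 2)) = Fin.succ 0 from rfl, Fin.succ_succAbove_succ]
    simp
  rw [h1] at this
  exact this

theorem faceClass_eq_zero {k : ℕ} {y : C(Cube (k + 1), Config Z ℓ)} {s : Cube (k + 1) → ℂ}
    (h : IsBranch κ lam Z y s) {a : Fin (k + 1)} {e : unitInterval}
    (hy : ∀ u, u a = e → y u ∈ infinity Z ℓ R) : faceClass κ lam R y s a e = 0 :=
  cubeClass_eq_zero_of_infinity (h.comp _) fun u => hy _ (faceIncl_self k a e u)

/-- A homotopy of singular cubes that keeps the boundary at infinity. -/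
theorem faceClass_zero_eq {k : ℕ} {y : C(Cube (k + 1), Config Z ℓ)} {s : Cube (k + 1) → ℂ}
    (h : IsBranch κ lam Z y s)
    (hy : ∀ (a : Fin k) u, (u a.succ = 0 ∨ u a.succ = 1) → y u ∈ infinity Z ℓ R) :
    faceClass κ lam R y s 0 1 = faceClass κ lam R y s 0 0 := by
  have := sum_faceClass (R := R) h
  rw [Fin.sum_univ_succ, Finset.sum_eq_zero] at this
  · simpa [sub_eq_zero] using this
  · intro a _
    rw [faceClass_eq_zero h fun u hu => hy a u (Or.inr hu),
      faceClass_eq_zero h fun u hu => hy a u (Or.inl hu)]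
    simp

/-- The relation between the faces of a cube in the first two directions, when the other faces are
at infinity. -/
theorem faceClass_square {k : ℕ} {y : C(Cube (k + 2), Config Z ℓ)} {s : Cube (k + 2) → ℂ}
    (h : IsBranch κ lam Z y s)
    (hy : ∀ (a : Fin k) u, (u a.succ.succ = 0 ∨ u a.succ.succ = 1) → y u ∈ infinity Z ℓ R) :
    faceClass κ lam R y s 0 1 + faceClass κ lam R y s 1 0 =
      faceClass κ lam R y s 0 0 + faceClass κ lam R y s 1 1 := by
  have := sum_faceClass (R := R) h
  rw [Fin.sum_univ_succ, Fin.sum_univ_succ, Finset.sum_eq_zero] at this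
  · rw [← sub_eq_zero, ← this]
    simp
    abel
  · intro a _
    rw [faceClass_eq_zero h fun u hu => hy a u (Or.inr hu),
      faceClass_eq_zero h fun u hu => hy a u (Or.inl hu)]
    simp

/-! #### Reparametrization of cubes -/

/-- The boundary of a cube. -/
def cubeBoundary (k : ℕ) : Set (Cube k) := {u | ∃ a, u a = 0 ∨ u a = 1}

/-- The first coordinate of the larger cube is the time of a homotopy of reparametrizations. The
homotopy keeps the boundary of the cube in the boundary, which `y` sends to infinity, so only the
two end faces survive. -/
theorem cubeClass_comp_eq {k : ℕ} {y : C(Cube k, Config Z ℓ)} {s : Cube k → ℂ}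
    (h : IsBranch κ lam Z y s) (hy : ∀ u ∈ cubeBoundary k, y u ∈ infinity Z ℓ R)
    (f : C(Cube (k + 1), Cube k))
    (hf : ∀ (a : Fin k) u, (u a.succ = 0 ∨ u a.succ = 1) → f u ∈ cubeBoundary k)
    {f₀ f₁ : C(Cube k, Cube k)} (h₀ : f.comp (faceIncl k 0 0) = f₀)
    (h₁ : f.comp (faceIncl k 0 1) = f₁) :
    cubeClass κ lam R (y.comp f₁) (s ∘ f₁) = cubeClass κ lam R (y.comp f₀) (s ∘ f₀) := by
  subst h₀ h₁
  exact faceClass_zero_eq (h.comp f) fun a u hu => hy _ (hf a u hu)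

/-- The reflection of a cube in one coordinate. -/
def cubeReflect {k : ℕ} (a : Fin k) : C(Cube k, Cube k) where
  toFun u := Function.update u a (unitInterval.symm (u a))
  continuous_toFun := by fun_prop

/-- The rotation of a cube in two coordinates by a right angle. -/
def cubeRotate {k : ℕ} (a b : Fin k) : C(Cube k, Cube k) where
  toFun u := Function.update (Function.update u a (unitInterval.symm (u b))) b (u a)
  continuous_toFun := by fun_prop

/-- The permutation of the coordinates of a cube. -/
def cubePerm {k : ℕ} (π : Equiv.Perm (Fin k)) : C(Cube k, Cube k) where
  toFun u := u ∘ π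
  continuous_toFun := by fun_prop

theorem cubeReflect_mem {k : ℕ} (a : Fin k) {u : Cube k} (hu : u ∈ cubeBoundary k) :
    cubeReflect a u ∈ cubeBoundary k := by
  obtain ⟨b, hb⟩ := hu
  refine ⟨b, ?_⟩
  by_cases h : b = a
  · subst h
    rcases hb with hb | hb <;> simp [cubeReflect, hb]
  · simpa [cubeReflect, h] using hb

theorem cubeRotate_mem {k : ℕ} {a b : Fin k} (hab : a ≠ b) {u : Cube k}
    (hu : u ∈ cubeBoundary k) : cubeRotate a b u ∈ cubeBoundary k := by
  obtain ⟨c, hc⟩ := hu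
  by_cases h : c = a
  · subst h
    exact ⟨b, by simpa [cubeRotate] using hc⟩
  · by_cases h' : c = b
    · subst h'
      refine ⟨a, ?_⟩
      rcases hc with hc | hc <;> simp [cubeRotate, hc, hab]
    · exact ⟨c, by simpa [cubeRotate, h, h'] using hc⟩

theorem cubePerm_mem {k : ℕ} (π : Equiv.Perm (Fin k)) {u : Cube k} (hu : u ∈ cubeBoundary k) :
    cubePerm π u ∈ cubeBoundary k := by
  obtain ⟨c, hc⟩ := hu
  exact ⟨π.symm c, by simpa [cubePerm] using hc⟩

/-- In the square with coordinates `u 0`, `u 1` the function `u 1 * (1 - u 0)` vanishes on the sides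
`u 0 = 1` and `u 1 = 0`, which therefore go to infinity. It gives the identity on `u 0 = 0` and the
reflection on `u 1 = 1`; the relation between the four sides yields the sign. -/
theorem cubeClass_cubeReflect_zero {k : ℕ} {y : C(Cube (k + 1), Config Z ℓ)}
    {s : Cube (k + 1) → ℂ} (h : IsBranch κ lam Z y s)
    (hy : ∀ u ∈ cubeBoundary (k + 1), y u ∈ infinity Z ℓ R) :
    cubeClass κ lam R (y.comp (cubeReflect 0)) (s ∘ cubeReflect 0) =
      -cubeClass κ lam R y s := by
  let f : C(Cube (k + 2), Cube (k + 1)) :=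
    ⟨fun u => Fin.cons (u 1 * unitInterval.symm (u 0)) fun j => u j.succ.succ, by fun_prop⟩
  have key := faceClass_square (R := R) (h.comp f) fun a u hu => hy _ ⟨a.succ, by simpa [f] using hu⟩
  rw [faceClass_eq_zero (a := 0) (e := 1) (h.comp f) fun u hu => hy _ ⟨0, by simp [f, hu]⟩,
    faceClass_eq_zero (a := 1) (e := 0) (h.comp f) fun u hu => hy _ ⟨0, by simp [f, hu]⟩] at key
  have e1 : f.comp (faceIncl (k + 1) 0 0) = ContinuousMap.id _ := by
    ext u j
    refine Fin.cases ?_ (fun j => ?_) j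
    · have h1 := faceIncl_zero_succ (k + 1) 0 u 0
      have h2 := faceIncl_self (k + 1) 0 0 u
      simp only [Fin.succ_zero_eq_one] at h1
      simp [f, h1, h2]
    · simp [f, faceIncl_zero_succ]
  have e2 : f.comp (faceIncl (k + 1) 1 1) = cubeReflect 0 := by
    ext u j
    refine Fin.cases ?_ (fun j => ?_) j
    · simp [f, faceIncl_self, faceIncl_one_zero, cubeReflect]
    · simp [f, faceIncl_one_succ, cubeReflect]
  have e1' : faceClass κ lam R (y.comp f) (s ∘ f) 0 0 = cubeClass κ lam R y s := by
    change cubeClass κ lam R (y.comp (f.comp (faceIncl (k + 1) 0 0)))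
      (s ∘ (f.comp (faceIncl (k + 1) 0 0))) = _
    rw [e1]
    rfl
  have e2' : faceClass κ lam R (y.comp f) (s ∘ f) 1 1 =
      cubeClass κ lam R (y.comp (cubeReflect 0)) (s ∘ cubeReflect 0) := by
    rw [← e2]
    rfl
  rw [e1', e2', add_zero] at key
  exact (neg_eq_of_add_eq_zero_right key.symm).symm

/-- A linear homotopy, rescaled so that the boundary of the square stays outside the open square,
from the identity to the rotation by a right angle, for coordinates in `[-1, 1]`. -/
def rotateCoord (τ p q : ℝ) : ℝ := (1 + 4 * τ * (1 - τ)) * ((1 - τ) * p + τ * q)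

/-- Let `A`, `B` be the two rotated coordinates before rescaling by `c = 1 + 4 τ (1 - τ)`. Then `(1
- τ) A + τ B = (τ² + (1 - τ)²) p` and `(1 - τ) B - τ A = (τ² + (1 - τ)²) q`. Since `c (τ² + (1 -
τ)²) ≥ 1`, a convex combination of `± c A` and `± c B` has modulus at least `1`, hence one of them
has. -/
theorem one_le_rotateCoord {τ p q : ℝ} (h0 : 0 ≤ τ) (h1 : τ ≤ 1)
    (h : |p| = 1 ∨ |q| = 1) :
    1 ≤ |rotateCoord τ p (-q)| ∨ 1 ≤ |rotateCoord τ q p| := by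
  by_contra! hlt
  obtain ⟨ha, hb⟩ := hlt
  rw [abs_lt] at ha hb
  unfold rotateCoord at ha hb
  have hm : 0 ≤ τ * (1 - τ) := mul_nonneg h0 (by linarith)
  have hm' : τ * (1 - τ) ≤ 1 / 4 := by nlinarith [sq_nonneg (2 * τ - 1)]
  set c := 1 + 4 * τ * (1 - τ) with hc
  have hcm : 1 ≤ c * (τ ^ 2 + (1 - τ) ^ 2) := by nlinarith
  rcases h with h | h
  · rcases (abs_eq (by norm_num)).1 h with rfl | rfl
    · rcases h0.eq_or_lt with rfl | h0
      · norm_num [hc] at ha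
      · nlinarith
    · rcases h0.eq_or_lt with rfl | h0
      · norm_num [hc] at ha
      · nlinarith
  · rcases (abs_eq (by norm_num)).1 h with rfl | rfl
    · rcases h0.eq_or_lt with rfl | h0
      · norm_num [hc] at hb
      · nlinarith
    · rcases h0.eq_or_lt with rfl | h0
      · norm_num [hc] at hb
      · nlinarith

/-- The point of the unit interval nearest to `(1 + p) / 2`. -/
def toUnit (p : ℝ) : unitInterval := Set.projIcc 0 1 zero_le_one ((1 + p) / 2)

theorem continuous_toUnit : Continuous toUnit := by unfold toUnit; fun_prop

theorem toUnit_of_one_le_abs {p : ℝ} (h : 1 ≤ |p|) : toUnit p = 0 ∨ toUnit p = 1 := by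
  rcases le_abs.1 h with h | h
  · exact Or.inr (Set.projIcc_of_right_le _ (by linarith))
  · exact Or.inl (Set.projIcc_of_le_left _ (by linarith))

theorem toUnit_coe (v : unitInterval) : toUnit (2 * v - 1) = v := by
  rw [toUnit, show (1 + (2 * (v : ℝ) - 1)) / 2 = v by ring, Set.projIcc_val]

/-- A quarter-turn is homotopic to the identity. Clamping by `toUnit` makes the homotopy one of the
cube, and by `one_le_rotateCoord` the image of a boundary point is clamped to the boundary, hence
stays at infinity. -/
theorem cubeClass_cubeRotate {k : ℕ} {a b : Fin k} (hab : a ≠ b) {y : C(Cube k, Config Z ℓ)}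
    {s : Cube k → ℂ} (h : IsBranch κ lam Z y s)
    (hy : ∀ u ∈ cubeBoundary k, y u ∈ infinity Z ℓ R) :
    cubeClass κ lam R (y.comp (cubeRotate a b)) (s ∘ cubeRotate a b) =
      cubeClass κ lam R y s := by
  let f : C(Cube (k + 1), Cube k) :=
    ⟨fun u => Function.update (Function.update (fun j => u j.succ) a
        (toUnit (rotateCoord (u 0) (2 * u a.succ - 1) (-(2 * u b.succ - 1))))) b
        (toUnit (rotateCoord (u 0) (2 * u b.succ - 1) (2 * u a.succ - 1))), by
      refine Continuous.update (Continuous.update (by fun_prop) _ ?_) _ ?_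
      all_goals
        refine continuous_toUnit.comp ?_
        unfold rotateCoord
        fun_prop⟩
  refine cubeClass_comp_eq h hy f ?_ (f₀ := ContinuousMap.id _) ?_ ?_
  · intro c u hu
    have key : |2 * (u c.succ : ℝ) - 1| = 1 := by
      rcases hu with hu | hu <;> rw [hu] <;> norm_num
    have := fun h => one_le_rotateCoord (τ := u 0) (p := 2 * u a.succ - 1) (q := 2 * u b.succ - 1)
      (u 0).2.1 (u 0).2.2 h
    by_cases hca : c = a
    · rw [hca] at key
      rcases this (Or.inl key) with h1 | h1
      · exact ⟨a, by simpa [f, hab] using toUnit_of_one_le_abs h1⟩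
      · exact ⟨b, by simpa [f] using toUnit_of_one_le_abs h1⟩
    · by_cases hcb : c = b
      · rw [hcb] at key
        rcases this (Or.inr key) with h1 | h1
        · exact ⟨a, by simpa [f, hab] using toUnit_of_one_le_abs h1⟩
        · exact ⟨b, by simpa [f] using toUnit_of_one_le_abs h1⟩
      · exact ⟨c, by simpa [f, hca, hcb] using hu⟩
  · ext u j : 2
    by_cases hjb : j = b
    · subst hjb
      simp [f, faceIncl_self, faceIncl_zero_succ, rotateCoord, toUnit_coe]
    · by_cases hja : j = a
      · subst hja
        simp [f, hab, faceIncl_self, faceIncl_zero_succ, rotateCoord, toUnit_coe]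
      · simp [f, hja, hjb, faceIncl_zero_succ]
  · ext u j : 2
    by_cases hjb : j = b
    · subst hjb
      simp [f, faceIncl_self, faceIncl_zero_succ, rotateCoord, toUnit_coe, cubeRotate]
    · by_cases hja : j = a
      · subst hja
        have := toUnit_coe (unitInterval.symm (u b))
        rw [unitInterval.coe_symm_eq] at this
        simp only [f, hab, faceIncl_self, faceIncl_zero_succ, rotateCoord, cubeRotate,
          ContinuousMap.comp_apply, ContinuousMap.coe_mk, Function.update_self, ne_eq,
          not_false_eq_true, Function.update_of_ne]
        rw [← this]
        congr 1
        simp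
        ring
      · simp [f, hja, hjb, faceIncl_zero_succ, cubeRotate]

theorem cubeClass_cubeReflect {k : ℕ} (a : Fin k) {y : C(Cube k, Config Z ℓ)}
    {s : Cube k → ℂ} (h : IsBranch κ lam Z y s)
    (hy : ∀ u ∈ cubeBoundary k, y u ∈ infinity Z ℓ R) :
    cubeClass κ lam R (y.comp (cubeReflect a)) (s ∘ cubeReflect a) = -cubeClass κ lam R y s := by
  rcases k with _ | k
  · exact a.elim0
  by_cases ha : a = 0
  · subst ha
    exact cubeClass_cubeReflect_zero h hy
  have ha' : (0 : Fin (k + 1)) ≠ a := fun e => ha e.symm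
  -- The reflection in the coordinate `a` is the one in the coordinate `0` conjugated by a
  -- quarter-turn of these two coordinates, and quarter-turns do not change classes.
  have e : cubeReflect a = ((cubeRotate 0 a).comp (cubeReflect 0)).comp (cubeRotate a 0) := by
    ext u j : 2
    by_cases h0 : j = 0
    · subst h0
      simp [cubeReflect, cubeRotate, ha, ha']
    · by_cases h1 : j = a
      · subst h1
        simp [cubeReflect, cubeRotate]
      · simp [cubeReflect, cubeRotate, h0, h1]
  have hy1 : ∀ u ∈ cubeBoundary (k + 1), y.comp (cubeRotate 0 a) u ∈ infinity Z ℓ R :=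
    fun u hu => hy _ (cubeRotate_mem ha' hu)
  have h2 := cubeClass_cubeRotate (R := R) ha ((h.comp (cubeRotate 0 a)).comp (cubeReflect 0))
    fun u hu => hy1 _ (cubeReflect_mem _ hu)
  rw [e]
  refine h2.trans ?_
  rw [cubeClass_cubeReflect_zero (h.comp (cubeRotate 0 a)) hy1, cubeClass_cubeRotate ha' h hy]

theorem cubeClass_cubePerm {k : ℕ} (π : Equiv.Perm (Fin k)) :
    ∀ {y : C(Cube k, Config Z ℓ)} {s : Cube k → ℂ}, IsBranch κ lam Z y s →
    (∀ u ∈ cubeBoundary k, y u ∈ infinity Z ℓ R) →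
    cubeClass κ lam R (y.comp (cubePerm π)) (s ∘ cubePerm π) =
      ((Equiv.Perm.sign π : ℤ) : ℂ) • cubeClass κ lam R y s := by
  induction π using Equiv.Perm.swap_induction_on with
  | one =>
    intro y s _ _
    simp
    rfl
  | swap_mul f a b hab ih =>
    intro y s h hy
    -- A transposition of coordinates is a quarter-turn composed with a reflection, so each one
    -- contributes a factor `-1`.
    have e : cubePerm (Equiv.swap a b * f) =
        (cubePerm f).comp ((cubeRotate a b).comp (cubeReflect b)) := by
      ext u j : 2
      by_cases h0 : f j = b
      · simp [cubePerm, cubeReflect, cubeRotate, h0, hab]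
      · by_cases h1 : f j = a
        · simp [cubePerm, cubeReflect, cubeRotate, h1, hab]
        · simp [cubePerm, cubeReflect, cubeRotate, h0, h1, Equiv.swap_apply_of_ne_of_ne]
    have h1 := h.comp (cubePerm f)
    have hy1 : ∀ u ∈ cubeBoundary k, y.comp (cubePerm f) u ∈ infinity Z ℓ R :=
      fun u hu => hy _ (cubePerm_mem f hu)
    have h2 := cubeClass_cubeReflect (R := R) b (h1.comp (cubeRotate a b))
      fun u hu => hy1 _ (cubeRotate_mem hab hu)
    rw [e]
    refine h2.trans ?_
    rw [cubeClass_cubeRotate hab h1 hy1, ih h hy, Equiv.Perm.sign_mul, Equiv.Perm.sign_swap hab]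
    simp

end Classes

/-! ### Push-forward, antisymmetrization, and the operator that adds a contour around everything -/

section Operators

variable {B B' : Type} [TopologicalSpace B] [TopologicalSpace B'] {n : ℕ}
  {κ : ℝ} {lam lam' : Fin n → ℂ} {Z : B → Fin n → ℂ} {Z' : B' → Fin n → ℂ} {ℓ : ℕ} {R : ℝ}

/-- The map induced on classes of chains. -/
def pushClass {g : C(Config Z ℓ, Config Z' ℓ)} (hg : IsTwistedMap κ lam lam' Z Z' ℓ R g)
    (k : ℕ) : ChainClass κ lam Z ℓ R k →ₗ[ℂ] ChainClass κ lam' Z' ℓ R k :=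
  Submodule.mapQ _ _ (push g k) (push_mem_boundaries hg k)

theorem pushClass_cubeClass {g : C(Config Z ℓ, Config Z' ℓ)}
    (hg : IsTwistedMap κ lam lam' Z Z' ℓ R g) {k : ℕ} (y : C(Cube k, Config Z ℓ))
    (s : Cube k → ℂ) :
    pushClass hg k (cubeClass κ lam R y s) = cubeClass κ lam' R (g.comp y) s := by
  rw [cubeClass, pushClass, Submodule.mkQ_apply, Submodule.mapQ_apply, push_single]
  rfl

theorem chainClass_ext {k : ℕ} {V : Type} [AddCommGroup V] [Module ℂ V]
    {f g : ChainClass κ lam Z ℓ R k →ₗ[ℂ] V}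
    (h : ∀ y s, f (cubeClass κ lam R y s) = g (cubeClass κ lam R y s)) : f = g := by
  refine Submodule.linearMap_qext _ (Finsupp.lhom_ext fun y s => h y s)

/-! #### Antisymmetrization -/

/-- The permutation of the coordinates of the configuration space. -/
theorem isTwistedMap_perm (κ : ℝ) (lam : Fin n → ℂ) (Z : B → Fin n → ℂ) (R : ℝ)
    (σ : Equiv.Perm (Fin ℓ)) :
    IsTwistedMap κ lam lam Z Z ℓ R (configMap (ContinuousMap.id B) σ 1 fun _ _ => rfl) :=
  isTwistedMap_configMap _ _ _ _ fun _ => rfl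

/-- Antisymmetrization of classes of chains. -/
def antiClass (κ : ℝ) (lam : Fin n → ℂ) (Z : B → Fin n → ℂ) (ℓ : ℕ) (R : ℝ) (k : ℕ) :
    ChainClass κ lam Z ℓ R k →ₗ[ℂ] ChainClass κ lam Z ℓ R k :=
  ∑ σ : Equiv.Perm (Fin ℓ), ((Equiv.Perm.sign σ : ℤ) : ℂ) •
    pushClass (isTwistedMap_perm κ lam Z R σ) k

/-- Reindex the sum over the group by left translation with `σ`; the sign comes out because it
squares to `1`. -/
theorem antiClass_comp_perm (k : ℕ) (σ : Equiv.Perm (Fin ℓ)) :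
    antiClass κ lam Z ℓ R k ∘ₗ pushClass (isTwistedMap_perm κ lam Z R σ) k =
      ((Equiv.Perm.sign σ : ℤ) : ℂ) • antiClass κ lam Z ℓ R k := by
  refine chainClass_ext fun y s => ?_
  simp only [antiClass, LinearMap.comp_apply, LinearMap.sum_apply, LinearMap.smul_apply,
    pushClass_cubeClass, Finset.smul_sum, smul_smul]
  conv_rhs => rw [← Equiv.sum_comp (Equiv.mulLeft σ)]
  refine Finset.sum_congr rfl fun σ' _ => ?_
  have h : ((Equiv.Perm.sign σ : ℤ) : ℂ) * ((Equiv.Perm.sign σ : ℤ) : ℂ) = 1 := by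
    exact_mod_cast Int.units_coe_mul_self (Equiv.Perm.sign σ)
  simp only [Equiv.coe_mulLeft, Equiv.Perm.sign_mul, Units.val_mul, Int.cast_mul, ← mul_assoc, h,
    one_mul]
  rfl

theorem antiClass_comp_pushClass (β : C(B, B')) (τ : Equiv.Perm (Fin n))
    (hZ : ∀ b p, Z' (β b) p = Z b (τ p)) (hlam : ∀ p, lam' p = lam (τ p)) (k : ℕ) :
    antiClass κ lam' Z' ℓ R k ∘ₗ pushClass (isTwistedMap_configMap β 1 τ hZ hlam) k =
      pushClass (isTwistedMap_configMap β 1 τ hZ hlam) k ∘ₗ antiClass κ lam Z ℓ R k := by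
  refine chainClass_ext fun y s => ?_
  simp only [antiClass, LinearMap.comp_apply, LinearMap.sum_apply, LinearMap.smul_apply,
    pushClass_cubeClass, map_sum, map_smul]
  rfl

/-! #### Adding a variable below all others -/

/-- The point `w` is on no vertical ray upwards from a variable or a point `Z_p`. -/
def Below (c : Config Z ℓ) (w : ℂ) : Prop :=
  (∀ j, OffCut (c.1.2 j - w)) ∧ ∀ p, OffCut (Z c.1.1 p - w)

/-- The product of the factors of `Ψ` that involve the new variable `w`. -/
def consFactor (κ : ℝ) (lam : Fin n → ℂ) (c : Config Z ℓ) (w : ℂ) : ℂ :=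
  Complex.exp ((∑ j, 2 / (κ : ℂ) * brLog (c.1.2 j - w)) +
    ∑ p, -(lam p / (κ : ℂ)) * brLog (Z c.1.1 p - w))

/-- A singular cube with a new variable `w` in the first place. -/
def consCell {k : ℕ} (y : C(Cube k, Config Z ℓ)) (w : C(Cube k, ℂ))
    (h : ∀ u, Below (y u) (w u)) : C(Cube k, Config Z (ℓ + 1)) where
  toFun u := ⟨((y u).1.1, Fin.cons (w u) (y u).1.2), by
    refine ⟨fun j l => ?_, fun j p => ?_⟩
    · refine Fin.cases ?_ (fun j => ?_) j <;> refine Fin.cases ?_ (fun l => ?_) l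
      · simp
      · intro _
        simpa using (sub_ne_zero.1 ((h u).1 l).ne_zero).symm
      · intro _
        simpa using sub_ne_zero.1 ((h u).1 j).ne_zero
      · intro hjl
        simpa using (y u).2.1 j l fun e => hjl (by rw [e])
    · refine Fin.cases ?_ (fun j => ?_) j
      · simpa using (sub_ne_zero.1 ((h u).2 p).ne_zero).symm
      · simpa using (y u).2.2 j p⟩
  continuous_toFun := by
    refine Continuous.subtype_mk ?_ _
    refine Continuous.prodMk (by fun_prop) (continuous_pi fun j => ?_)
    refine Fin.cases ?_ (fun j => ?_) j
    · simpa using w.continuous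
    · simp only [Fin.cons_succ]
      fun_prop

/-- The section along `consCell`. -/
def consSection (κ : ℝ) (lam : Fin n → ℂ) {k : ℕ} (y : C(Cube k, Config Z ℓ)) (w : C(Cube k, ℂ))
    (s : Cube k → ℂ) (u : Cube k) : ℂ := s u * consFactor κ lam (y u) (w u)

theorem isBranch_consSection {k : ℕ} {y : C(Cube k, Config Z ℓ)} {w : C(Cube k, ℂ)}
    (h : ∀ u, Below (y u) (w u)) {s : Cube k → ℂ} (hZ : ∀ p, Continuous fun b => Z b p)
    (hs : IsBranch κ lam Z y s) :
    IsBranch κ lam Z (consCell y w h) (consSection κ lam y w s) := by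
  obtain ⟨c, L, K, M, hL, hK, hM, hs⟩ := hs
  -- `Ψ` contains the differences `w - x_l` and `w - Z_p`, with the new variable first, whereas
  -- `consFactor` uses their negatives. The logarithms differ by `πi`; the total `D` of these shifts
  -- goes into the constant of the flat section.
  let D : ℂ := (∑ _l : Fin ℓ, 2 / (κ : ℂ) * (Real.pi * Complex.I)) +
    ∑ p, -(lam p / (κ : ℂ)) * (Real.pi * Complex.I)
  refine ⟨c * Complex.exp (-D),
    Fin.cons (fun l u => (Fin.cons 0 fun l => brLog ((y u).1.2 l - w u) + Real.pi * Complex.I :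
      Fin (ℓ + 1) → ℂ) l) fun j => Fin.cons 0 (L j),
    Fin.cons (fun p u => brLog (Z (y u).1.1 p - w u) + Real.pi * Complex.I) K, M, ?_, ?_, hM, ?_⟩
  · intro j l
    refine Fin.cases ?_ (fun j => ?_) j <;> refine Fin.cases ?_ (fun l => ?_) l
    · simp
    · intro _
      simp only [Fin.cons_zero, Fin.cons_succ]
      refine ⟨(OffCut.continuous_brLog (by fun_prop) fun u => (h u).1 l).add continuous_const,
        fun u => ?_⟩
      rw [exp_brLog_add ((h u).1 l).ne_zero]
      simp [consCell]
    · intro hjl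
      exact absurd hjl (Fin.not_lt_zero _)
    · intro hjl
      simpa [consCell] using hL j l (Fin.succ_lt_succ_iff.1 hjl)
  · intro j p
    refine Fin.cases ?_ (fun j => ?_) j
    · simp only [Fin.cons_zero]
      have := hZ p
      refine ⟨(OffCut.continuous_brLog (by fun_prop) fun u => (h u).2 p).add continuous_const,
        fun u => ?_⟩
      rw [exp_brLog_add ((h u).2 p).ne_zero]
      simp [consCell]
    · simpa [consCell] using hK j p
  · intro u
    simp only [consSection, consFactor, hs u, Fin.sum_univ_succ, Fin.sum_Ioi_zero, Fin.sum_Ioi_succ,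
      Fin.cons_zero, Fin.cons_succ]
    rw [mul_assoc, mul_assoc, ← Complex.exp_add, ← Complex.exp_add]
    congr 2
    simp only [D, mul_add, Finset.sum_add_distrib]
    ring

/-- A curve below all points of modulus at most `N` that goes from height `R` far to the left to
height `R` far to the right. -/
def farCurve (R N ξ : ℝ) : ℂ := ⟨ξ, R - (R + N + 1) * max 0 (min 1 (N + 1 - |ξ|))⟩

/-- If `x` has real part `ξ`, then `|ξ| ≤ N`, the cut-off factor equals `1` and the curve is at
height `-N - 1`, below `x`. -/
theorem offCut_sub_farCurve {N : ℝ} (ξ : ℝ) {x : ℂ} (hx : ‖x‖ ≤ N) :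
    OffCut (x - farCurve R N ξ) := by
  by_cases h : x.re = ξ
  · right
    have h1 := (Complex.abs_re_le_norm x).trans hx
    have h2 := (abs_le.1 ((Complex.abs_im_le_norm x).trans hx)).1
    rw [h] at h1
    have h3 : max 0 (min 1 (N + 1 - |ξ|)) = 1 := by
      rw [min_eq_left (by linarith), max_eq_right zero_le_one]
    simp only [Complex.sub_im, farCurve, h3]
    linarith
  · left
    simpa [farCurve, sub_eq_zero] using h

/-- A bound for the modulus of all variables. -/
def farRadius (C : ℝ) (c : Config Z ℓ) : ℝ := C + ∑ j, ‖c.1.2 j‖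

/-- The radius is a function of the configuration rather than a bound chosen for each cube: so it
restricts to faces, which makes `addContour` compatible with the boundary. Being symmetric in the
variables, it also makes `addContour` compatible with permutations. -/
theorem continuous_farRadius (C : ℝ) : Continuous fun c : Config Z ℓ => farRadius C c := by
  unfold farRadius
  fun_prop

omit [TopologicalSpace B] in
theorem below_farCurve {C : ℝ} (hC : ∀ b p, ‖Z b p‖ ≤ C) (hC0 : 0 ≤ C) (c : Config Z ℓ) (ξ : ℝ) :
    Below c (farCurve R (farRadius C c) ξ) := by
  have h0 : 0 ≤ ∑ j, ‖c.1.2 j‖ := Finset.sum_nonneg fun _ _ => norm_nonneg _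
  refine ⟨fun j => offCut_sub_farCurve _ ?_, fun p => offCut_sub_farCurve _ ?_⟩
  · have := Finset.single_le_sum (f := fun j => ‖c.1.2 j‖) (fun _ _ => norm_nonneg _)
      (Finset.mem_univ j)
    simp only [farRadius]
    linarith
  · simp only [farRadius]
    linarith [hC c.1.1 p]

/-- Forget the first coordinate of a cube. -/
def cubeTail (k : ℕ) : C(Cube (k + 1), Cube k) where
  toFun u j := u j.succ
  continuous_toFun := by fun_prop

/-- The new variable on the far curve, the first coordinate of the cube being the parameter. -/
def farPoint (R C : ℝ) {k : ℕ} (y : C(Cube k, Config Z ℓ)) : C(Cube (k + 1), ℂ) where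
  toFun u := farCurve R (farRadius C (y (cubeTail k u)))
    ((2 * (u 0 : ℝ) - 1) * (farRadius C (y (cubeTail k u)) + 1))
  continuous_toFun := by
    have h := (continuous_farRadius C).comp (y.continuous.comp (cubeTail k).continuous)
    simp only [Function.comp_def] at h
    have : ∀ f g : Cube (k + 1) → ℝ, Continuous f → Continuous g →
        Continuous fun u => (⟨f u, g u⟩ : ℂ) := fun f g hf hg =>
      Complex.equivRealProdCLM.symm.continuous.comp (hf.prodMk hg)
    unfold farCurve
    refine this _ _ ?_ ?_ <;> fun_prop

theorem below_farPoint {C : ℝ} (hC : ∀ b p, ‖Z b p‖ ≤ C) (hC0 : 0 ≤ C) {k : ℕ}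
    (y : C(Cube k, Config Z ℓ)) (u : Cube (k + 1)) :
    Below (y.comp (cubeTail k) u) (farPoint R C y u) :=
  below_farCurve hC hC0 _ _

/-- At the ends `ξ = ± (N + 1)`, where the cut-off `N + 1 - |ξ|` vanishes. -/
theorem farPoint_im {C : ℝ} (hC0 : 0 ≤ C) {k : ℕ} (y : C(Cube k, Config Z ℓ)) {u : Cube (k + 1)}
    (hu : u 0 = 0 ∨ u 0 = 1) : (farPoint R C y u).im = R := by
  have h0 : 0 ≤ farRadius C (y (cubeTail k u)) :=
    add_nonneg hC0 (Finset.sum_nonneg fun _ _ => norm_nonneg _)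
  set N := farRadius C (y (cubeTail k u)) with hN
  have h1 : |(2 * (u 0 : ℝ) - 1) * (N + 1)| = N + 1 := by
    rw [abs_mul, abs_of_nonneg (by linarith : 0 ≤ N + 1)]
    rcases hu with hu | hu <;> rw [hu] <;> norm_num
  have h2 : (farPoint R C y u).im = R - (R + N + 1) *
      max 0 (min 1 (N + 1 - |(2 * (u 0 : ℝ) - 1) * (N + 1)|)) := rfl
  rw [h2, h1]
  simp

/-- Multiplication of sections by the factor of the new variable on the far curve. -/
def farSection (κ : ℝ) (lam : Fin n → ℂ) (R C : ℝ) {k : ℕ} (y : C(Cube k, Config Z ℓ)) :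
    (Cube k → ℂ) →ₗ[ℂ] (Cube (k + 1) → ℂ) where
  toFun s := consSection κ lam (y.comp (cubeTail k)) (farPoint R C y) (s ∘ cubeTail k)
  map_add' s s' := by
    ext u
    simp [consSection, add_mul]
  map_smul' c s := by
    ext u
    simp [consSection, mul_assoc]

/-- Add a variable that runs over a contour around all points and all other variables. -/
def addContour (κ : ℝ) (lam : Fin n → ℂ) (R : ℝ) {C : ℝ} (hC : ∀ b p, ‖Z b p‖ ≤ C) (hC0 : 0 ≤ C)
    (ℓ k : ℕ) : PreChain Z ℓ k →ₗ[ℂ] PreChain Z (ℓ + 1) (k + 1) :=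
  Finsupp.lsum ℂ fun y =>
    Finsupp.lsingle (consCell (y.comp (cubeTail k)) (farPoint R C y) (below_farPoint hC hC0 y)) ∘ₗ
      farSection κ lam R C y

variable {C : ℝ} (hC : ∀ b p, ‖Z b p‖ ≤ C) (hC0 : 0 ≤ C)

theorem addContour_single {k : ℕ} (y : C(Cube k, Config Z ℓ)) (s : Cube k → ℂ) :
    addContour κ lam R hC hC0 ℓ k (Finsupp.single y s) =
      Finsupp.single (consCell (y.comp (cubeTail k)) (farPoint R C y) (below_farPoint hC hC0 y))
        (consSection κ lam (y.comp (cubeTail k)) (farPoint R C y) (s ∘ cubeTail k)) := by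
  simp [addContour]
  rfl

theorem faceIncl_succ_zero (k : ℕ) (a : Fin (k + 1)) (e : unitInterval) (u : Cube (k + 1)) :
    faceIncl (k + 1) a.succ e u 0 = u 0 := by
  have := Fin.insertNth_apply_succAbove (α := fun _ => unitInterval) a.succ e u 0
  rwa [Fin.succ_succAbove_zero] at this

theorem cubeTail_comp_faceIncl (k : ℕ) (a : Fin (k + 1)) (e : unitInterval) :
    (cubeTail (k + 1)).comp (faceIncl (k + 1) a.succ e) =
      (faceIncl k a e).comp (cubeTail k) := by
  ext u j : 2
  simp only [cubeTail, ContinuousMap.comp_apply, ContinuousMap.coe_mk]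
  rcases Fin.eq_self_or_eq_succAbove a j with rfl | ⟨j, rfl⟩
  · rw [faceIncl_self, faceIncl_self]
  · have h1 := Fin.insertNth_apply_succAbove (α := fun _ => unitInterval) a.succ e u j.succ
    rw [Fin.succ_succAbove_succ] at h1
    have h2 := Fin.insertNth_apply_succAbove (α := fun _ => unitInterval) a e
      (fun j => u j.succ) j
    exact h1.trans h2.symm

theorem consCell_congr {k : ℕ} {y y' : C(Cube k, Config Z ℓ)} {w w' : C(Cube k, ℂ)}
    (hy : y = y') (hw : w = w') (h : ∀ u, Below (y u) (w u)) :
    consCell y w h = consCell y' w' (by subst hy hw; exact h) := by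
  subst hy hw
  rfl

/-- The new parameter is the coordinate `0`, so the faces of the old cube move up by one direction
and change sign. What remains are the two faces in direction `0`, where the new variable is at
infinity. -/
theorem boundary_addContour (k : ℕ) (c : PreChain Z ℓ (k + 1)) :
    boundary Z (ℓ + 1) (k + 1) (addContour κ lam R hC hC0 ℓ (k + 1) c) =
      (face Z (ℓ + 1) (k + 1) 0 1 (addContour κ lam R hC hC0 ℓ (k + 1) c) -
        face Z (ℓ + 1) (k + 1) 0 0 (addContour κ lam R hC hC0 ℓ (k + 1) c)) -
      addContour κ lam R hC hC0 ℓ k (boundary Z ℓ k c) := by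
  have key : ∀ (a : Fin (k + 1)) (e : unitInterval),
      face Z (ℓ + 1) (k + 1) a.succ e (addContour κ lam R hC hC0 ℓ (k + 1) c) =
        addContour κ lam R hC hC0 ℓ k (face Z ℓ k a e c) := by
    intro a e
    induction c using Finsupp.induction_linear with
    | zero => simp
    | add c d hc hd => simp only [map_add, hc, hd]
    | single y s =>
      simp only [addContour_single, face_single]
      have hw : (farPoint R C y).comp (faceIncl (k + 1) a.succ e) =
          farPoint R C (y.comp (faceIncl k a e)) := by
        ext u
        have := congrArg (fun f => f u) (cubeTail_comp_faceIncl k a e)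
        simp only [ContinuousMap.comp_apply] at this
        simp only [farPoint, ContinuousMap.comp_apply, ContinuousMap.coe_mk, faceIncl_succ_zero,
          this]
      have hy : (y.comp (cubeTail (k + 1))).comp (faceIncl (k + 1) a.succ e) =
          (y.comp (faceIncl k a e)).comp (cubeTail k) := by
        rw [ContinuousMap.comp_assoc, cubeTail_comp_faceIncl, ContinuousMap.comp_assoc]
      have hs : (s ∘ cubeTail (k + 1)) ∘ faceIncl (k + 1) a.succ e =
          (s ∘ faceIncl k a e) ∘ cubeTail k := by
        have := congrArg (fun f : C(Cube (k + 1), Cube (k + 1)) => s ∘ f)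
          (cubeTail_comp_faceIncl k a e)
        exact this
      congr 1
      · exact consCell_congr hy hw fun u => below_farPoint hC hC0 y _
      · rw [← hw, ← hy, ← hs]
        rfl
  simp only [boundary, LinearMap.sum_apply, LinearMap.smul_apply, LinearMap.sub_apply, map_sum,
    map_smul, map_sub]
  rw [Fin.sum_univ_succ]
  simp only [key, Fin.val_zero, pow_zero, one_smul, Fin.val_succ, pow_succ, mul_neg, mul_one,
    neg_smul, Finset.sum_neg_distrib]
  exact (sub_eq_add_neg _ _).symm

theorem antiClass_pushClass_perm {k : ℕ} (σ : Equiv.Perm (Fin ℓ)) (c : ChainClass κ lam Z ℓ R k) :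
    antiClass κ lam Z ℓ R k (pushClass (isTwistedMap_perm κ lam Z R σ) k c) =
      ((Equiv.Perm.sign σ : ℤ) : ℂ) • antiClass κ lam Z ℓ R k c :=
  LinearMap.congr_fun (antiClass_comp_perm k σ) c

variable (hZ : ∀ p, Continuous fun b => Z b p)
include hZ

theorem addContour_mem_chains (k : ℕ) :
    chains κ lam Z ℓ k ≤
      (chains κ lam Z (ℓ + 1) (k + 1)).comap (addContour κ lam R hC hC0 ℓ k) := by
  refine Submodule.span_le.2 ?_
  rintro _ ⟨y, s, hs, rfl⟩
  exact Submodule.mem_comap.2 (Submodule.subset_span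
    ⟨_, _, isBranch_consSection _ hZ (hs.comp _), addContour_single hC hC0 y s⟩)

theorem face_addContour_mem (k : ℕ) {e : unitInterval} (he : e = 0 ∨ e = 1) :
    chains κ lam Z ℓ k ≤ (chainsAtInfinity κ lam Z (ℓ + 1) R k).comap
      (face Z (ℓ + 1) k 0 e ∘ₗ addContour κ lam R hC hC0 ℓ k) := by
  refine Submodule.span_le.2 ?_
  rintro _ ⟨y, s, hs, rfl⟩
  rw [SetLike.mem_coe, Submodule.mem_comap, LinearMap.comp_apply, addContour_single, face_single]
  refine Submodule.subset_span ⟨_, _, (isBranch_consSection _ hZ (hs.comp _)).comp _, fun u => ?_,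
    rfl⟩
  refine ⟨0, le_of_eq ?_⟩
  have : faceIncl k 0 e u 0 = 0 ∨ faceIncl k 0 e u 0 = 1 := by rwa [faceIncl_self]
  exact (farPoint_im hC0 y this).symm

theorem addContour_mem_trivialChains (k : ℕ) :
    trivialChains κ lam Z ℓ R k ≤
      (trivialChains κ lam Z (ℓ + 1) R (k + 1)).comap (addContour κ lam R hC hC0 ℓ k) := by
  refine sup_le (Submodule.span_le.2 ?_) (Submodule.span_le.2 ?_)
  · rintro _ ⟨y, s, hs, hy, rfl⟩
    refine Submodule.mem_comap.2 (Submodule.mem_sup_left (Submodule.subset_span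
      ⟨_, _, isBranch_consSection _ hZ (hs.comp _), fun u => ?_, addContour_single hC hC0 y s⟩))
    obtain ⟨j, hj⟩ := hy (cubeTail k u)
    exact ⟨j.succ, hj⟩
  · rintro _ ⟨y, s, hs, ⟨a, ha⟩, rfl⟩
    refine Submodule.mem_comap.2 (Submodule.mem_sup_right (Submodule.subset_span
      ⟨_, _, isBranch_consSection _ hZ (hs.comp _), ⟨a.succ, fun u v huv => ?_⟩,
        addContour_single hC hC0 y s⟩))
    have h1 : y (cubeTail k u) = y (cubeTail k v) :=
      ha _ _ fun b hb => huv _ fun e => hb (Fin.succ_injective _ e)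
    have h2 : u 0 = v 0 := huv 0 (Fin.succ_ne_zero a).symm
    simp only [consCell, farPoint, ContinuousMap.coe_mk, ContinuousMap.comp_apply, h1, h2]

theorem addContour_mem_boundaries (k : ℕ) :
    boundaries κ lam Z ℓ R k ≤
      (boundaries κ lam Z (ℓ + 1) R (k + 1)).comap (addContour κ lam R hC hC0 ℓ k) := by
  refine sup_le (fun c hc => Submodule.mem_sup_left
    (addContour_mem_trivialChains hC hC0 hZ k hc)) ?_
  rintro _ ⟨c, hc, rfl⟩
  have h := boundary_addContour (κ := κ) (lam := lam) (R := R) hC hC0 k c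
  have hf : ∀ e : unitInterval, e = 0 ∨ e = 1 →
      face Z (ℓ + 1) (k + 1) 0 e (addContour κ lam R hC hC0 ℓ (k + 1) c) ∈
        trivialChains κ lam Z (ℓ + 1) R (k + 1) := fun e he =>
    Submodule.mem_sup_left (face_addContour_mem hC hC0 hZ (k + 1) he hc)
  have h' : addContour κ lam R hC hC0 ℓ k (boundary Z ℓ k c) =
      (face Z (ℓ + 1) (k + 1) 0 1 (addContour κ lam R hC hC0 ℓ (k + 1) c) -
        face Z (ℓ + 1) (k + 1) 0 0 (addContour κ lam R hC hC0 ℓ (k + 1) c)) -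
      boundary Z (ℓ + 1) (k + 1) (addContour κ lam R hC hC0 ℓ (k + 1) c) := by
    rw [h]
    abel
  rw [Submodule.mem_comap, h']
  refine Submodule.sub_mem _ (Submodule.mem_sup_left (Submodule.sub_mem _ (hf 1 (Or.inr rfl))
    (hf 0 (Or.inl rfl)))) (Submodule.mem_sup_right
      ⟨_, addContour_mem_chains hC hC0 hZ (k + 1) hc, rfl⟩)

/-- The map induced by `addContour` on classes of chains. -/
def addContourClass (κ : ℝ) (lam : Fin n → ℂ) (R : ℝ) (ℓ k : ℕ) :
    ChainClass κ lam Z ℓ R k →ₗ[ℂ] ChainClass κ lam Z (ℓ + 1) R (k + 1) :=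
  Submodule.mapQ _ _ (addContour κ lam R hC hC0 ℓ k) (addContour_mem_boundaries hC hC0 hZ k)

theorem addContourClass_cubeClass {k : ℕ} (y : C(Cube k, Config Z ℓ)) (s : Cube k → ℂ) :
    addContourClass hC hC0 hZ κ lam R ℓ k (cubeClass κ lam R y s) =
      cubeClass κ lam R
        (consCell (y.comp (cubeTail k)) (farPoint R C y) (below_farPoint hC hC0 y))
        (consSection κ lam (y.comp (cubeTail k)) (farPoint R C y) (s ∘ cubeTail k)) := by
  rw [cubeClass, addContourClass, Submodule.mkQ_apply, Submodule.mapQ_apply, addContour_single]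
  rfl

/-- Adding a contour commutes with the maps of configuration spaces. -/
theorem addContourClass_comp_pushClass (hC' : ∀ b p, ‖Z' b p‖ ≤ C)
    (hZ' : ∀ p, Continuous fun b => Z' b p) (β : C(B, B')) (σ : Equiv.Perm (Fin ℓ))
    (τ : Equiv.Perm (Fin n)) (hτ : ∀ b p, Z' (β b) p = Z b (τ p)) (hlam : ∀ p, lam' p = lam (τ p))
    (k : ℕ) :
    addContourClass hC' hC0 hZ' κ lam' R ℓ k ∘ₗ
        pushClass (isTwistedMap_configMap β σ τ hτ hlam) k =
      pushClass (isTwistedMap_configMap β (Equiv.Perm.decomposeFin.symm (0, σ)) τ hτ hlam) (k + 1)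
        ∘ₗ addContourClass hC hC0 hZ κ lam R ℓ k := by
  refine chainClass_ext fun y s => ?_
  simp only [LinearMap.comp_apply, addContourClass_cubeClass, pushClass_cubeClass]
  have hN : ∀ c : Config Z ℓ, farRadius C (configMap β σ τ hτ c) = farRadius C c := by
    intro c
    simp only [farRadius, configMap, ContinuousMap.coe_mk]
    rw [Equiv.sum_comp σ fun j => ‖c.1.2 j‖]
  have hw : farPoint R C ((configMap β σ τ hτ).comp y) = farPoint R C y := by
    ext u
    simp only [farPoint, ContinuousMap.coe_mk, ContinuousMap.comp_apply, hN]
  congr 1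
  · ext u : 1
    refine Subtype.ext (Prod.ext rfl (funext fun j => ?_))
    refine Fin.cases ?_ (fun j => ?_) j
    · exact congrArg (fun f => f u) hw
    · simp [consCell, configMap]
  · ext u
    simp only [consSection, hw, consFactor, ContinuousMap.comp_apply, Function.comp_apply]
    congr 3
    · exact Equiv.sum_comp σ fun j =>
        2 / (κ : ℂ) * brLog ((y (cubeTail k u)).1.2 j - farPoint R C y u)
    · rw [← Equiv.sum_comp τ fun p =>
        -(lam p / (κ : ℂ)) * brLog (Z (y (cubeTail k u)).1.1 p - farPoint R C y u)]
      simp only [configMap, ContinuousMap.coe_mk, hτ, hlam]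

/-- Antisymmetrizing before adding a contour only multiplies the antisymmetrization by `ℓ!`. -/
theorem antiClass_addContourClass_antiClass (k : ℕ) (c : ChainClass κ lam Z ℓ R k) :
    antiClass κ lam Z (ℓ + 1) R (k + 1) (addContourClass hC hC0 hZ κ lam R ℓ k
        (antiClass κ lam Z ℓ R k c)) =
      (ℓ.factorial : ℂ) •
        antiClass κ lam Z (ℓ + 1) R (k + 1) (addContourClass hC hC0 hZ κ lam R ℓ k c) := by
  -- All permuted copies contribute equally: `σ` extends to a permutation of the same sign that
  -- fixes the new variable, the outer antisymmetrization turns it into this sign, and the two signs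
  -- cancel. There are `ℓ!` copies.
  have key : ∀ σ : Equiv.Perm (Fin ℓ), antiClass κ lam Z (ℓ + 1) R (k + 1)
      (addContourClass hC hC0 hZ κ lam R ℓ k
        (((Equiv.Perm.sign σ : ℤ) : ℂ) • pushClass (isTwistedMap_perm κ lam Z R σ) k c)) =
      antiClass κ lam Z (ℓ + 1) R (k + 1) (addContourClass hC hC0 hZ κ lam R ℓ k c) := by
    intro σ
    have h : ((Equiv.Perm.sign σ : ℤ) : ℂ) * ((Equiv.Perm.sign σ : ℤ) : ℂ) = 1 := by
      exact_mod_cast Int.units_coe_mul_self (Equiv.Perm.sign σ)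
    obtain ⟨π, hπ, h1⟩ : ∃ π : Equiv.Perm (Fin (ℓ + 1)),
        Equiv.Perm.sign π = Equiv.Perm.sign σ ∧
        addContourClass hC hC0 hZ κ lam R ℓ k (pushClass (isTwistedMap_perm κ lam Z R σ) k c) =
        pushClass (isTwistedMap_perm κ lam Z R π) (k + 1)
          (addContourClass hC hC0 hZ κ lam R ℓ k c) :=
      by
        have h2 := addContourClass_comp_pushClass (κ := κ) (lam := lam) (lam' := lam) (R := R)
          hC hC0 hZ hC hZ (ContinuousMap.id B) σ 1 (fun _ _ => rfl) (fun _ => rfl) k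
        generalize hπ : Equiv.Perm.decomposeFin.symm (0, σ) = π at h2
        refine ⟨π, ?_, LinearMap.congr_fun h2 c⟩
        rw [← hπ]
        simp
    rw [map_smul, h1, map_smul, antiClass_pushClass_perm, hπ, smul_smul, h, one_smul]
  conv_lhs => rw [antiClass.eq_def κ lam Z ℓ R k]
  rw [LinearMap.sum_apply, map_sum, map_sum]
  refine (Finset.sum_congr rfl fun σ _ => key σ).trans ?_
  simp [Fintype.card_perm, Nat.cast_smul_eq_nsmul]

end Operators

/-! ### Cells labelled by contours -/

/-- The cut is on the negative imaginary axis, so the way from the right half-plane to `-d` leads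
through the upper half-plane and adds `πi`. All powers of `q` in the relations between contours come
from here. -/
theorem brLog_neg {d : ℂ} (hd : 0 < d.re) : brLog (-d) = brLog d + Real.pi * Complex.I := by
  have hd0 : d ≠ 0 := by
    rintro rfl
    simp at hd
  have h1 := Complex.abs_arg_lt_pi_div_two_iff.2 (Or.inl hd)
  rw [abs_lt] at h1
  have h2 : Complex.log (Complex.I * d) = Complex.log Complex.I + Complex.log d := by
    refine (Complex.log_mul_eq_add_log_iff (by simp) hd0).2 ?_
    rw [Complex.arg_I]
    constructor <;> linarith [Real.pi_pos]
  rw [brLog_of_re_pos hd, brLog, neg_mul_neg, h2, Complex.log_I]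
  ring

theorem continuous_complex_mk {α : Type*} [TopologicalSpace α] {f g : α → ℝ} (hf : Continuous f)
    (hg : Continuous g) : Continuous fun a => (⟨f a, g a⟩ : ℂ) :=
  Complex.equivRealProdCLM.symm.continuous.comp (hf.prodMk hg)

section Branch

variable {B : Type} [TopologicalSpace B] {n : ℕ} {Z : B → Fin n → ℂ} {ℓ : ℕ}

/-- A section of the local system given by the logarithms `brLog` of differences taken in the order
prescribed by `o` and `o'`. -/
theorem isBranch_of_offCut (κ : ℝ) (lam : Fin n → ℂ) (hZ : ∀ p, Continuous fun b => Z b p) {k : ℕ}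
    (y : C(Cube k, Config Z ℓ)) (o : Fin ℓ → Fin ℓ → Prop) (o' : Fin ℓ → Fin n → Prop)
    [∀ j l, Decidable (o j l)] [∀ j p, Decidable (o' j p)]
    (h : ∀ u j l, j < l → OffCut (if o j l then (y u).1.2 l - (y u).1.2 j
      else (y u).1.2 j - (y u).1.2 l))
    (h' : ∀ u j p, OffCut (if o' j p then Z (y u).1.1 p - (y u).1.2 j
      else (y u).1.2 j - Z (y u).1.1 p))
    (h'' : ∀ u p r, p < r → OffCut (Z (y u).1.1 r - Z (y u).1.1 p)) :
    IsBranch κ lam Z y fun u => Complex.exp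
      ((∑ j, ∑ l ∈ Finset.Ioi j, 2 / (κ : ℂ) * brLog (if o j l then (y u).1.2 l - (y u).1.2 j
          else (y u).1.2 j - (y u).1.2 l)) +
        (∑ j, ∑ p, -(lam p / (κ : ℂ)) * brLog (if o' j p then Z (y u).1.1 p - (y u).1.2 j
          else (y u).1.2 j - Z (y u).1.1 p)) +
        ∑ p, ∑ r ∈ Finset.Ioi p, lam p * lam r / (2 * (κ : ℂ)) *
          brLog (Z (y u).1.1 r - Z (y u).1.1 p)) := by
  let d : Fin ℓ → Fin ℓ → ℂ := fun j l => if o j l then Real.pi * Complex.I else 0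
  let d' : Fin ℓ → Fin n → ℂ := fun j p => if o' j p then Real.pi * Complex.I else 0
  let D : ℂ := (∑ j, ∑ l ∈ Finset.Ioi j, 2 / (κ : ℂ) * d j l) +
    (∑ j, ∑ p, -(lam p / (κ : ℂ)) * d' j p) +
    ∑ p, ∑ s ∈ Finset.Ioi p, lam p * lam s / (2 * (κ : ℂ)) * (Real.pi * Complex.I)
  refine ⟨Complex.exp (-D), fun j l u => brLog (if o j l then (y u).1.2 l - (y u).1.2 j
      else (y u).1.2 j - (y u).1.2 l) + d j l,
    fun j p u => brLog (if o' j p then Z (y u).1.1 p - (y u).1.2 j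
      else (y u).1.2 j - Z (y u).1.1 p) + d' j p,
    fun p r u => brLog (Z (y u).1.1 r - Z (y u).1.1 p) + Real.pi * Complex.I, ?_, ?_, ?_, ?_⟩
  · intro j l hjl
    refine ⟨(OffCut.continuous_brLog ?_ fun u => h u j l hjl).add continuous_const, fun u => ?_⟩
    · split_ifs <;> fun_prop
    · have := (h u j l hjl).ne_zero
      by_cases ho : o j l
      · simp only [d, ho, if_true] at this ⊢
        rw [exp_brLog_add this, neg_sub]
      · simp only [d, ho, if_false, add_zero] at this ⊢
        rw [exp_brLog this]
  · intro j p
    have hp := hZ p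
    refine ⟨(OffCut.continuous_brLog ?_ fun u => h' u j p).add continuous_const, fun u => ?_⟩
    · split_ifs <;> fun_prop
    · have := (h' u j p).ne_zero
      by_cases ho : o' j p
      · simp only [d', ho, if_true] at this ⊢
        rw [exp_brLog_add this, neg_sub]
      · simp only [d', ho, if_false, add_zero] at this ⊢
        rw [exp_brLog this]
  · intro p r hpr
    have hp := hZ p
    have hr := hZ r
    refine ⟨(OffCut.continuous_brLog (by fun_prop) fun u => h'' u p r hpr).add continuous_const,
      fun u => ?_⟩
    rw [exp_brLog_add (h'' u p r hpr).ne_zero, neg_sub]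
  · intro u
    beta_reduce
    rw [← Complex.exp_add]
    congr 1
    simp only [mul_add, Finset.sum_add_distrib, D]
    ring

end Branch

/-! ### Antisymmetrized products of contours depend only on the set of contours -/

section Labels

variable {n : ℕ} {z : Fin n → ℂ} {R ε : ℝ} {ℓ : ℕ}

/-- The point with parameter `t` on the contour number `e.2` around the point number `e.1`. -/
def labelPt (z : Fin n → ℂ) (R ε : ℝ) (e : Fin n × ℕ) (t : ℝ) : ℂ :=
  contour (z e.1) (width ε e.2) R t

/-- The contour `e` starts to the left of the contour `f`. -/
def LabelLeft (e f : Fin n × ℕ) : Prop := e.1 < f.1 ∨ (e.1 = f.1 ∧ f.2 < e.2)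

instance (e f : Fin n × ℕ) : Decidable (LabelLeft e f) := inferInstanceAs (Decidable (_ ∨ _))

theorem labelLeft_or {e f : Fin n × ℕ} (h : e ≠ f) : LabelLeft e f ∨ LabelLeft f e := by
  unfold LabelLeft
  rcases lt_trichotomy e.1 f.1 with h1 | h1 | h1
  · exact Or.inl (Or.inl h1)
  · rcases lt_trichotomy e.2 f.2 with h2 | h2 | h2
    · exact Or.inr (Or.inr ⟨h1.symm, h2⟩)
    · exact absurd (Prod.ext h1 h2) h
    · exact Or.inl (Or.inr ⟨h1, h2⟩)
  · exact Or.inr (Or.inl h1)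

theorem LabelLeft.asymm {e f : Fin n × ℕ} (h : LabelLeft e f) : ¬LabelLeft f e := by
  unfold LabelLeft at *
  rintro (h' | h') <;> rcases h with h | h
  · exact h.not_gt h'
  · exact h'.ne h.1.symm
  · exact h.ne h'.1.symm
  · exact h.2.not_gt h'.2

theorem LabelLeft.offCut (hz : Admissible z R ε) {e f : Fin n × ℕ} (h : LabelLeft e f)
    (t t' : ℝ) : OffCut (labelPt z R ε f t' - labelPt z R ε e t) :=
  -- Any family with enough contours to contain both labels will do.
  offCut_contourPt (r := fun _ => e.2 + f.2 + 1) (e := ⟨e.1, ⟨e.2, by omega⟩⟩)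
    (f := ⟨f.1, ⟨f.2, by omega⟩⟩) hz h t t'

theorem offCut_labelPt (hz : Admissible z R ε) {e f : Fin n × ℕ} (hef : e ≠ f) (t t' : ℝ) :
    OffCut (if LabelLeft e f then labelPt z R ε f t' - labelPt z R ε e t
      else labelPt z R ε e t - labelPt z R ε f t') := by
  split_ifs with h
  · exact h.offCut hz t t'
  · exact ((labelLeft_or hef).resolve_left h).offCut hz t' t

theorem offCut_labelPt_point (hz : Admissible z R ε) (e : Fin n × ℕ) (p : Fin n) (t : ℝ) :
    OffCut (if e.1 ≤ p then z p - labelPt z R ε e t else labelPt z R ε e t - z p) := by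
  split_ifs with h
  · exact offCut_contourPt_point (r := fun _ => e.2 + 1) hz ⟨e.1, ⟨e.2, by simp⟩⟩ p h t
  · exact offCut_point_contourPt (r := fun _ => e.2 + 1) hz ⟨e.1, ⟨e.2, by simp⟩⟩ p (not_le.1 h) t

theorem ne_of_offCut_ite {P : Prop} [Decidable P] {a b : ℂ}
    (h : OffCut (if P then b - a else a - b)) : a ≠ b := by
  rintro rfl
  have := h.ne_zero
  simp at this

theorem continuous_contour {α : Type*} [TopologicalSpace α] {a : α → ℂ} {t : α → ℝ} (w R : ℝ)
    (ha : Continuous a) (ht : Continuous t) : Continuous fun x => contour (a x) w R (t x) := by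
  unfold contour
  refine continuous_complex_mk ?_ ?_ <;> fun_prop

/-- The product of the contours with the labels `e j`. -/
def labelCell (hz : Admissible z R ε) (e : Fin ℓ → Fin n × ℕ) (he : Function.Injective e) :
    C(Cube ℓ, Config (fun _ : Unit => z) ℓ) where
  toFun u := ⟨((), fun j => labelPt z R ε (e j) (u j)),
    fun j l hjl => ne_of_offCut_ite (offCut_labelPt hz (he.ne hjl) _ _),
    fun j p => ne_of_offCut_ite (offCut_labelPt_point hz (e j) p _)⟩
  continuous_toFun := by
    refine Continuous.subtype_mk (continuous_const.prodMk (continuous_pi fun j => ?_)) _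
    exact continuous_contour _ _ continuous_const (by fun_prop)

/-- The section along the product of contours. -/
def labelSection (κ : ℝ) (lam : Fin n → ℂ) (z : Fin n → ℂ) (R ε : ℝ) (e : Fin ℓ → Fin n × ℕ)
    (u : Cube ℓ) : ℂ :=
  Complex.exp
    ((∑ j, ∑ l ∈ Finset.Ioi j, 2 / (κ : ℂ) * brLog (if LabelLeft (e j) (e l)
        then labelPt z R ε (e l) (u l) - labelPt z R ε (e j) (u j)
        else labelPt z R ε (e j) (u j) - labelPt z R ε (e l) (u l))) +
    (∑ j, ∑ p, -(lam p / (κ : ℂ)) * brLog (if (e j).1 ≤ p then z p - labelPt z R ε (e j) (u j)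
        else labelPt z R ε (e j) (u j) - z p)) +
    ∑ p, ∑ s ∈ Finset.Ioi p, lam p * lam s / (2 * (κ : ℂ)) * brLog (z s - z p))

theorem Admissible.offCut_sub (hz : Admissible z R ε) {p r : Fin n} (h : p < r) :
    OffCut (z r - z p) := by
  left
  rw [Complex.sub_re]
  have := hz.gap p r h
  have := hz.pos
  exact (by linarith : 0 < (z r).re - (z p).re).ne'

theorem isBranch_labelSection (κ : ℝ) (lam : Fin n → ℂ) (hz : Admissible z R ε)
    (e : Fin ℓ → Fin n × ℕ) (he : Function.Injective e) :
    IsBranch κ lam (fun _ : Unit => z) (labelCell hz e he) (labelSection κ lam z R ε e) :=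
  isBranch_of_offCut (Z := fun _ : Unit => z) κ lam (fun _ => continuous_const)
    (labelCell hz e he) (fun j l => LabelLeft (e j) (e l)) (fun j p => (e j).1 ≤ p)
    (fun u j l hjl => offCut_labelPt hz (he.ne hjl.ne) (u j) (u l))
    (fun u j p => offCut_labelPt_point hz (e j) p (u j)) fun _ _ _ h => hz.offCut_sub h

theorem contour_im_of_end (a : ℂ) (w R : ℝ) {t : unitInterval} (ht : t = 0 ∨ t = 1) :
    (contour a w R t).im = R := by
  rcases ht with rfl | rfl <;> norm_num [contour]

theorem labelCell_mem_infinity (hz : Admissible z R ε) (e : Fin ℓ → Fin n × ℕ)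
    (he : Function.Injective e) {u : Cube ℓ} (hu : u ∈ cubeBoundary ℓ) :
    labelCell hz e he u ∈ infinity (fun _ : Unit => z) ℓ R := by
  obtain ⟨a, ha⟩ := hu
  exact ⟨a, (contour_im_of_end _ _ _ ha).ge⟩

/-- The antisymmetrized class of the product of contours. -/
def labelClass (κ : ℝ) (lam : Fin n → ℂ) (hz : Admissible z R ε) (e : Fin ℓ → Fin n × ℕ)
    (he : Function.Injective e) : ChainClass κ lam (fun _ : Unit => z) ℓ R ℓ :=
  antiClass κ lam (fun _ : Unit => z) ℓ R ℓ
    (cubeClass κ lam R (labelCell hz e he) (labelSection κ lam z R ε e))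

/-- The order in which a difference is taken depends on the labels and not on the numbering, so the
summands are symmetric in the pair of variables and the sum over pairs may be permuted. -/
theorem labelSection_comp_perm (κ : ℝ) (lam : Fin n → ℂ) (e : Fin ℓ → Fin n × ℕ)
    (he : Function.Injective e) (π : Equiv.Perm (Fin ℓ)) (u : Cube ℓ) :
    labelSection κ lam z R ε (e ∘ π) u = labelSection κ lam z R ε e (u ∘ π.symm) := by
  have h1 := sum_pairs_perm π (fun j l => 2 / (κ : ℂ) * brLog (if LabelLeft (e j) (e l)
        then labelPt z R ε (e l) (u (π.symm l)) - labelPt z R ε (e j) (u (π.symm j))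
        else labelPt z R ε (e j) (u (π.symm j)) - labelPt z R ε (e l) (u (π.symm l)))) (by
    intro j l
    by_cases hjl : j = l
    · rw [hjl]
    · rcases labelLeft_or (he.ne hjl) with h | h <;> simp [h, h.asymm])
  have h2 := Equiv.sum_comp π fun j => ∑ p, -(lam p / (κ : ℂ)) *
    brLog (if (e j).1 ≤ p then z p - labelPt z R ε (e j) (u (π.symm j))
        else labelPt z R ε (e j) (u (π.symm j)) - z p)
  simp only [Equiv.symm_apply_apply] at h1 h2
  simp only [labelSection, Function.comp_apply, ← h1, ← h2]

/-- Renumbering the contours permutes both the variables and the parameters of the cube. The first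
gives a sign through antisymmetrization, the second the same sign as an orientation, and the two
cancel. -/
theorem labelClass_comp_perm (κ : ℝ) (lam : Fin n → ℂ) (hz : Admissible z R ε)
    (e : Fin ℓ → Fin n × ℕ) (he : Function.Injective e) (π : Equiv.Perm (Fin ℓ)) :
    labelClass κ lam hz (e ∘ π) (he.comp π.injective) = labelClass κ lam hz e he := by
  have h1 := cubeClass_cubePerm (R := R) π.symm (isBranch_labelSection κ lam hz e he)
    fun u hu => labelCell_mem_infinity hz e he hu
  have h2 : cubeClass κ lam R (labelCell hz (e ∘ π) (he.comp π.injective))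
      (labelSection κ lam z R ε (e ∘ π)) = pushClass (isTwistedMap_perm κ lam _ R π) ℓ
        (cubeClass κ lam R ((labelCell hz e he).comp (cubePerm π.symm))
          (labelSection κ lam z R ε e ∘ cubePerm π.symm)) := by
    rw [pushClass_cubeClass]
    congr 1
    · ext u : 1
      refine Subtype.ext (Prod.ext rfl (funext fun j => ?_))
      simp [labelCell, configMap, cubePerm]
    · ext u
      exact labelSection_comp_perm κ lam e he π u
  have h : ((Equiv.Perm.sign π : ℤ) : ℂ) * ((Equiv.Perm.sign π : ℤ) : ℂ) = 1 := by
    exact_mod_cast Int.units_coe_mul_self (Equiv.Perm.sign π)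
  rw [labelClass, h2, antiClass_pushClass_perm, h1, map_smul, Equiv.Perm.sign_symm, smul_smul, h,
    one_smul, labelClass]

/-- Two injective enumerations of one set differ by a permutation. Thus a contour that is added in
the first place can be absorbed in the standard numbering. -/
theorem labelClass_congr (κ : ℝ) (lam : Fin n → ℂ) (hz : Admissible z R ε)
    {e e' : Fin ℓ → Fin n × ℕ} (he : Function.Injective e) (he' : Function.Injective e')
    (h : Set.range e = Set.range e') : labelClass κ lam hz e he = labelClass κ lam hz e' he' := by
  obtain ⟨π, rfl⟩ : ∃ π : Equiv.Perm (Fin ℓ), e = e' ∘ π := by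
    refine ⟨((Equiv.ofInjective e he).trans (Equiv.setCongr h)).trans
      (Equiv.ofInjective e' he').symm, funext fun j => ?_⟩
    have := Equiv.apply_ofInjective_symm he' (Equiv.setCongr h (Equiv.ofInjective e he j))
    simpa using this.symm
  exact labelClass_comp_perm κ lam hz e' he' π

/-- The labels of the contours of a Gomez-Sierra chain. -/
def gsLabel (r : Fin n → ℕ) (hr : ∑ p, r p = ℓ) (j : Fin ℓ) : Fin n × ℕ :=
  ((label r hr j).1, (label r hr j).2)

theorem gsLabel_injective (r : Fin n → ℕ) (hr : ∑ p, r p = ℓ) :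
    Function.Injective (gsLabel r hr) := by
  intro j l h
  refine label_injective r hr ?_
  simp only [gsLabel, Prod.mk.injEq] at h
  generalize label r hr j = x at h
  generalize label r hr l = y at h
  obtain ⟨p, b⟩ := x
  obtain ⟨p', b'⟩ := y
  obtain ⟨h1, h2⟩ := h
  simp only at h1 h2
  subst h1
  rw [Fin.ext h2]

theorem range_gsLabel (r : Fin n → ℕ) (hr : ∑ p, r p = ℓ) :
    Set.range (gsLabel r hr) = {e | e.2 < r e.1} := by
  ext ⟨p, b⟩
  constructor
  · rintro ⟨j, hj⟩
    rw [← hj]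
    exact (label r hr j).2.2
  · intro hb
    have h : label r hr (Fin.cast hr (finSigmaFinEquiv ⟨p, ⟨b, hb⟩⟩)) = ⟨p, ⟨b, hb⟩⟩ := by
      simp [label]
    refine ⟨Fin.cast hr (finSigmaFinEquiv ⟨p, ⟨b, hb⟩⟩), ?_⟩
    rw [gsLabel, h]

theorem sum_gsLabel (r : Fin n → ℕ) (hr : ∑ p, r p = ℓ) (g : Fin n → ℂ) :
    ∑ j, g (gsLabel r hr j).1 = ∑ p, r p * g p := by
  subst hr
  refine (Equiv.sum_comp finSigmaFinEquiv.symm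
    (fun x : (p : Fin n) × Fin (r p) => g x.1)).trans ?_
  rw [Fintype.sum_sigma]
  simp

/-- The class of an antisymmetrized Gomez-Sierra chain. -/
def gsClass (κ : ℝ) (lam : Fin n → ℂ) (hz : Admissible z R ε) (r : Fin n → ℕ)
    (hr : ∑ p, r p = ℓ) : ChainClass κ lam (fun _ : Unit => z) ℓ R ℓ :=
  labelClass κ lam hz (gsLabel r hr) (gsLabel_injective r hr)

end Labels

/-! ### Splitting a contour around all points -/

section Envelope

variable {n : ℕ} {z : Fin n → ℂ} {R ε : ℝ}

/-- The horizontal correction by which the part of the real line over the strip `|v| ≤ w` is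
mapped to a contour. -/
def stripShift (w v : ℝ) : ℝ := max (-w) (min w (3 * v)) - max (-w) (min w v)

/-- The depth of a contour over the strip `|v| ≤ w`, relative to its total depth. -/
def stripDip (w v : ℝ) : ℝ := max 0 (min 1 ((3 - 3 * |v| / w) / 2))

/-- The curve that runs along all contours of half-widths `w p` and joins them at height `R`. -/
def envelope (z : Fin n → ℂ) (R : ℝ) (w : Fin n → ℝ) (ξ : ℝ) : ℂ :=
  ⟨ξ + ∑ p, stripShift (w p) (ξ - (z p).re),
    R - ∑ p, (R - ((z p).im - w p)) * stripDip (w p) (ξ - (z p).re)⟩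

theorem continuous_envelope (w : Fin n → ℝ) : Continuous (envelope z R w) := by
  unfold envelope stripShift stripDip
  refine continuous_complex_mk ?_ ?_ <;> fun_prop

theorem stripShift_eq_zero {w v : ℝ} (hw : 0 < w) (h : w ≤ |v|) : stripShift w v = 0 := by
  unfold stripShift
  rcases le_abs.1 h with h | h
  · rw [min_eq_left (by linarith), min_eq_left h, sub_self]
  · rw [min_eq_right (by linarith), min_eq_right (by linarith), max_eq_left (by linarith),
      max_eq_left (by linarith), sub_self]

theorem stripDip_eq_zero {w v : ℝ} (hw : 0 < w) (h : w ≤ |v|) : stripDip w v = 0 := by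
  unfold stripDip
  refine max_eq_left ((min_le_right _ _).trans ?_)
  have : 3 ≤ 3 * |v| / w := by
    rw [le_div_iff₀ hw]
    linarith
  linarith

theorem envelope_of_outside {w : Fin n → ℝ} (hw : ∀ p, 0 < w p) {ξ : ℝ}
    (h : ∀ p, w p ≤ |ξ - (z p).re|) : envelope z R w ξ = ⟨ξ, R⟩ := by
  unfold envelope
  rw [Finset.sum_eq_zero fun p _ => stripShift_eq_zero (hw p) (h p),
    Finset.sum_eq_zero fun p _ => by rw [stripDip_eq_zero (hw p) (h p), mul_zero]]
  simp

theorem Admissible.le_abs_sub (hz : Admissible z R ε) {p q : Fin n} (hpq : p ≠ q) {ξ : ℝ}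
    (h : |ξ - (z p).re| ≤ ε) : ε ≤ |ξ - (z q).re| := by
  rw [abs_le] at h
  rw [le_abs]
  rcases lt_or_gt_of_ne hpq with h' | h'
  · have := hz.gap _ _ h'
    right
    linarith
  · have := hz.gap _ _ h'
    left
    linarith

/-- Over the strip of `p` the terms of the other points vanish. The slope `3` in `stripShift` and
`stripDip` reflects that a contour spends the outer thirds of its parameter on the vertical sides
and the middle third on the bottom. -/
theorem envelope_of_mem (hz : Admissible z R ε) {w : Fin n → ℝ} (hw : ∀ p, 0 < w p)
    (hw' : ∀ p, w p < ε) (p : Fin n) {t : ℝ} (ht0 : 0 ≤ t) (ht1 : t ≤ 1) :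
    envelope z R w ((z p).re + w p * (2 * t - 1)) = contour (z p) (w p) R t := by
  have hwp := hw p
  have habs : |w p * (2 * t - 1)| ≤ w p := by
    rw [abs_le]
    constructor <;> nlinarith
  have hout : ∀ q, q ≠ p → w q ≤ |(z p).re + w p * (2 * t - 1) - (z q).re| := fun q hq =>
    (hw' q).le.trans (hz.le_abs_sub hq.symm (by
      rw [add_sub_cancel_left]
      exact habs.trans (hw' p).le))
  unfold envelope contour
  rw [Finset.sum_eq_single p (fun q _ hq => stripShift_eq_zero (hw q) (hout q hq)) (by simp),
    Finset.sum_eq_single p (fun q _ hq => by rw [stripDip_eq_zero (hw q) (hout q hq), mul_zero])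
      (by simp), add_sub_cancel_left]
  have h6 : w p * (2 * t - 1) * 3 = w p * (6 * t - 3) := by ring
  apply Complex.ext
  · simp only [stripShift]
    rw [abs_le] at habs
    rw [min_eq_right habs.2, max_eq_right habs.1, mul_comm 3, h6]
    have e1 : min (w p) (w p * (6 * t - 3)) = w p * min 1 (6 * t - 3) := by
      rw [mul_min_of_nonneg _ _ hwp.le, mul_one]
    have e2 : max (-w p) (w p * min 1 (6 * t - 3)) = w p * max (-1) (min 1 (6 * t - 3)) := by
      rw [mul_max_of_nonneg _ _ hwp.le]
      simp
    rw [e1, e2]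
    ring
  · simp only [stripDip]
    have e1 : 3 * |w p * (2 * t - 1)| / w p = |6 * t - 3| := by
      rw [abs_mul, abs_of_pos hwp, show 6 * t - 3 = 3 * (2 * t - 1) by ring, abs_mul]
      field_simp
      norm_num [mul_comm]
    have e2 : |6 * t - 3| ≤ 3 := by
      rw [abs_le]
      constructor <;> linarith
    rw [e1]
    rcases le_total 1 |6 * t - 3| with h | h
    · rw [min_eq_right (by linarith), max_eq_right (by linarith), max_eq_right (by linarith)]
      ring
    · rw [min_eq_left (by linarith), max_eq_right (by linarith), max_eq_left (by linarith)]
      ring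

/-- The point `x` lies strictly above the curve `envelope`, in one of the strips. -/
def InStrip (z : Fin n → ℂ) (w : Fin n → ℝ) (x : ℂ) : Prop :=
  ∃ q, |x.re - (z q).re| < w q ∧ (z q).im - w q < x.im

theorem exists_param {a w ξ : ℝ} (hw : 0 < w) (h : |ξ - a| ≤ w) :
    ∃ t, 0 ≤ t ∧ t ≤ 1 ∧ ξ = a + w * (2 * t - 1) := by
  rw [abs_le] at h
  refine ⟨((ξ - a) / w + 1) / 2, ?_, ?_, ?_⟩
  · have : -1 ≤ (ξ - a) / w := by
      rw [le_div_iff₀ hw]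
      linarith
    linarith
  · have : (ξ - a) / w ≤ 1 := by
      rw [div_le_one hw]
      linarith
    linarith
  · field_simp
    ring

/-- A point of the envelope with the real part of `x` lies strictly inside the strip of `q`, hence
on the horizontal bottom of the contour around `z q`, which is below `x`. -/
theorem offCut_sub_envelope (hz : Admissible z R ε) {w : Fin n → ℝ} (hw : ∀ p, 0 < w p)
    (hw' : ∀ p, w p < ε) {x : ℂ} (hx : InStrip z w x) (ξ : ℝ) :
    OffCut (x - envelope z R w ξ) := by
  obtain ⟨q, hq1, hq2⟩ := hx
  by_cases hre : x.re = (envelope z R w ξ).re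
  · right
    rw [Complex.sub_im]
    by_cases hξ : ∃ p, |ξ - (z p).re| ≤ w p
    · obtain ⟨p, hp⟩ := hξ
      obtain ⟨t, ht0, ht1, rfl⟩ := exists_param (hw p) hp
      rw [envelope_of_mem hz hw hw' p ht0 ht1] at hre ⊢
      have h1 := contour_re_mem (z p) (hw p).le R t
      have hpq : p = q := by
        by_contra hpq
        have h2 := hz.le_abs_sub hpq (ξ := x.re) (by
          rw [abs_le]
          have := hw' p
          constructor <;> linarith)
        linarith [hw' q]
      subst hpq
      rw [abs_lt] at hq1
      rw [contour_im_eq (z p) (hw p) R t (by linarith) (by linarith)]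
      linarith
    · push Not at hξ
      rw [envelope_of_outside hw fun p => (hξ p).le] at hre
      simp only at hre
      rw [hre] at hq1
      linarith [hξ q]
  · left
    rw [Complex.sub_re]
    exact sub_ne_zero.2 hre

/-- Either `ξ` lies over a strip, and all strips are within distance `C` of `0`, or the horizontal
correction vanishes there and `ξ = r`. -/
theorem abs_le_of_envelope_re {C : ℝ} {w : Fin n → ℝ}
    (hw : ∀ p, 0 < w p) (hw' : ∀ p, w p < ε) (hC : ∀ p, ‖z p‖ + ε ≤ C) {ξ s r : ℝ}
    (hr : |r| ≤ C) (h : ξ + s * ((envelope z R w ξ).re - ξ) = r) : |ξ| ≤ C := by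
  by_cases hξ : ∃ p, |ξ - (z p).re| ≤ w p
  · obtain ⟨p, hp⟩ := hξ
    have h1 := (Complex.abs_re_le_norm (z p))
    have h2 := abs_add_le (ξ - (z p).re) (z p).re
    rw [sub_add_cancel] at h2
    linarith [hw' p, hC p]
  · push Not at hξ
    rw [envelope_of_outside hw fun p => (hξ p).le] at h
    simp only [sub_self, mul_zero, add_zero] at h
    rwa [h]

/-- A homotopy from the far curve to the envelope. -/
def farHomotopy (z : Fin n → ℂ) (R : ℝ) (w : Fin n → ℝ) (N τ ξ : ℝ) : ℂ :=
  ⟨ξ + min 1 (2 * τ) * ((envelope z R w ξ).re - ξ),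
    (farCurve R N ξ).im + max 0 (2 * τ - 1) * ((envelope z R w ξ).im - (farCurve R N ξ).im)⟩

theorem farHomotopy_zero (w : Fin n → ℝ) (N ξ : ℝ) :
    farHomotopy z R w N 0 ξ = farCurve R N ξ := by
  apply Complex.ext <;> simp [farHomotopy, farCurve]

theorem farHomotopy_one (w : Fin n → ℝ) (N ξ : ℝ) :
    farHomotopy z R w N 1 ξ = envelope z R w ξ := by
  apply Complex.ext
  · norm_num [farHomotopy]
  · have : max (0 : ℝ) (2 * 1 - 1) = 1 := by norm_num
    simp only [farHomotopy, this]
    ring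

/-- In the first half of the homotopy only real parts change, and the height stays that of the far
curve, below `x`. In the second half the real part is that of the envelope and the height is a
convex combination of two heights that are both below `x`. -/
theorem offCut_sub_farHomotopy (hz : Admissible z R ε) {w : Fin n → ℝ} (hw : ∀ p, 0 < w p)
    (hw' : ∀ p, w p < ε) {N : ℝ} (hN : ∀ p, ‖z p‖ + ε ≤ N) {x : ℂ} (hx : InStrip z w x)
    (hxN : ‖x‖ ≤ N) {τ : ℝ} (hτ : τ ≤ 1) (ξ : ℝ) :
    OffCut (x - farHomotopy z R w N τ ξ) := by
  by_cases hre : (farHomotopy z R w N τ ξ).re = x.re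
  · right
    rw [Complex.sub_im, sub_pos]
    have h1 : |ξ| ≤ N := abs_le_of_envelope_re hw hw' hN
      ((Complex.abs_re_le_norm x).trans hxN) hre
    have h2 := (abs_le.1 ((Complex.abs_im_le_norm x).trans hxN)).1
    have h3 : (farCurve R N ξ).im < x.im := by
      have h3 : max 0 (min 1 (N + 1 - |ξ|)) = 1 := by
        rw [min_eq_left (by linarith), max_eq_right zero_le_one]
      simp only [farCurve, h3]
      linarith
    simp only [farHomotopy] at hre ⊢
    rcases le_total τ (1 / 2) with h | h
    · rw [max_eq_left (by linarith)]
      linarith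
    · rw [min_eq_left (by linarith)] at hre
      rw [max_eq_right (by linarith)]
      have h4 : (envelope z R w ξ).im < x.im := by
        rcases offCut_sub_envelope hz hw hw' hx ξ with h4 | h4
        · exact absurd (by rw [Complex.sub_re, ← hre]; ring) h4
        · rwa [Complex.sub_im, sub_pos] at h4
      have h5 := max_lt h3 h4
      nlinarith [le_max_left (farCurve R N ξ).im (envelope z R w ξ).im,
        le_max_right (farCurve R N ξ).im (envelope z R w ξ).im]
  · left
    rw [Complex.sub_re]
    exact sub_ne_zero.2 fun h => hre h.symm

theorem farHomotopy_im_of_end {w : Fin n → ℝ} (hw : ∀ p, 0 < w p)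
    (hw' : ∀ p, w p < ε) {N : ℝ} (hN : ∀ p, ‖z p‖ + ε ≤ N) {ξ : ℝ}
    (hξ : |ξ| = N + 1) (τ : ℝ) : (farHomotopy z R w N τ ξ).im = R := by
  have h : ∀ p, w p ≤ |ξ - (z p).re| := by
    intro p
    have h1 := Complex.abs_re_le_norm (z p)
    have h2 := abs_add_le (ξ - (z p).re) (z p).re
    rw [sub_add_cancel] at h2
    linarith [hw' p, hN p]
  simp [farHomotopy, envelope_of_outside hw h, farCurve, hξ]

end Envelope

/-! ### Deforming and cutting the curve of the first variable -/

section Cons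

variable {B : Type} [TopologicalSpace B] {n : ℕ} {κ : ℝ} {lam : Fin n → ℂ} {Z : B → Fin n → ℂ}
  {ℓ : ℕ} {R : ℝ}

/-- The class of a cube with a new variable `w`. -/
def consClass (κ : ℝ) (lam : Fin n → ℂ) (R : ℝ) {k : ℕ} (y : C(Cube k, Config Z ℓ))
    (s : Cube k → ℂ) (w : C(Cube k, ℂ)) (h : ∀ u, Below (y u) (w u)) :
    ChainClass κ lam Z (ℓ + 1) R k :=
  cubeClass κ lam R (consCell y w h) (consSection κ lam y w s)

/-- The restrictions enter through equations because the proof term inside `consCell` depends on `y`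
and `w`, which prevents rewriting in place. -/
theorem faceClass_consCell {k : ℕ} {y : C(Cube (k + 1), Config Z ℓ)} {s : Cube (k + 1) → ℂ}
    {w : C(Cube (k + 1), ℂ)} (h : ∀ u, Below (y u) (w u)) (a : Fin (k + 1)) (t : unitInterval)
    {y' : C(Cube k, Config Z ℓ)} {s' : Cube k → ℂ} {w' : C(Cube k, ℂ)}
    (hy : y.comp (faceIncl k a t) = y') (hs : s ∘ faceIncl k a t = s')
    (hw : w.comp (faceIncl k a t) = w') :
    faceClass κ lam R (consCell y w h) (consSection κ lam y w s) a t =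
      consClass κ lam R y' s' w' (by subst hy hw; exact fun u => h _) := by
  subst hy hs hw
  rfl

theorem cubeTail_cubeTail_faceIncl_zero (k : ℕ) (t : unitInterval) :
    ((cubeTail k).comp (cubeTail (k + 1))).comp (faceIncl (k + 1) 0 t) = cubeTail k := by
  ext u j : 2
  exact faceIncl_zero_succ (k + 1) t u j.succ

theorem cubeTail_cubeTail_faceIncl_one (k : ℕ) (t : unitInterval) :
    ((cubeTail k).comp (cubeTail (k + 1))).comp (faceIncl (k + 1) 1 t) = cubeTail k := by
  ext u j : 2
  exact faceIncl_one_succ k t u j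

/-- A homotopy of curves for the new variable. -/
theorem consClass_homotopy (hZ : ∀ p, Continuous fun b => Z b p) {k : ℕ}
    {y : C(Cube k, Config Z ℓ)} {s : Cube k → ℂ} (hs : IsBranch κ lam Z y s)
    (hy : ∀ u ∈ cubeBoundary k, y u ∈ infinity Z ℓ R) (w : C(Cube (k + 2), ℂ))
    (hw : ∀ u, Below (y (cubeTail k (cubeTail (k + 1) u))) (w u))
    (hw' : ∀ u, u 1 = 0 ∨ u 1 = 1 → R ≤ (w u).im) {w₀ w₁ : C(Cube (k + 1), ℂ)}
    (h₀ : w.comp (faceIncl (k + 1) 0 0) = w₀) (h₁ : w.comp (faceIncl (k + 1) 0 1) = w₁)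
    (hw₀ : ∀ u, Below (y.comp (cubeTail k) u) (w₀ u))
    (hw₁ : ∀ u, Below (y.comp (cubeTail k) u) (w₁ u)) :
    consClass κ lam R (y.comp (cubeTail k)) (s ∘ cubeTail k) w₁ hw₁ =
      consClass κ lam R (y.comp (cubeTail k)) (s ∘ cubeTail k) w₀ hw₀ := by
  let T := (cubeTail k).comp (cubeTail (k + 1))
  have hT : ∀ t, T.comp (faceIncl (k + 1) 0 t) = cubeTail k := cubeTail_cubeTail_faceIncl_zero k
  have hy' : ∀ t, (y.comp T).comp (faceIncl (k + 1) 0 t) = y.comp (cubeTail k) := fun t => by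
    rw [ContinuousMap.comp_assoc, hT]
  have hs' : ∀ t, (s ∘ T) ∘ faceIncl (k + 1) 0 t = s ∘ cubeTail k := fun t =>
    congrArg (fun f : C(Cube (k + 1), Cube k) => s ∘ f) (hT t)
  have key := faceClass_zero_eq (R := R) (isBranch_consSection (y := y.comp T) (w := w) hw hZ
    (hs.comp T)) (by
      intro a u hu
      refine Fin.cases (fun hu => ⟨0, hw' u hu⟩) (fun a hu => ?_) a hu
      obtain ⟨j, hj⟩ := hy (T u) ⟨a, hu⟩
      exact ⟨j.succ, hj⟩)
  rwa [faceClass_consCell _ 0 1 (hy' 1) (hs' 1) h₁, faceClass_consCell _ 0 0 (hy' 0) (hs' 0) h₀]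
    at key

/-- The new variable on a piece of a curve `Γ`. -/
def curvePiece (Γ : C(ℝ, ℂ)) {k : ℕ} (α β : C(Cube k, ℝ)) : C(Cube (k + 1), ℂ) where
  toFun u := Γ (α (cubeTail k u) + u 0 * (β (cubeTail k u) - α (cubeTail k u)))
  continuous_toFun := by fun_prop

/-- Splitting a curve for the new variable. -/
theorem consClass_curvePiece_add (hZ : ∀ p, Continuous fun b => Z b p) {k : ℕ}
    {y : C(Cube k, Config Z ℓ)} {s : Cube k → ℂ} (hs : IsBranch κ lam Z y s)
    (hy : ∀ u ∈ cubeBoundary k, y u ∈ infinity Z ℓ R) (Γ : C(ℝ, ℂ))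
    (hΓ : ∀ u ξ, Below (y u) (Γ ξ)) (α β γ : C(Cube k, ℝ)) :
    consClass κ lam R (y.comp (cubeTail k)) (s ∘ cubeTail k) (curvePiece Γ α γ)
        (fun _ => hΓ _ _) =
      consClass κ lam R (y.comp (cubeTail k)) (s ∘ cubeTail k) (curvePiece Γ α β)
        (fun _ => hΓ _ _) +
      consClass κ lam R (y.comp (cubeTail k)) (s ∘ cubeTail k) (curvePiece Γ β γ)
        (fun _ => hΓ _ _) := by
  let T := (cubeTail k).comp (cubeTail (k + 1))
  -- The coordinate `u 1` runs along `Γ` from `α` to an end point that slides from `β` to `γ` with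
  -- `u 0`. The sides are `α` to `β`, `α` to `γ`, the path `β` to `γ`, and a constant side at `α`,
  -- which is degenerate.
  let w : C(Cube (k + 2), ℂ) :=
    ⟨fun u => Γ (α (T u) + u 1 * ((β (T u) + u 0 * (γ (T u) - β (T u))) - α (T u))), by fun_prop⟩
  have hT : ∀ t, T.comp (faceIncl (k + 1) 0 t) = cubeTail k := cubeTail_cubeTail_faceIncl_zero k
  have hT' : ∀ t, T.comp (faceIncl (k + 1) 1 t) = cubeTail k := cubeTail_cubeTail_faceIncl_one k
  have hTu : ∀ t u, T (faceIncl (k + 1) 0 t u) = cubeTail k u := fun t u =>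
    congrArg (fun f => f u) (hT t)
  have hTu' : ∀ t u, T (faceIncl (k + 1) 1 t u) = cubeTail k u := fun t u =>
    congrArg (fun f => f u) (hT' t)
  have hy0 : ∀ t, (y.comp T).comp (faceIncl (k + 1) 0 t) = y.comp (cubeTail k) := fun t => by
    rw [ContinuousMap.comp_assoc, hT]
  have hy1 : ∀ t, (y.comp T).comp (faceIncl (k + 1) 1 t) = y.comp (cubeTail k) := fun t => by
    rw [ContinuousMap.comp_assoc, hT']
  have hs0 : ∀ t, (s ∘ T) ∘ faceIncl (k + 1) 0 t = s ∘ cubeTail k := fun t =>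
    congrArg (fun f : C(Cube (k + 1), Cube k) => s ∘ f) (hT t)
  have hs1 : ∀ t, (s ∘ T) ∘ faceIncl (k + 1) 1 t = s ∘ cubeTail k := fun t =>
    congrArg (fun f : C(Cube (k + 1), Cube k) => s ∘ f) (hT' t)
  have h01 : ∀ t u, faceIncl (k + 1) 0 t u 1 = u 0 := fun t u => faceIncl_zero_succ (k + 1) t u 0
  have hb := isBranch_consSection (κ := κ) (lam := lam) (y := y.comp T) (w := w)
    (fun u => hΓ _ _) hZ (hs.comp T)
  have key := faceClass_square (R := R) hb (by
      intro a u hu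
      obtain ⟨j, hj⟩ := hy (T u) ⟨a, hu⟩
      exact ⟨j.succ, hj⟩)
  have hdeg : faceClass κ lam R (consCell (y.comp T) w fun u => hΓ _ _)
      (consSection κ lam (y.comp T) w (s ∘ T)) 1 0 = 0 := by
    refine cubeClass_eq_zero_of_degenerate (hb.comp _) 0 fun u v huv => ?_
    have h1 : cubeTail k u = cubeTail k v := funext fun j => huv _ (Fin.succ_ne_zero j)
    refine Subtype.ext (Prod.ext ?_ ?_)
    · change (y (T (faceIncl (k + 1) 1 0 u))).1.1 = (y (T (faceIncl (k + 1) 1 0 v))).1.1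
      rw [hTu', hTu', h1]
    · change (Fin.cons (w (faceIncl (k + 1) 1 0 u)) (y (T (faceIncl (k + 1) 1 0 u))).1.2 :
        Fin (ℓ + 1) → ℂ) = Fin.cons (w (faceIncl (k + 1) 1 0 v))
          (y (T (faceIncl (k + 1) 1 0 v))).1.2
      have h2 : w (faceIncl (k + 1) 1 0 u) = w (faceIncl (k + 1) 1 0 v) := by
        simp [w, hTu', h1, faceIncl_self]
      rw [hTu', hTu', h1, h2]
  rw [hdeg, add_zero] at key
  rwa [faceClass_consCell _ 0 1 (hy0 1) (hs0 1) (w' := curvePiece Γ α γ) (by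
      ext u
      simp [w, curvePiece, hTu, h01, faceIncl_self]),
    faceClass_consCell _ 0 0 (hy0 0) (hs0 0) (w' := curvePiece Γ α β) (by
      ext u
      simp [w, curvePiece, hTu, h01, faceIncl_self]),
    faceClass_consCell _ 1 1 (hy1 1) (hs1 1) (w' := curvePiece Γ β γ) (by
      ext u
      simp [w, curvePiece, hTu', faceIncl_one_zero, faceIncl_self])] at key

end Cons

/-! ### An outermost contour as a sum of contours around the single points -/

section Relation

variable {n : ℕ} {z : Fin n → ℂ} {R ε : ℝ} {ℓ : ℕ}

theorem inStrip_labelPt (hz : Admissible z R ε) {k : Fin n → ℕ} {e : Fin n × ℕ}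
    (he : e.2 < k e.1) (t : ℝ) :
    InStrip z (fun p => width ε (k p)) (labelPt z R ε e t) := by
  have h1 := contour_re_mem (z e.1) (width_pos hz.pos e.2).le R t
  have h2 := le_contour_im (z e.1) (w := width ε e.2) (R := R)
    (by linarith [hz.below e.1, width_pos hz.pos e.2]) t
  have h3 := width_strictMono hz.pos he
  refine ⟨e.1, ?_, ?_⟩
  · simp only [labelPt]
    rw [abs_lt]
    constructor <;> linarith
  · simp only [labelPt]
    linarith

theorem inStrip_point {w : Fin n → ℝ} (hw : ∀ p, 0 < w p) (p : Fin n) : InStrip z w (z p) :=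
  ⟨p, by simpa using hw p, by linarith [hw p]⟩

/-- The curve `envelope` for the outermost contours around each point. -/
def outerEnvelope (z : Fin n → ℂ) (R ε : ℝ) (k : Fin n → ℕ) : C(ℝ, ℂ) :=
  ⟨envelope z R fun p => width ε (k p), continuous_envelope _⟩

variable (hz : Admissible z R ε) {k : Fin n → ℕ} {e : Fin ℓ → Fin n × ℕ}
  (he : Function.Injective e) (hek : ∀ j, (e j).2 < k (e j).1)
include hek

theorem below_outerEnvelope (u : Cube ℓ) (ξ : ℝ) :
    Below (labelCell hz e he u) (outerEnvelope z R ε k ξ) :=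
  ⟨fun j => offCut_sub_envelope hz (fun _ => width_pos hz.pos _) (fun _ => width_lt hz.pos _)
      (inStrip_labelPt hz (hek j) _) ξ,
    fun p => offCut_sub_envelope hz (fun _ => width_pos hz.pos _) (fun _ => width_lt hz.pos _)
      (inStrip_point (fun _ => width_pos hz.pos _) p) ξ⟩

theorem below_farHomotopy {C : ℝ} (hC : ∀ p, ‖z p‖ + ε ≤ C) (hC0 : 0 ≤ C) (u : Cube ℓ) {τ : ℝ}
    (hτ : τ ≤ 1) (ξ : ℝ) :
    Below (labelCell hz e he u) (farHomotopy z R (fun p => width ε (k p))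
      (farRadius C (labelCell hz e he u)) τ ξ) := by
  set N := farRadius C (labelCell hz e he u) with hN
  have h0 : C ≤ N := le_add_of_nonneg_right (Finset.sum_nonneg fun _ _ => norm_nonneg _)
  have h1 : ∀ p, ‖z p‖ + ε ≤ N := fun p => (hC p).trans h0
  refine ⟨fun j => offCut_sub_farHomotopy hz (fun _ => width_pos hz.pos _)
      (fun _ => width_lt hz.pos _) h1 (inStrip_labelPt hz (hek j) _) ?_ hτ ξ,
    fun p => offCut_sub_farHomotopy hz (fun _ => width_pos hz.pos _) (fun _ => width_lt hz.pos _)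
      h1 (inStrip_point (fun _ => width_pos hz.pos _) p) ?_ hτ ξ⟩
  · have := Finset.single_le_sum (f := fun j => ‖(labelCell hz e he u).1.2 j‖)
      (fun _ _ => norm_nonneg _) (Finset.mem_univ j)
    simp only [hN, farRadius]
    exact le_add_of_nonneg_of_le hC0 this
  · linarith [h1 p, hz.pos]

/-- The class of the chain in which a new variable runs over a piece of the outer envelope. -/
def pieceClass (κ : ℝ) (lam : Fin n → ℂ) (α β : C(Cube ℓ, ℝ)) :
    ChainClass κ lam (fun _ : Unit => z) (ℓ + 1) R (ℓ + 1) :=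
  consClass κ lam R ((labelCell hz e he).comp (cubeTail ℓ))
    (labelSection κ lam z R ε e ∘ cubeTail ℓ) (curvePiece (outerEnvelope z R ε k) α β)
    fun _ => below_outerEnvelope hz he hek _ _

theorem pieceClass_add (κ : ℝ) (lam : Fin n → ℂ) (α β γ : C(Cube ℓ, ℝ)) :
    pieceClass hz he hek κ lam α γ =
      pieceClass hz he hek κ lam α β + pieceClass hz he hek κ lam β γ :=
  consClass_curvePiece_add (Z := fun _ : Unit => z) (fun _ => continuous_const) (isBranch_labelSection κ lam hz e he)
    (fun _ hu => labelCell_mem_infinity hz e he hu) _ (below_outerEnvelope hz he hek) α β γ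

/-- Between two neighbouring strips, and beyond all of them, the envelope runs at height `R`, so the
new variable is at infinity. -/
theorem pieceClass_eq_zero (κ : ℝ) (lam : Fin n → ℂ) (α β : C(Cube ℓ, ℝ))
    (h : ∀ p, (∀ u, (z p).re + width ε (k p) ≤ α u ∧ (z p).re + width ε (k p) ≤ β u) ∨
      ∀ u, α u ≤ (z p).re - width ε (k p) ∧ β u ≤ (z p).re - width ε (k p)) :
    pieceClass hz he hek κ lam α β = 0 := by
  refine cubeClass_eq_zero_of_infinity (isBranch_consSection _ (fun _ => continuous_const)
    ((isBranch_labelSection κ lam hz e he).comp _)) fun u => ⟨0, ?_⟩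
  change R ≤ (envelope z R (fun p => width ε (k p)) (α (cubeTail ℓ u) +
    u 0 * (β (cubeTail ℓ u) - α (cubeTail ℓ u)))).im
  have h0 := (u 0).2.1
  have h1 := (u 0).2.2
  rw [envelope_of_outside fun _ => width_pos hz.pos _]
  intro p
  rw [le_abs]
  rcases h p with h | h
  · left
    obtain ⟨h2, h3⟩ := h (cubeTail ℓ u)
    nlinarith
  · right
    obtain ⟨h2, h3⟩ := h (cubeTail ℓ u)
    nlinarith

/-- Induction on the number `m` of strips passed: the last part is cut at both walls of the strip of
the point number `m`, and the remainder to the right of it vanishes. Once `m` has reached `n`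
nothing is added. The end points are functions on the cube because the length of the far curve
varies with the configuration. -/
theorem pieceClass_eq_sum_of_le (κ : ℝ) (lam : Fin n → ℂ) (α : C(Cube ℓ, ℝ))
    (hα : ∀ p u, α u ≤ (z p).re - width ε (k p)) (m : ℕ) :
    ∀ β : C(Cube ℓ, ℝ), (∀ p : Fin n, (p : ℕ) < m → ∀ u, (z p).re + width ε (k p) ≤ β u) →
      (∀ p : Fin n, m ≤ (p : ℕ) → ∀ u, β u ≤ (z p).re - width ε (k p)) →
      pieceClass hz he hek κ lam α β = ∑ p : Fin n, if (p : ℕ) < m then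
        pieceClass hz he hek κ lam (ContinuousMap.const _ ((z p).re - width ε (k p)))
          (ContinuousMap.const _ ((z p).re + width ε (k p))) else 0 := by
  induction m with
  | zero =>
    intro β _ hβ
    rw [pieceClass_eq_zero hz he hek κ lam α β fun p => Or.inr fun u => ⟨hα p u, hβ p (by simp) u⟩]
    simp
  | succ m ih =>
    intro β hβ hβ'
    by_cases hm : m < n
    · have hw : ∀ p q : Fin n, p < q → (z p).re + width ε (k p) ≤ (z q).re - width ε (k q) := by
        intro p q hpq
        linarith [hz.gap p q hpq, width_lt hz.pos (k p), width_lt hz.pos (k q)]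
      let q : Fin n := ⟨m, hm⟩
      rw [pieceClass_add hz he hek κ lam α
          (ContinuousMap.const _ ((z q).re - width ε (k q))) β,
        pieceClass_add hz he hek κ lam (ContinuousMap.const _ ((z q).re - width ε (k q)))
          (ContinuousMap.const _ ((z q).re + width ε (k q))) β,
        pieceClass_eq_zero hz he hek κ lam (ContinuousMap.const _ ((z q).re + width ε (k q))) β,
        add_zero, ih]
      · rw [← Finset.sum_ite_eq_of_mem' Finset.univ q (fun p => pieceClass hz he hek κ lam
          (ContinuousMap.const _ ((z p).re - width ε (k p)))
          (ContinuousMap.const _ ((z p).re + width ε (k p)))) (Finset.mem_univ q),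
          ← Finset.sum_add_distrib]
        refine Finset.sum_congr rfl fun p _ => ?_
        rcases lt_trichotomy (p : ℕ) m with h | h | h
        · have : p ≠ q := fun e => by simp [q, e] at h
          simp [h, this, h.trans (Nat.lt_succ_self m)]
        · have : p = q := Fin.ext h
          simp [this, q]
        · have : p ≠ q := fun e => by simp [q, e] at h
          simp [this, h.not_gt, Nat.not_lt.2 (Nat.succ_le_of_lt h)]
      · exact fun p hp u => hw p q hp
      · intro p hp u
        rcases hp.eq_or_lt with hp | hp
        · have : q = p := Fin.ext hp
          rw [this]
          rfl
        · have h1 := hw q p hp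
          have h2 := width_pos hz.pos (k q)
          change (z q).re - width ε (k q) ≤ _
          linarith
      · intro p
        rcases le_or_gt p q with h | h
        · refine Or.inl fun u => ⟨?_, hβ p (Nat.lt_succ_of_le h) u⟩
          rcases h.eq_or_lt with h | h
          · rw [h]
            rfl
          · have h1 := hw p q h
            have h2 := width_pos hz.pos (k q)
            change _ ≤ (z q).re + width ε (k q)
            linarith
        · exact Or.inr fun u => ⟨hw q p h, hβ' p h u⟩
    · rw [ih β (fun p hp => hβ p (hp.trans (Nat.lt_succ_self m)))
        fun p hp => absurd (p.2.trans_le (not_lt.1 hm)) (not_lt.2 hp)]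
      refine Finset.sum_congr rfl fun p _ => ?_
      have h1 : (p : ℕ) < m := p.2.trans_le (not_lt.1 hm)
      simp [h1, h1.trans (Nat.lt_succ_self m)]

/-- The far curve is deformed to the envelope, with ends kept at height `R`, and the envelope is cut
into its strips. -/
theorem addContourClass_eq_sum (κ : ℝ) (lam : Fin n → ℂ) {C : ℝ} (hC : ∀ p, ‖z p‖ + ε ≤ C)
    (hC' : ∀ (_ : Unit) p, ‖z p‖ ≤ C) (hC0 : 0 ≤ C) :
    addContourClass hC' hC0 (fun _ => continuous_const) κ lam R ℓ ℓ
        (cubeClass κ lam R (labelCell hz e he) (labelSection κ lam z R ε e)) =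
      ∑ p, pieceClass hz he hek κ lam (ContinuousMap.const _ ((z p).re - width ε (k p)))
          (ContinuousMap.const _ ((z p).re + width ε (k p))) := by
  let N : C(Cube ℓ, ℝ) := ⟨fun u => farRadius C (labelCell hz e he u) + 1,
    ((continuous_farRadius C).comp (labelCell hz e he).continuous).add continuous_const⟩
  have hN : ∀ u, C + 1 ≤ N u := fun u => by
    have : 0 ≤ ∑ j, ‖(labelCell hz e he u).1.2 j‖ := Finset.sum_nonneg fun _ _ => norm_nonneg _
    simp only [N, ContinuousMap.coe_mk, farRadius]
    linarith
  have h1 : addContourClass hC' hC0 (fun _ => continuous_const) κ lam R ℓ ℓ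
        (cubeClass κ lam R (labelCell hz e he) (labelSection κ lam z R ε e)) =
      pieceClass hz he hek κ lam (-N) N := by
    rw [addContourClass_cubeClass]
    let T := (cubeTail ℓ).comp (cubeTail (ℓ + 1))
    let w : C(Cube (ℓ + 2), ℂ) :=
      ⟨fun u => farHomotopy z R (fun p => width ε (k p)) (farRadius C (labelCell hz e he (T u)))
        (u 0) ((2 * (u 1 : ℝ) - 1) * N (T u)), by
        have h1 := (continuous_farRadius C).comp ((labelCell hz e he).continuous.comp T.continuous)
        have h2 : Continuous fun u : Cube (ℓ + 2) => envelope z R (fun p => width ε (k p))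
          ((2 * (u 1 : ℝ) - 1) * N (T u)) := (continuous_envelope _).comp (by fun_prop)
        have h3 := Complex.continuous_re.comp h2
        have h4 := Complex.continuous_im.comp h2
        simp only [Function.comp_def] at h1 h3 h4
        unfold farHomotopy farCurve
        refine continuous_complex_mk ?_ ?_ <;> fun_prop⟩
    have h01 : ∀ t u, faceIncl (ℓ + 1) 0 t u 1 = u 0 := fun t u =>
      faceIncl_zero_succ (ℓ + 1) t u 0
    have hTu : ∀ t u, T (faceIncl (ℓ + 1) 0 t u) = cubeTail ℓ u := fun t u =>
      congrArg (fun f => f u) (cubeTail_cubeTail_faceIncl_zero ℓ t)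
    refine (consClass_homotopy (Z := fun _ : Unit => z) (fun _ => continuous_const)
      (isBranch_labelSection κ lam hz e he) (fun _ hu => labelCell_mem_infinity hz e he hu) w
      (fun u => below_farHomotopy hz he hek hC hC0 _ (u 0).2.2 _) ?_ (w₀ := farPoint R C _)
      (w₁ := curvePiece (outerEnvelope z R ε k) (-N) N) ?_ ?_ (below_farPoint hC' hC0 _)
      fun _ => below_outerEnvelope hz he hek _ _).symm
    · intro u hu
      refine (farHomotopy_im_of_end (fun _ => width_pos hz.pos _) (fun _ => width_lt hz.pos _)
        (fun p => ?_) ?_ _).ge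
      · have := hN (T u)
        simp only [N, ContinuousMap.coe_mk] at this
        linarith [hC p]
      · have h2 := hN (T u)
        rw [abs_mul, abs_of_pos (by linarith : 0 < N (T u))]
        rcases hu with hu | hu <;> rw [hu] <;> norm_num [N]
    · ext u
      simp only [w, ContinuousMap.comp_apply, ContinuousMap.coe_mk, faceIncl_self, h01, hTu]
      exact farHomotopy_zero _ _ _
    · ext u
      simp only [w, ContinuousMap.comp_apply, ContinuousMap.coe_mk, faceIncl_self, h01, hTu]
      refine (farHomotopy_one _ _ _).trans ?_
      simp only [curvePiece, outerEnvelope, ContinuousMap.coe_mk, ContinuousMap.coe_neg,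
        Pi.neg_apply]
      congr 1
      ring
  have hb : ∀ p u, |(z p).re| + width ε (k p) ≤ N u := fun p u => by
    linarith [Complex.abs_re_le_norm (z p), hC p, hN u, width_lt hz.pos (k p)]
  rw [h1, pieceClass_eq_sum_of_le hz he hek κ lam (-N) _ n]
  · exact Finset.sum_congr rfl fun p _ => by simp
  · exact fun p _ u => by linarith [hb p u, le_abs_self (z p).re]
  · exact fun p hp => absurd p.2 (not_lt.2 hp)
  · intro p u
    change -N u ≤ _
    linarith [hb p u, neg_abs_le (z p).re]

include he in
theorem cons_injective (p : Fin n) : Function.Injective (Fin.cons (p, k p) e : Fin (ℓ + 1) → _) :=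
  Fin.cons_injective_iff.2 ⟨fun ⟨j, hj⟩ => by
    have := hek j
    rw [hj] at this
    exact lt_irrefl _ this, he⟩

/-- The left side always subtracts the new variable, the right side subtracts the left object from
the right one. They disagree exactly for the contours and the points to the left of `p`. Each such
contour gives `πi` with weight `2 / κ`, that is `q ^ 2`, and each such point `q` gives `πi` with
weight `-lam q / κ`. -/
theorem consSection_labelSection (κ : ℝ) (lam : Fin n → ℂ) (p : Fin n) (u : Cube (ℓ + 1)) :
    labelSection κ lam z R ε e (cubeTail ℓ u) * consFactor κ lam (labelCell hz e he (cubeTail ℓ u))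
        (labelPt z R ε (p, k p) (u 0)) =
      qPow κ ((∑ j, if (e j).1 < p then 2 else 0) - ∑ q ∈ Finset.Iio p, lam q) *
        labelSection κ lam z R ε (Fin.cons (p, k p) e) u := by
  have hx : ∀ j, brLog (labelPt z R ε (e j) (u j.succ) - labelPt z R ε (p, k p) (u 0)) =
      brLog (if LabelLeft (p, k p) (e j)
        then labelPt z R ε (e j) (u j.succ) - labelPt z R ε (p, k p) (u 0)
        else labelPt z R ε (p, k p) (u 0) - labelPt z R ε (e j) (u j.succ)) +
      if (e j).1 < p then Real.pi * Complex.I else 0 := by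
    intro j
    have h1 := contour_re_mem (z (e j).1) (width_pos hz.pos (e j).2).le R (u j.succ)
    have h2 := contour_re_mem (z p) (width_pos hz.pos (k p)).le R (u 0)
    have h3 := width_lt hz.pos (e j).2
    have h4 := width_lt hz.pos (k p)
    by_cases h : (e j).1 < p
    · have h' : ¬LabelLeft (p, k p) (e j) := by
        rintro (h' | h')
        · exact h.not_gt h'
        · exact h.ne h'.1.symm
      rw [if_neg h', if_pos h, ← brLog_neg, neg_sub]
      have := hz.gap _ _ h
      simp only [labelPt, Complex.sub_re]
      linarith
    -- The new contour is the outermost one around `p`, so it starts to the left also of the other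
    -- contours around `p`.
    · have h' : LabelLeft (p, k p) (e j) := by
        rcases (not_lt.1 h).lt_or_eq with h' | h'
        · exact Or.inl h'
        · refine Or.inr ⟨h', ?_⟩
          have := hek j
          rwa [← h'] at this
      rw [if_pos h', if_neg h, add_zero]
  have hp : ∀ q, brLog (z q - labelPt z R ε (p, k p) (u 0)) =
      brLog (if p ≤ q then z q - labelPt z R ε (p, k p) (u 0)
        else labelPt z R ε (p, k p) (u 0) - z q) + if q < p then Real.pi * Complex.I else 0 := by
    intro q
    by_cases h : q < p
    · rw [if_neg (not_le.2 h), if_pos h, ← brLog_neg, neg_sub]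
      have h2 := contour_re_mem (z p) (width_pos hz.pos (k p)).le R (u 0)
      have h4 := width_lt hz.pos (k p)
      have := hz.gap _ _ h
      simp only [labelPt, Complex.sub_re]
      linarith [hz.pos]
    · rw [if_pos (not_lt.1 h), if_neg h, add_zero]
  have hq : ∑ q ∈ Finset.Iio p, lam q = ∑ q, if q < p then lam q else 0 := by
    rw [← Finset.sum_filter]
    congr 1
    ext q
    simp
  have h1 : ∑ j, 2 / (κ : ℂ) * brLog (labelPt z R ε (e j) (u j.succ) -
      labelPt z R ε (p, k p) (u 0)) = Real.pi * Complex.I / κ * (∑ j, if (e j).1 < p then 2 else 0)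
      + ∑ j, 2 / (κ : ℂ) * brLog (if LabelLeft (p, k p) (e j)
        then labelPt z R ε (e j) (u j.succ) - labelPt z R ε (p, k p) (u 0)
        else labelPt z R ε (p, k p) (u 0) - labelPt z R ε (e j) (u j.succ)) := by
    rw [Finset.mul_sum, ← Finset.sum_add_distrib]
    refine Finset.sum_congr rfl fun j _ => ?_
    rw [hx j]
    split_ifs <;> ring
  have h2 : ∑ q, -(lam q / (κ : ℂ)) * brLog (z q - labelPt z R ε (p, k p) (u 0)) =
      -(Real.pi * Complex.I / κ * ∑ q ∈ Finset.Iio p, lam q) + ∑ q, -(lam q / (κ : ℂ)) *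
        brLog (if p ≤ q then z q - labelPt z R ε (p, k p) (u 0)
        else labelPt z R ε (p, k p) (u 0) - z q) := by
    rw [hq, Finset.mul_sum, ← Finset.sum_neg_distrib, ← Finset.sum_add_distrib]
    refine Finset.sum_congr rfl fun j _ => ?_
    rw [hp j]
    split_ifs <;> ring
  have h3 : consFactor κ lam (labelCell hz e he (cubeTail ℓ u)) (labelPt z R ε (p, k p) (u 0)) =
      Complex.exp ((∑ j, 2 / (κ : ℂ) * brLog (labelPt z R ε (e j) (u j.succ) -
        labelPt z R ε (p, k p) (u 0))) +
      ∑ q, -(lam q / (κ : ℂ)) * brLog (z q - labelPt z R ε (p, k p) (u 0))) := rfl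
  rw [h3, h1, h2]
  simp only [labelSection, qPow, Fin.sum_univ_succ, Fin.sum_Ioi_zero, Fin.sum_Ioi_succ,
    Fin.cons_zero, Fin.cons_succ, cubeTail, ContinuousMap.coe_mk]
  rw [← Complex.exp_add, ← Complex.exp_add]
  congr 1
  ring

theorem pieceClass_eq (κ : ℝ) (lam : Fin n → ℂ) (p : Fin n) :
    pieceClass hz he hek κ lam (ContinuousMap.const _ ((z p).re - width ε (k p)))
        (ContinuousMap.const _ ((z p).re + width ε (k p))) =
      qPow κ ((∑ j, if (e j).1 < p then 2 else 0) - ∑ q ∈ Finset.Iio p, lam q) •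
        cubeClass κ lam R (labelCell hz (Fin.cons (p, k p) e) (cons_injective he hek p))
          (labelSection κ lam z R ε (Fin.cons (p, k p) e)) := by
  have hw : ∀ u : Cube (ℓ + 1), curvePiece (outerEnvelope z R ε k)
      (ContinuousMap.const _ ((z p).re - width ε (k p)))
      (ContinuousMap.const _ ((z p).re + width ε (k p))) u = labelPt z R ε (p, k p) (u 0) := by
    intro u
    have := envelope_of_mem hz (w := fun p => width ε (k p)) (fun _ => width_pos hz.pos _)
      (fun _ => width_lt hz.pos _) p (u 0).2.1 (u 0).2.2
    rw [labelPt, ← this]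
    simp only [curvePiece, outerEnvelope, ContinuousMap.coe_mk, ContinuousMap.const_apply]
    congr 1
    ring
  rw [← cubeClass_smul]
  unfold pieceClass consClass
  congr 1
  · ext u : 1
    refine Subtype.ext (Prod.ext rfl (funext fun j => ?_))
    refine Fin.cases ?_ (fun j => ?_) j
    · exact hw u
    · rfl
  · ext u
    simp only [consSection, hw, Pi.smul_apply, smul_eq_mul]
    exact consSection_labelSection hz he hek κ lam p u

end Relation

/-! ### The added contour acts as the coproduct of `F` -/

section GomezSierraRelation

variable {n : ℕ} {z : Fin n → ℂ} {R ε : ℝ} {ℓ : ℕ}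

/-- The coefficients of the iterated coproduct of `F`. -/
def coproductCoeff (κ : ℝ) (lam : Fin n → ℂ) (k : Fin n → ℕ) (p : Fin n) : ℂ :=
  qPow κ (∑ q ∈ Finset.Iio p, (2 * k q - lam q))

theorem sum_add_single {k : Fin n → ℕ} (hk : ∑ p, k p = ℓ) (p : Fin n) :
    ∑ q, (k + Pi.single p 1 : Fin n → ℕ) q = ℓ + 1 := by
  simp [Finset.sum_add_distrib, hk]

/-- Adding an outermost contour around all points is the action of `F` on the tensor product. -/
theorem antiClass_addContourClass_gsClass (κ : ℝ) (lam : Fin n → ℂ) (hz : Admissible z R ε)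
    {C : ℝ} (hC : ∀ p, ‖z p‖ + ε ≤ C) (hC' : ∀ (_ : Unit) p, ‖z p‖ ≤ C) (hC0 : 0 ≤ C)
    (k : Fin n → ℕ) (hk : ∑ p, k p = ℓ) :
    antiClass κ lam (fun _ : Unit => z) (ℓ + 1) R (ℓ + 1)
        (addContourClass hC' hC0 (fun _ => continuous_const) κ lam R ℓ ℓ
          (gsClass κ lam hz k hk)) =
      (ℓ.factorial : ℂ) • ∑ p, coproductCoeff κ lam k p •
        gsClass κ lam hz (k + Pi.single p 1) (sum_add_single hk p) := by
  have hek : ∀ j, (gsLabel k hk j).2 < k (gsLabel k hk j).1 := fun j => (label k hk j).2.2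
  have he := gsLabel_injective k hk
  rw [gsClass, labelClass, antiClass_addContourClass_antiClass,
    addContourClass_eq_sum hz he hek κ lam hC, map_sum]
  congr 1
  refine Finset.sum_congr rfl fun p _ => ?_
  rw [pieceClass_eq, map_smul]
  congr 1
  -- Each point `q < p` is surrounded by `k q` contours, and each of them contributes `2` to the
  -- exponent.
  · rw [coproductCoeff, sum_gsLabel k hk fun q => if q < p then 2 else 0, Finset.sum_sub_distrib]
    congr 2
    rw [← Finset.sum_filter_add_sum_filter_not Finset.univ fun q => q < p,
      Finset.sum_eq_zero (s := Finset.univ.filter fun q => ¬q < p), add_zero]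
    · have : Finset.univ.filter (fun q => q < p) = Finset.Iio p := by
        ext q
        simp
      rw [this]
      refine Finset.sum_congr rfl fun q hq => ?_
      rw [if_pos (Finset.mem_Iio.1 hq), mul_comm]
    · intro q hq
      rw [if_neg (Finset.mem_filter.1 hq).2, mul_zero]
  -- Contours are numbered from `0`, so the label `(p, k p)` is the next one free around `p`.
  · refine labelClass_congr κ lam hz (cons_injective he hek p)
      (gsLabel_injective _ (sum_add_single hk p)) ?_
    rw [range_gsLabel, Fin.range_cons, range_gsLabel]
    ext ⟨q, b⟩
    by_cases hq : q = p
    · subst hq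
      simp
      omega
    · simp [hq]

end GomezSierraRelation

/-! ### Families of maps of the plane -/

section PlaneMaps

variable {B B' : Type} [TopologicalSpace B] [TopologicalSpace B'] {n : ℕ}

/-- A continuous family of injective maps of the plane that carries the points of one family to
the points of another one, with a continuous logarithm of the difference quotients. -/
structure PlaneMap (Z : B → Fin n → ℂ) (Z' : B' → Fin n → ℂ) (R : ℝ) where
  base : C(B, B')
  map : B → ℂ → ℂ
  log : B → ℂ → ℂ → ℂ
  continuous_points : ∀ p, Continuous fun b => Z b p
  continuous_map : Continuous fun q : B × ℂ => map q.1 q.2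
  continuousOn_log :
    ContinuousOn (fun q : B × ℂ × ℂ => log q.1 q.2.1 q.2.2) {q | q.2.1 ≠ q.2.2}
  exp_log : ∀ b x y, x ≠ y → Complex.exp (log b x y) * (x - y) = map b x - map b y
  map_points : ∀ b p, Z' (base b) p = map b (Z b p)
  le_im_map : ∀ b x, R ≤ x.im → R ≤ (map b x).im

namespace PlaneMap

variable {κ : ℝ} {lam : Fin n → ℂ} {Z : B → Fin n → ℂ} {Z' : B' → Fin n → ℂ} {ℓ : ℕ} {R : ℝ}
  (G : PlaneMap Z Z' R)

theorem map_ne (b : B) {x y : ℂ} (h : x ≠ y) : G.map b x ≠ G.map b y := by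
  rw [← sub_ne_zero, ← G.exp_log b x y h]
  exact mul_ne_zero (Complex.exp_ne_zero _) (sub_ne_zero.2 h)

theorem continuous_map_comp {α : Type*} [TopologicalSpace α] {b : α → B} {x : α → ℂ}
    (hb : Continuous b) (hx : Continuous x) : Continuous fun a => G.map (b a) (x a) :=
  G.continuous_map.comp (hb.prodMk hx)

theorem continuous_log_comp {α : Type*} [TopologicalSpace α] {b : α → B} {x y : α → ℂ}
    (hb : Continuous b) (hx : Continuous x) (hy : Continuous y) (h : ∀ a, x a ≠ y a) :
    Continuous fun a => G.log (b a) (x a) (y a) :=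
  G.continuousOn_log.comp_continuous (hb.prodMk (hx.prodMk hy)) h

/-- The map of configuration spaces. -/
def configMap (ℓ : ℕ) : C(Config Z ℓ, Config Z' ℓ) where
  toFun c := ⟨(G.base c.1.1, fun j => G.map c.1.1 (c.1.2 j)),
    fun j l hjl => G.map_ne _ (c.2.1 j l hjl),
    fun j p => by
      rw [G.map_points]
      exact G.map_ne _ (c.2.2 j p)⟩
  continuous_toFun := by
    refine Continuous.subtype_mk (Continuous.prodMk (by fun_prop) (continuous_pi fun j => ?_)) _
    exact G.continuous_map_comp (by fun_prop) (by fun_prop)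

/-- The quotient of `Ψ` after and before the map. -/
def factor (κ : ℝ) (lam : Fin n → ℂ) (c : Config Z ℓ) : ℂ :=
  Complex.exp ((∑ j, ∑ l ∈ Finset.Ioi j, 2 / (κ : ℂ) * G.log c.1.1 (c.1.2 j) (c.1.2 l)) +
    (∑ j, ∑ p, -(lam p / (κ : ℂ)) * G.log c.1.1 (c.1.2 j) (Z c.1.1 p)) +
    ∑ p, ∑ r ∈ Finset.Ioi p, lam p * lam r / (2 * (κ : ℂ)) *
      G.log c.1.1 (Z c.1.1 p) (Z c.1.1 r))

theorem factor_eq_one {c : Config Z ℓ} (h : ∀ x y, G.log c.1.1 x y = 0) :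
    G.factor κ lam c = 1 := by
  simp [factor, h]

/-- The logarithm of a difference after the map is the old one plus `G.log`. The map does not
preserve the values of `Ψ`, which is why the section is multiplied by the nonconstant `G.factor`. -/
theorem isBranch {k : ℕ} {y : C(Cube k, Config Z ℓ)} {s : Cube k → ℂ}
    (h : IsBranch κ lam Z y s) :
    IsBranch κ lam Z' ((G.configMap ℓ).comp y) (s * fun u => G.factor κ lam (y u)) := by
  obtain ⟨c, L, K, M, hL, hK, hM, hs⟩ := h
  have hb : Continuous fun u => (y u).1.1 := by fun_prop
  have hx : ∀ j, Continuous fun u => (y u).1.2 j := fun j => by fun_prop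
  have hz : ∀ p, Continuous fun u => Z (y u).1.1 p := fun p => (G.continuous_points p).comp hb
  -- That the points `Z_p` are distinct along the cube is not assumed of the family; the logarithms
  -- `M` in the branch imply it.
  have hne : ∀ p r, p < r → ∀ u, Z (y u).1.1 p ≠ Z (y u).1.1 r := fun p r hpr u => by
    rw [← sub_ne_zero, ← (hM p r hpr).2 u]
    exact Complex.exp_ne_zero _
  refine ⟨c, fun j l u => L j l u + G.log (y u).1.1 ((y u).1.2 j) ((y u).1.2 l),
    fun j p u => K j p u + G.log (y u).1.1 ((y u).1.2 j) (Z (y u).1.1 p),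
    fun p r u => M p r u + G.log (y u).1.1 (Z (y u).1.1 p) (Z (y u).1.1 r), ?_, ?_, ?_, ?_⟩
  · intro j l hjl
    have hne : ∀ u, (y u).1.2 j ≠ (y u).1.2 l := fun u => (y u).2.1 j l hjl.ne
    refine ⟨(hL j l hjl).1.add (G.continuous_log_comp hb (hx j) (hx l) hne), fun u => ?_⟩
    rw [Complex.exp_add, (hL j l hjl).2, mul_comm, G.exp_log _ _ _ (hne u)]
    rfl
  · intro j p
    have hne : ∀ u, (y u).1.2 j ≠ Z (y u).1.1 p := fun u => (y u).2.2 j p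
    refine ⟨(hK j p).1.add (G.continuous_log_comp hb (hx j) (hz p) hne), fun u => ?_⟩
    rw [Complex.exp_add, (hK j p).2, mul_comm, G.exp_log _ _ _ (hne u), ← G.map_points]
    rfl
  · intro p r hpr
    refine ⟨(hM p r hpr).1.add (G.continuous_log_comp hb (hz p) (hz r) (hne p r hpr)),
      fun u => ?_⟩
    rw [Complex.exp_add, (hM p r hpr).2, mul_comm, G.exp_log _ _ _ (hne p r hpr u),
      ← G.map_points, ← G.map_points]
    rfl
  · intro u
    rw [Pi.mul_apply, hs u, factor, mul_assoc, ← Complex.exp_add]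
    congr 2
    simp only [mul_add, Finset.sum_add_distrib]
    ring

theorem mem_infinity {c : Config Z ℓ} (h : c ∈ infinity Z ℓ R) :
    G.configMap ℓ c ∈ infinity Z' ℓ R := by
  obtain ⟨j, hj⟩ := h
  exact ⟨j, G.le_im_map _ _ hj⟩

/-- Push-forward of twisted chains. -/
def push (κ : ℝ) (lam : Fin n → ℂ) (ℓ k : ℕ) : PreChain Z ℓ k →ₗ[ℂ] PreChain Z' ℓ k :=
  Finsupp.lsum ℂ fun y => Finsupp.lsingle ((G.configMap ℓ).comp y) ∘ₗ
    LinearMap.mulRight ℂ fun u => G.factor κ lam (y u)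

theorem push_single (k : ℕ) (y : C(Cube k, Config Z ℓ)) (s : Cube k → ℂ) :
    G.push κ lam ℓ k (Finsupp.single y s) =
      Finsupp.single ((G.configMap ℓ).comp y) (s * fun u => G.factor κ lam (y u)) := by
  simp [push]

theorem push_boundary (k : ℕ) (c : PreChain Z ℓ (k + 1)) :
    G.push κ lam ℓ k (boundary Z ℓ k c) = boundary Z' ℓ k (G.push κ lam ℓ (k + 1) c) := by
  induction c using Finsupp.induction_linear with
  | zero => simp
  | add c d hc hd => simp only [map_add, hc, hd]
  | single y s =>
    simp only [boundary, LinearMap.sum_apply, LinearMap.smul_apply, LinearMap.sub_apply, map_sum,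
      map_smul, map_sub, face_single, push_single]
    rfl

theorem push_mem_boundaries (k : ℕ) :
    boundaries κ lam Z ℓ R k ≤ (boundaries κ lam Z' ℓ R k).comap (G.push κ lam ℓ k) := by
  refine sup_le (fun c hc => Submodule.mem_sup_left ?_) ?_
  · revert c
    change trivialChains κ lam Z ℓ R k ≤
      (trivialChains κ lam Z' ℓ R k).comap (G.push κ lam ℓ k)
    refine sup_le (Submodule.span_le.2 ?_) (Submodule.span_le.2 ?_)
    · rintro _ ⟨y, s, hs, hy, rfl⟩
      exact Submodule.mem_comap.2 (Submodule.mem_sup_left (Submodule.subset_span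
        ⟨_, _, G.isBranch hs, fun u => G.mem_infinity (hy u), G.push_single k y s⟩))
    · rintro _ ⟨y, s, hs, ⟨a, ha⟩, rfl⟩
      refine Submodule.mem_comap.2 (Submodule.mem_sup_right (Submodule.subset_span
        ⟨_, _, G.isBranch hs, ⟨a, fun u v huv => ?_⟩, G.push_single k y s⟩))
      simp [ha u v huv]
  · rintro _ ⟨c, hc, rfl⟩
    refine Submodule.mem_sup_right ⟨G.push κ lam ℓ (k + 1) c, ?_, (G.push_boundary k c).symm⟩
    revert c
    change chains κ lam Z ℓ (k + 1) ≤ (chains κ lam Z' ℓ (k + 1)).comap (G.push κ lam ℓ (k + 1))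
    refine Submodule.span_le.2 ?_
    rintro _ ⟨y, s, hs, rfl⟩
    exact Submodule.mem_comap.2 (Submodule.subset_span
      ⟨_, _, G.isBranch hs, G.push_single (k + 1) y s⟩)

/-- The map induced on classes of chains. -/
def pushClass (κ : ℝ) (lam : Fin n → ℂ) (ℓ k : ℕ) :
    ChainClass κ lam Z ℓ R k →ₗ[ℂ] ChainClass κ lam Z' ℓ R k :=
  Submodule.mapQ _ _ (G.push κ lam ℓ k) (G.push_mem_boundaries k)

theorem pushClass_cubeClass {k : ℕ} (y : C(Cube k, Config Z ℓ)) (s : Cube k → ℂ) :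
    G.pushClass κ lam ℓ k (cubeClass κ lam R y s) =
      cubeClass κ lam R ((G.configMap ℓ).comp y) (s * fun u => G.factor κ lam (y u)) := by
  rw [cubeClass, pushClass, Submodule.mkQ_apply, Submodule.mapQ_apply, push_single]
  rfl

end PlaneMap

end PlaneMaps

/-! ### Twists of a disc -/

theorem one_sub_mem_slitPlane {w : ℂ} (h : ‖w‖ ≤ 1) (h' : w ≠ 1) :
    1 - w ∈ Complex.slitPlane := by
  rw [Complex.mem_slitPlane_iff]
  by_contra! hc
  obtain ⟨h1, h2⟩ := hc
  simp only [Complex.sub_re, Complex.one_re, Complex.sub_im, Complex.one_im, zero_sub,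
    neg_eq_zero] at h1 h2
  refine h' (Complex.ext ?_ (by simpa using h2))
  have := (Complex.re_le_norm w).trans h
  simp only [Complex.one_re]
  linarith

/-- A logarithm of `(x e^{ia} - y e^{ib}) / (x - y)` for `‖y‖ ≤ ‖x‖`. -/
def halfTwistLog (a b : ℝ) (x y : ℂ) : ℂ :=
  a * Complex.I + Complex.log (1 - y / x * Complex.exp ((b - a) * Complex.I)) -
    Complex.log (1 - y / x)

/-- A logarithm of `(x e^{ia} - y e^{ib}) / (x - y)`. -/
def twistLog (a b : ℝ) (x y : ℂ) : ℂ :=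
  if ‖y‖ ≤ ‖x‖ then halfTwistLog a b x y else halfTwistLog b a y x

/-- Both `y / x` and its rotation lie in the closed unit disc and differ from `1`: on the unit
circle the rotation is trivial by `hab`. Subtracting them from `1` gives a nonzero number in the
closed right half-plane and off the slit. -/
theorem halfTwistLog_mem {a b : ℝ} {x y : ℂ} (hxy : x ≠ y) (h : ‖y‖ ≤ ‖x‖)
    (hab : ‖y‖ = ‖x‖ → a = b) :
    x ≠ 0 ∧ 1 - y / x * Complex.exp ((b - a) * Complex.I) ∈ Complex.slitPlane ∧
      1 - y / x ∈ Complex.slitPlane := by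
  have hx : x ≠ 0 := by
    rintro rfl
    simp only [norm_zero, norm_le_zero_iff] at h
    exact hxy h.symm
  have hx' : 0 < ‖x‖ := norm_pos_iff.2 hx
  have h1 : ‖y / x‖ ≤ 1 := by
    rw [norm_div]
    exact div_le_one_of_le₀ h hx'.le
  have hn : ‖Complex.exp ((b - a) * Complex.I)‖ = 1 := by
    exact_mod_cast Complex.norm_exp_ofReal_mul_I (b - a)
  have h2 : y / x ≠ 1 := fun e => hxy ((div_eq_one_iff_eq hx).1 e).symm
  refine ⟨hx, one_sub_mem_slitPlane (by rw [norm_mul, hn, mul_one]; exact h1) fun e => h2 ?_,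
    one_sub_mem_slitPlane h1 h2⟩
  have h3 := congrArg norm e
  rw [norm_mul, hn, mul_one, norm_div, norm_one, div_eq_one_iff_eq hx'.ne'] at h3
  simpa [hab h3] using e

theorem exp_halfTwistLog {a b : ℝ} {x y : ℂ} (hxy : x ≠ y) (h : ‖y‖ ≤ ‖x‖)
    (hab : ‖y‖ = ‖x‖ → a = b) :
    Complex.exp (halfTwistLog a b x y) * (x - y) =
      x * Complex.exp (a * Complex.I) - y * Complex.exp (b * Complex.I) := by
  obtain ⟨hx, h1, h2⟩ := halfTwistLog_mem hxy h hab
  have h3 := Complex.slitPlane_ne_zero h2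
  rw [halfTwistLog, Complex.exp_sub, Complex.exp_add, Complex.exp_log (Complex.slitPlane_ne_zero h1),
    Complex.exp_log h3]
  have h4 : x - y = x * (1 - y / x) := by field_simp
  have h5 : Complex.exp (b * Complex.I) =
      Complex.exp (a * Complex.I) * Complex.exp ((b - a) * Complex.I) := by
    rw [← Complex.exp_add]
    ring_nf
  rw [h4, h5]
  field_simp

theorem exp_twistLog {a b : ℝ} {x y : ℂ} (hxy : x ≠ y) (hab : ‖y‖ = ‖x‖ → a = b) :
    Complex.exp (twistLog a b x y) * (x - y) =
      x * Complex.exp (a * Complex.I) - y * Complex.exp (b * Complex.I) := by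
  unfold twistLog
  split_ifs with h
  · exact exp_halfTwistLog hxy h hab
  · have := exp_halfTwistLog hxy.symm (not_le.1 h).le fun e => (hab e.symm).symm
    linear_combination -this

theorem twistLog_zero (x y : ℂ) : twistLog 0 0 x y = 0 := by simp [twistLog, halfTwistLog]

theorem continuousOn_halfTwistLog {α : Type*} [TopologicalSpace α] {a b : α → ℝ} {x y : α → ℂ}
    (ha : Continuous a) (hb : Continuous b) (hx : Continuous x) (hy : Continuous y)
    (hxy : ∀ q, x q ≠ y q) (hab : ∀ q, ‖y q‖ = ‖x q‖ → a q = b q) :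
    ContinuousOn (fun q => halfTwistLog (a q) (b q) (x q) (y q)) {q | ‖y q‖ ≤ ‖x q‖} := by
  have hd : ContinuousOn (fun q => y q / x q) {q | ‖y q‖ ≤ ‖x q‖} :=
    hy.continuousOn.div hx.continuousOn fun q hq => (halfTwistLog_mem (hxy q) hq (hab q)).1
  unfold halfTwistLog
  refine ContinuousOn.sub (ContinuousOn.add (by fun_prop) (ContinuousOn.clog ?_ fun q hq =>
    (halfTwistLog_mem (hxy q) hq (hab q)).2.1)) (ContinuousOn.clog (by fun_prop) fun q hq =>
      (halfTwistLog_mem (hxy q) hq (hab q)).2.2)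
  exact continuousOn_const.sub (hd.mul (by fun_prop))

/-- On the locus `‖y‖ = ‖x‖` one has `a = b`, so both formulas reduce to `a * I` and fit together.
-/
theorem continuous_twistLog {α : Type*} [TopologicalSpace α] {a b : α → ℝ} {x y : α → ℂ}
    (ha : Continuous a) (hb : Continuous b) (hx : Continuous x) (hy : Continuous y)
    (hxy : ∀ q, x q ≠ y q) (hab : ∀ q, ‖y q‖ = ‖x q‖ → a q = b q) :
    Continuous fun q => twistLog (a q) (b q) (x q) (y q) := by
  unfold twistLog
  refine continuous_if_le (by fun_prop) (by fun_prop)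
    (continuousOn_halfTwistLog ha hb hx hy hxy hab)
    (continuousOn_halfTwistLog hb ha hy hx (fun q => (hxy q).symm)
      fun q h => (hab q h.symm).symm) fun q hq => ?_
  have := hab q hq
  simp [halfTwistLog, this]

/-! ### The fibre at the end as a retract of the family over the half-turn -/

section Retraction

variable {n : ℕ} (i : Fin n) (z : Fin (n + 1) → ℂ)

/-- The centre of the half-turn. -/
def turnCentre : ℂ := (z i.castSucc + z i.succ) / 2

/-- The radius of the half-turn. -/
def turnRadius : ℝ := ‖z i.castSucc - z i.succ‖ / 2

theorem exchangePath_castSucc (t : unitInterval) : exchangePath i z t i.castSucc =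
    turnCentre i z - (z i.succ - z i.castSucc) / 2 * Complex.exp (Real.pi * Complex.I * (t : ℝ)) := by
  simp only [exchangePath, turnCentre, if_true]
  ring

theorem exchangePath_succ (t : unitInterval) : exchangePath i z t i.succ =
    turnCentre i z + (z i.succ - z i.castSucc) / 2 * Complex.exp (Real.pi * Complex.I * (t : ℝ)) := by
  have : i.succ ≠ i.castSucc := i.castSucc_lt_succ.ne'
  simp only [exchangePath, turnCentre, if_true, this, if_false]
  ring

theorem exchangePath_of_ne (t : unitInterval) {p : Fin (n + 1)} (h : p ≠ i.castSucc)
    (h' : p ≠ i.succ) : exchangePath i z t p = z p := by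
  simp [exchangePath, h, h']

theorem continuous_exchangePath (p : Fin (n + 1)) : Continuous fun t => exchangePath i z t p := by
  unfold exchangePath
  split_ifs <;> fun_prop

theorem norm_exp_half_turn (t : unitInterval) :
    ‖Complex.exp (Real.pi * Complex.I * (t : ℝ))‖ = 1 := by
  have := Complex.norm_exp_ofReal_mul_I (Real.pi * t)
  rw [← this]
  push_cast
  ring_nf

theorem norm_exchangePath_sub {t : unitInterval} {p : Fin (n + 1)}
    (hp : p = i.castSucc ∨ p = i.succ) :
    ‖exchangePath i z t p - turnCentre i z‖ = turnRadius i z := by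
  have : ‖(z i.succ - z i.castSucc) / 2‖ = turnRadius i z := by
    rw [norm_div, norm_sub_rev, turnRadius]
    simp
  rcases hp with rfl | rfl
  · rw [exchangePath_castSucc, sub_sub_cancel_left, norm_neg, norm_mul, norm_exp_half_turn, this,
      mul_one]
  · rw [exchangePath_succ, add_sub_cancel_left, norm_mul, norm_exp_half_turn, this, mul_one]

variable {i z}

/-- With `d` half the vector between the two points, the right point is at the top of the circle at
the time `1/2 - arg d / π`. This time lies in `[0, 1]` because `Re d > 0`, and `R` exceeds the
height of the point then. -/
theorem turnCentre_im_add_turnRadius_lt {R : ℝ} (hre : (z i.castSucc).re < (z i.succ).re)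
    (hR : ∀ t p, (exchangePath i z t p).im < R) :
    (turnCentre i z).im + turnRadius i z < R := by
  set d := (z i.succ - z i.castSucc) / 2 with hd
  have hdre : 0 < d.re := by
    rw [hd, Complex.div_ofNat_re, Complex.sub_re]
    linarith
  have h1 := Complex.abs_arg_lt_pi_div_two_iff.2 (Or.inl hdre)
  rw [abs_lt] at h1
  have hπ := Real.pi_pos
  have ht : (1 / 2 - d.arg / Real.pi) ∈ unitInterval := by
    have e : d.arg / Real.pi * Real.pi = d.arg := by field_simp
    constructor
    · rw [sub_nonneg, div_le_iff₀ hπ]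
      linarith
    · rw [sub_le_iff_le_add', ← sub_le_iff_le_add, le_div_iff₀ hπ]
      linarith
  have h := hR ⟨_, ht⟩ i.succ
  rw [exchangePath_succ, ← hd] at h
  have h2 : d * Complex.exp (Real.pi * Complex.I * ((1 / 2 - d.arg / Real.pi : ℝ) : ℂ)) =
      turnRadius i z * Complex.I := by
    conv_lhs => rw [← Complex.norm_mul_exp_arg_mul_I d]
    rw [mul_assoc, ← Complex.exp_add]
    have e1 : (d.arg : ℂ) * Complex.I +
        Real.pi * Complex.I * ((1 / 2 - d.arg / Real.pi : ℝ) : ℂ) = Real.pi / 2 * Complex.I := by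
      have : (Real.pi : ℂ) ≠ 0 := by exact_mod_cast hπ.ne'
      push_cast
      field_simp
      ring
    have e2 : ‖d‖ = turnRadius i z := by
      rw [hd, norm_div, norm_sub_rev, turnRadius]
      simp
    rw [Complex.norm_mul_exp_arg_mul_I, e1, e2, Complex.exp_pi_div_two_mul_I]
  simp only [h2] at h
  simpa using h

/-- Finitely many strict inequalities survive a small increase of the radius. -/
theorem exists_collar {R : ℝ} (hre : (z i.castSucc).re < (z i.succ).re)
    (hdisc : ∀ p, p ≠ i.castSucc → p ≠ i.succ → turnRadius i z < ‖z p - turnCentre i z‖)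
    (hR : ∀ t p, (exchangePath i z t p).im < R) :
    ∃ r, turnRadius i z < r ∧ (turnCentre i z).im + r ≤ R ∧
      ∀ p, p ≠ i.castSucc → p ≠ i.succ → r ≤ ‖z p - turnCentre i z‖ := by
  have h0 := turnCentre_im_add_turnRadius_lt hre hR
  have h1 : ∀ᶠ r in nhdsWithin (turnRadius i z) (Set.Ioi (turnRadius i z)),
      r < R - (turnCentre i z).im :=
    nhdsWithin_le_nhds (eventually_lt_nhds (by linarith))
  have h2 : ∀ᶠ r in nhdsWithin (turnRadius i z) (Set.Ioi (turnRadius i z)),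
      ∀ p, p ≠ i.castSucc → p ≠ i.succ → r < ‖z p - turnCentre i z‖ := by
    refine Filter.eventually_all.2 fun p => ?_
    by_cases hp : p ≠ i.castSucc ∧ p ≠ i.succ
    · filter_upwards [nhdsWithin_le_nhds (eventually_lt_nhds (hdisc p hp.1 hp.2))] with r h _ _
      exact h
    · exact Filter.Eventually.of_forall fun _ h1 h2 => absurd ⟨h1, h2⟩ hp
  obtain ⟨r, ⟨h3, h4⟩, h5⟩ := ((h1.and h2).and self_mem_nhdsWithin).exists
  exact ⟨r, h5, by linarith, fun p hp hp' => (h4 p hp hp').le⟩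

/-- The angle of the rotation that completes the half-turn from time `t` on; it decreases to zero
across the collar between the radii `r` and `r'`. -/
def twistAngle (r r' : ℝ) (t : unitInterval) (ρ : ℝ) : ℝ :=
  Real.pi * (1 - t) * max 0 (min 1 ((r' - ρ) / (r' - r)))

theorem twistAngle_of_le {r r' : ℝ} (h : r < r') (t : unitInterval) {ρ : ℝ} (hρ : ρ ≤ r) :
    twistAngle r r' t ρ = Real.pi * (1 - t) := by
  have : 1 ≤ (r' - ρ) / (r' - r) := by
    rw [le_div_iff₀ (by linarith)]
    linarith
  rw [twistAngle, min_eq_left this, max_eq_right zero_le_one, mul_one]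

theorem twistAngle_of_ge {r r' : ℝ} (h : r < r') (t : unitInterval) {ρ : ℝ} (hρ : r' ≤ ρ) :
    twistAngle r r' t ρ = 0 := by
  have : (r' - ρ) / (r' - r) ≤ 0 := div_nonpos_of_nonpos_of_nonneg (by linarith) (by linarith)
  rw [twistAngle, max_eq_left ((min_le_right _ _).trans this), mul_zero]

theorem twistAngle_one (r r' ρ : ℝ) : twistAngle r r' 1 ρ = 0 := by simp [twistAngle]

theorem continuous_twistAngle (r r' : ℝ) {α : Type*} [TopologicalSpace α] {t : α → unitInterval}
    {ρ : α → ℝ} (ht : Continuous t) (hρ : Continuous ρ) :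
    Continuous fun a => twistAngle r r' (t a) (ρ a) := by
  unfold twistAngle
  fun_prop

/-- The retraction of the family over the half-turn to the fibre at the end. -/
def turnRetraction {R r : ℝ} (h : turnRadius i z < r) (hr : (turnCentre i z).im + r ≤ R)
    (hp : ∀ p, p ≠ i.castSucc → p ≠ i.succ → r ≤ ‖z p - turnCentre i z‖) :
    PlaneMap (exchangePath i z) (fun _ : Unit => z ∘ swapAt i) R where
  base := ContinuousMap.const _ ()
  map t x := turnCentre i z + (x - turnCentre i z) *
    Complex.exp (twistAngle (turnRadius i z) r t ‖x - turnCentre i z‖ * Complex.I)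
  log t x y := twistLog (twistAngle (turnRadius i z) r t ‖x - turnCentre i z‖)
    (twistAngle (turnRadius i z) r t ‖y - turnCentre i z‖) (x - turnCentre i z)
    (y - turnCentre i z)
  continuous_points := continuous_exchangePath i z
  continuous_map := by
    have := continuous_twistAngle (turnRadius i z) r (α := unitInterval × ℂ) (t := fun q => q.1)
      (ρ := fun q => ‖q.2 - turnCentre i z‖) (by fun_prop) (by fun_prop)
    fun_prop
  continuousOn_log := by
    rw [continuousOn_iff_continuous_domRestrict]
    refine continuous_twistLog (continuous_twistAngle _ _ (by fun_prop) (by fun_prop))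
      (continuous_twistAngle _ _ (by fun_prop) (by fun_prop)) (by fun_prop) (by fun_prop)
      (fun q e => q.2 (sub_left_injective e)) fun q e => by rw [e]
  exp_log t x y hxy := by
    have := exp_twistLog (a := twistAngle (turnRadius i z) r t ‖x - turnCentre i z‖)
      (b := twistAngle (turnRadius i z) r t ‖y - turnCentre i z‖) (x := x - turnCentre i z)
      (y := y - turnCentre i z) (fun e => hxy (sub_left_injective e)) fun e => by rw [e]
    linear_combination this
  map_points t p := by
    by_cases h1 : p = i.castSucc ∨ p = i.succ
    -- The angle `π t` already turned and the remaining angle `π (1 - t)` add up to `π`.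
    · have e1 : Complex.exp (Real.pi * Complex.I * (t : ℝ)) *
          Complex.exp ((Real.pi * (1 - (t : ℝ)) : ℝ) * Complex.I) = -1 := by
        rw [← Complex.exp_add, ← Complex.exp_pi_mul_I]
        push_cast
        ring_nf
      rw [twistAngle_of_le h t (norm_exchangePath_sub i z h1).le]
      rw [Function.comp_apply, ← exchangePath_one i z p]
      rcases h1 with rfl | rfl
      · rw [exchangePath_castSucc, exchangePath_castSucc]
        simp only [Set.Icc.coe_one, Complex.ofReal_one, mul_one, Complex.exp_pi_mul_I]
        linear_combination (z i.succ - z i.castSucc) / 2 * e1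
      · rw [exchangePath_succ, exchangePath_succ]
        simp only [Set.Icc.coe_one, Complex.ofReal_one, mul_one, Complex.exp_pi_mul_I]
        linear_combination -(z i.succ - z i.castSucc) / 2 * e1
    · obtain ⟨h2, h3⟩ := not_or.1 h1
      rw [exchangePath_of_ne i z t h2 h3, twistAngle_of_ge h t (hp p h2 h3), Function.comp_apply,
        swapAt, Equiv.swap_apply_of_ne_of_ne h2 h3]
      simp
  le_im_map t x hx := by
    -- The collar ends below height `R`, so points at infinity are fixed.
    have h1 : r ≤ ‖x - turnCentre i z‖ := by
      have := Complex.im_le_norm (x - turnCentre i z)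
      rw [Complex.sub_im] at this
      linarith
    rw [twistAngle_of_ge h t h1]
    simpa using hx

/-- The inclusion of the fibre at the end of the half-turn. -/
theorem isTwistedMap_end (κ : ℝ) (lam z : Fin (n + 1) → ℂ) (R : ℝ) (ℓ : ℕ) (i : Fin n) :
    IsTwistedMap κ (lam ∘ swapAt i) lam (fun _ : Unit => z) (exchangePath i z) ℓ R
      (configMap (ContinuousMap.const Unit (1 : unitInterval)) 1 (swapAt i)
        fun _ p => exchangePath_one i z p) :=
  isTwistedMap_configMap _ _ _ _ fun p => by simp [swapAt]

/-- The inclusion of the fibre at the start of the half-turn. -/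
theorem isTwistedMap_start (κ : ℝ) (lam z : Fin (n + 1) → ℂ) (R : ℝ) (ℓ : ℕ) (i : Fin n) :
    IsTwistedMap κ lam lam (fun _ : Unit => z) (exchangePath i z) ℓ R
      (configMap (ContinuousMap.const Unit (0 : unitInterval)) 1 1
        fun _ p => exchangePath_zero i z p) :=
  isTwistedMap_configMap _ _ _ _ fun _ => rfl

/-- A left inverse is the retraction followed by the relabelling of the points. At `t = 1` the twist
angle and its logarithm vanish, so the retraction is the identity there and the factor is `1`. -/
theorem pushClass_end_injective (κ : ℝ) (lam : Fin (n + 1) → ℂ) {R : ℝ} (ℓ k : ℕ)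
    (hre : (z i.castSucc).re < (z i.succ).re)
    (hdisc : ∀ p, p ≠ i.castSucc → p ≠ i.succ → turnRadius i z < ‖z p - turnCentre i z‖)
    (hR : ∀ t p, (exchangePath i z t p).im < R) :
    Function.Injective (pushClass (isTwistedMap_end κ lam z R ℓ i) k) := by
  obtain ⟨r, h, hr, hp⟩ := exists_collar hre hdisc hR
  let G := turnRetraction h hr hp
  have hτ : IsTwistedMap κ lam (lam ∘ swapAt i) (fun _ : Unit => z ∘ swapAt i)
      (fun _ : Unit => z) ℓ R
      (configMap (Z := fun _ : Unit => z ∘ swapAt i) (Z' := fun _ : Unit => z)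
        (ContinuousMap.id Unit) 1 (swapAt i) fun _ p => by simp [swapAt]) :=
    isTwistedMap_configMap _ _ _ _ fun _ => rfl
  have key : pushClass hτ k ∘ₗ G.pushClass κ lam ℓ k ∘ₗ
      pushClass (isTwistedMap_end κ lam z R ℓ i) k = LinearMap.id := by
    refine chainClass_ext fun y s => ?_
    rw [LinearMap.comp_apply, LinearMap.comp_apply, pushClass_cubeClass, G.pushClass_cubeClass,
      pushClass_cubeClass]
    have h1 : (s * fun u => G.factor κ lam ((configMap (ContinuousMap.const Unit (1 : unitInterval))
        1 (swapAt i) fun _ p => exchangePath_one i z p).comp y u)) = s := by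
      funext u
      rw [Pi.mul_apply, G.factor_eq_one, mul_one]
      intro x x'
      simp only [G, turnRetraction, configMap, ContinuousMap.comp_apply, ContinuousMap.coe_mk,
        ContinuousMap.const_apply, twistAngle_one, twistLog_zero]
    rw [h1, LinearMap.id_apply]
    congr 1
    ext u : 1
    refine Subtype.ext (Prod.ext rfl (funext fun j => ?_))
    simp [G, turnRetraction, configMap, PlaneMap.configMap, twistAngle_one]
  exact Function.LeftInverse.injective
    (g := fun c => pushClass hτ k (G.pushClass κ lam ℓ k c)) fun c => LinearMap.congr_fun key c

end Retraction

/-! ### Closing a gap around a disc -/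

section Closing

/-- A ramp of slope `a / (δ + a)` from `0` to `a`. -/
def ramp (δ a v : ℝ) : ℝ := max 0 (min a (a / (δ + a) * v))

variable {δ a : ℝ} (hδ : 0 < δ) (ha : 0 ≤ a)
include hδ ha

theorem ramp_of_nonpos {v : ℝ} (hv : v ≤ 0) : ramp δ a v = 0 := by
  have : a / (δ + a) * v ≤ 0 := mul_nonpos_of_nonneg_of_nonpos (by positivity) hv
  exact max_eq_left ((min_le_right _ _).trans this)

theorem ramp_of_le {v : ℝ} (hv : δ + a ≤ v) : ramp δ a v = a := by
  have h : a ≤ a / (δ + a) * v := by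
    rw [div_mul_eq_mul_div, le_div_iff₀ (by positivity)]
    exact mul_le_mul_of_nonneg_left hv ha
  rw [ramp, min_eq_left h, max_eq_right ha]

/-- The slope `a / (δ + a)` is less than `1`, so subtracting the ramp preserves the order of the
line. -/
theorem ramp_sub_lt {v v' : ℝ} (h : v' < v) : ramp δ a v - ramp δ a v' < v - v' := by
  have hμ : a / (δ + a) < 1 := by
    rw [div_lt_one (by positivity)]
    linarith
  have hμ0 : 0 ≤ a / (δ + a) := by positivity
  have h1 : a / (δ + a) * v - a / (δ + a) * v' < v - v' := by nlinarith
  have h2 : 0 ≤ a / (δ + a) * v - a / (δ + a) * v' := by nlinarith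
  suffices h3 : ramp δ a v ≤ ramp δ a v' + (a / (δ + a) * v - a / (δ + a) * v') by linarith
  have h4 : min a (a / (δ + a) * v') ≤ ramp δ a v' := le_max_right _ _
  refine max_le (add_nonneg (le_max_left _ _) h2) ?_
  rcases min_choice a (a / (δ + a) * v') with h5 | h5
  · have := min_le_left a (a / (δ + a) * v)
    linarith
  · have := min_le_right a (a / (δ + a) * v)
    linarith

/-- The map of the line that moves the points at distance at least `d + δ + a` from `0` by `a`
towards `0` and fixes the points at distance at most `d` is strictly monotone. -/
theorem close_strictMono {d : ℝ} (hd : 0 ≤ d) {v v' : ℝ} (h : v' < v) :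
    v' - ramp δ a (v' - d) + ramp δ a (-v' - d) < v - ramp δ a (v - d) + ramp δ a (-v - d) := by
  rcases le_or_gt (-d) v' with h1 | h1
  · rw [ramp_of_nonpos hδ ha (by linarith : -v' - d ≤ 0),
      ramp_of_nonpos hδ ha (by linarith : -v - d ≤ 0)]
    have := ramp_sub_lt hδ ha (by linarith : v' - d < v - d)
    linarith
  rcases le_or_gt v d with h2 | h2
  · rw [ramp_of_nonpos hδ ha (by linarith : v' - d ≤ 0),
      ramp_of_nonpos hδ ha (by linarith : v - d ≤ 0)]
    have := ramp_sub_lt hδ ha (by linarith : -v - d < -v' - d)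
    linarith
  · rw [ramp_of_nonpos hδ ha (by linarith : v' - d ≤ 0),
      ramp_of_nonpos hδ ha (by linarith : -v - d ≤ 0)]
    have e0 := ramp_of_nonpos hδ ha (le_refl 0)
    have h3 := ramp_sub_lt hδ ha (by linarith : 0 < -v' - d)
    have h4 := ramp_sub_lt hδ ha (by linarith : 0 < v - d)
    linarith

end Closing

/-- Two vectors with the same nonzero imaginary part lie in one open half-plane, so their directions
differ by less than `π`; if they are real, their signs agree by hypothesis. -/
theorem div_mem_slitPlane {w w' : ℂ} (him : w'.im = w.im) (h : w.im = 0 → 0 < w'.re * w.re)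
    (hw : w ≠ 0) : w' / w ∈ Complex.slitPlane := by
  have hn : 0 < Complex.normSq w := Complex.normSq_pos.2 hw
  rw [Complex.mem_slitPlane_iff, Complex.div_re, Complex.div_im, ← add_div, ← sub_div, him]
  by_cases h0 : w.im = 0
  · left
    have := h h0
    rw [h0]
    rw [mul_zero, add_zero]
    positivity
  · by_cases h1 : w'.re = w.re
    · left
      rw [h1, ← Complex.normSq_apply]
      exact div_pos hn hn
    · right
      refine div_ne_zero ?_ hn.ne'
      rw [mul_comm, ← sub_mul]
      exact mul_ne_zero (sub_ne_zero.2 fun e => h1 e.symm) h0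

/-- The horizontal map that moves the points outside of the disc with centre `c` and radius `r`
towards the disc, by at most `a`. -/
def closeMap (c : ℂ) (r δ a : ℝ) (x : ℂ) : ℂ :=
  ⟨x.re - ramp δ a (x.re - c.re - √(r ^ 2 - (x.im - c.im) ^ 2)) +
    ramp δ a (-(x.re - c.re) - √(r ^ 2 - (x.im - c.im) ^ 2)), x.im⟩

/-- The map preserves every horizontal line and is strictly increasing on it. Hence the principal
logarithm of the difference quotient is continuous and serves as the logarithm of a `PlaneMap`. -/
theorem closeMap_div_mem {c : ℂ} {r δ a : ℝ} (hδ : 0 < δ) (ha : 0 ≤ a) {x y : ℂ} (h : x ≠ y) :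
    (closeMap c r δ a x - closeMap c r δ a y) / (x - y) ∈ Complex.slitPlane := by
  refine div_mem_slitPlane rfl (fun him => ?_) (sub_ne_zero.2 h)
  have him' : x.im = y.im := sub_eq_zero.1 him
  have key : ∀ x y : ℂ, x.im = y.im → y.re < x.re →
      (closeMap c r δ a y).re < (closeMap c r δ a x).re := by
    intro x y him h
    have := close_strictMono hδ ha (Real.sqrt_nonneg (r ^ 2 - (x.im - c.im) ^ 2))
      (by linarith : y.re - c.re < x.re - c.re)
    simp only [closeMap, ← him]
    linarith
  have hre : x.re ≠ y.re := fun e => h (Complex.ext e him')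
  rw [Complex.sub_re, Complex.sub_re]
  rcases hre.lt_or_gt with h1 | h1
  · exact mul_pos_of_neg_of_neg (sub_neg.2 (key y x him'.symm h1)) (sub_neg.2 h1)
  · exact mul_pos (sub_pos.2 (key x y him' h1)) (sub_pos.2 h1)

theorem closeMap_zero (c : ℂ) (r δ : ℝ) (x : ℂ) : closeMap c r δ 0 x = x := by
  apply Complex.ext <;> simp [closeMap, ramp]

theorem closeMap_of_mem {c : ℂ} {r δ a : ℝ} (hδ : 0 < δ) (ha : 0 ≤ a) {x : ℂ}
    (hx : ‖x - c‖ ≤ r) : closeMap c r δ a x = x := by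
  have h : |x.re - c.re| ≤ √(r ^ 2 - (x.im - c.im) ^ 2) := by
    refine Real.abs_le_sqrt ?_
    have h1 : ‖x - c‖ ^ 2 ≤ r ^ 2 := pow_le_pow_left₀ (norm_nonneg _) hx 2
    rw [Complex.sq_norm, Complex.normSq_apply, Complex.sub_re, Complex.sub_im] at h1
    linarith
  rw [abs_le] at h
  rw [closeMap, ramp_of_nonpos hδ ha (by linarith), ramp_of_nonpos hδ ha (by linarith)]
  simp

/-- Beyond distance `δ + a` from the disc the ramp has its full value `a`. On horizontal lines that
miss the disc the root of a negative number is `0`, and distances are measured from the vertical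
line through the centre. -/
theorem closeMap_of_right {c : ℂ} {r δ a : ℝ} (hδ : 0 < δ) (ha : 0 ≤ a) {x : ℂ}
    (hx : √(r ^ 2 - (x.im - c.im) ^ 2) + δ ≤ x.re - c.re) : closeMap c r δ a (x + a) = x := by
  have := Real.sqrt_nonneg (r ^ 2 - (x.im - c.im) ^ 2)
  rw [closeMap]
  simp only [Complex.add_re, Complex.ofReal_re, Complex.add_im, Complex.ofReal_im, add_zero]
  rw [ramp_of_le hδ ha (by linarith), ramp_of_nonpos hδ ha (by linarith)]
  simp

theorem closeMap_of_left {c : ℂ} {r δ a : ℝ} (hδ : 0 < δ) (ha : 0 ≤ a) {x : ℂ}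
    (hx : √(r ^ 2 - (x.im - c.im) ^ 2) + δ ≤ -(x.re - c.re)) :
    closeMap c r δ a (x - a) = x := by
  have := Real.sqrt_nonneg (r ^ 2 - (x.im - c.im) ^ 2)
  rw [closeMap]
  simp only [Complex.sub_re, Complex.ofReal_re, Complex.sub_im, Complex.ofReal_im, sub_zero]
  rw [ramp_of_nonpos hδ ha (by linarith), ramp_of_le hδ ha (by linarith)]
  simp

/-! ### The motion of the points -/

/-- The time of the half-turn while the other points are first moved away, then kept in place, then
moved back. -/
def turnTime (τ : unitInterval) : unitInterval := Set.projIcc 0 1 zero_le_one (3 * (τ : ℝ) - 1)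

/-- The distance to which the other points are moved away, relative to the maximal one. -/
def awayTime (τ : unitInterval) : ℝ := min 1 (min (3 * (τ : ℝ)) (3 - 3 * τ))

theorem continuous_turnTime : Continuous turnTime := by
  unfold turnTime
  fun_prop

theorem awayTime_nonneg (τ : unitInterval) : 0 ≤ awayTime τ :=
  le_min zero_le_one (le_min (by linarith [τ.2.1]) (by linarith [τ.2.2]))

/-- The turn takes place only in the middle third of the time, when the other points are fully away.
-/
theorem awayTime_or (τ : unitInterval) :
    awayTime τ = 1 ∨ turnTime τ = 0 ∨ turnTime τ = 1 := by
  rcases le_or_gt (3 * (τ : ℝ)) 1 with h | h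
  · exact Or.inr (Or.inl (Set.projIcc_of_le_left _ (by linarith)))
  rcases le_or_gt (3 - 3 * (τ : ℝ)) 1 with h' | h'
  · exact Or.inr (Or.inr (Set.projIcc_of_right_le _ (by linarith)))
  · exact Or.inl (min_eq_left (le_min h.le h'.le))

theorem turnTime_zero : turnTime 0 = 0 := Set.projIcc_of_le_left _ (by norm_num)

theorem turnTime_one : turnTime 1 = 1 := Set.projIcc_of_right_le _ (by norm_num)

theorem awayTime_zero : awayTime 0 = 0 := by norm_num [awayTime]

theorem awayTime_one : awayTime 1 = 0 := by norm_num [awayTime]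

section Motion

variable {n : ℕ} (i : Fin n) (z : Fin (n + 1) → ℂ)

/-- The direction in which a point is moved away. -/
def awayDir (p : Fin (n + 1)) : ℝ := if p < i.castSucc then -1 else if i.succ < p then 1 else 0

/-- The points during the motion. -/
def movedPoints (τ : unitInterval) (p : Fin (n + 1)) : ℂ :=
  exchangePath i z (turnTime τ) p + ((awayDir i p * (awayTime τ * turnRadius i z) : ℝ) : ℂ)

theorem continuous_movedPoints (p : Fin (n + 1)) : Continuous fun τ => movedPoints i z τ p := by
  have := (continuous_exchangePath i z p).comp continuous_turnTime
  simp only [Function.comp_def] at this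
  unfold movedPoints awayTime
  fun_prop

theorem movedPoints_zero (p : Fin (n + 1)) : movedPoints i z 0 p = z p := by
  simp [movedPoints, turnTime_zero, awayTime_zero, exchangePath_zero]

theorem movedPoints_one (p : Fin (n + 1)) : movedPoints i z 1 p = z (swapAt i p) := by
  simp [movedPoints, turnTime_one, awayTime_one, exchangePath_one]

theorem turnRadius_nonneg : 0 ≤ turnRadius i z := by
  unfold turnRadius
  positivity

variable {i z}

theorem eq_or_lt_or_gt (p : Fin (n + 1)) :
    p = i.castSucc ∨ p = i.succ ∨ p < i.castSucc ∨ i.succ < p := by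
  simp only [Fin.ext_iff, Fin.lt_def, Fin.val_castSucc, Fin.val_succ]
  omega

/-- The maps `closeMap` bring the points that are moved away back to their places. -/
def closing {R δ : ℝ} (hδ : 0 < δ)
    (hl : ∀ p, p < i.castSucc → √(turnRadius i z ^ 2 - ((z p).im - (turnCentre i z).im) ^ 2) + δ ≤
      -((z p).re - (turnCentre i z).re))
    (hg : ∀ p, i.succ < p → √(turnRadius i z ^ 2 - ((z p).im - (turnCentre i z).im) ^ 2) + δ ≤
      (z p).re - (turnCentre i z).re) :
    PlaneMap (movedPoints i z) (exchangePath i z) R where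
  base := ⟨turnTime, continuous_turnTime⟩
  map τ := closeMap (turnCentre i z) (turnRadius i z) δ (awayTime τ * turnRadius i z)
  log τ x y := Complex.log
    ((closeMap (turnCentre i z) (turnRadius i z) δ (awayTime τ * turnRadius i z) x -
      closeMap (turnCentre i z) (turnRadius i z) δ (awayTime τ * turnRadius i z) y) / (x - y))
  continuous_points := continuous_movedPoints i z
  continuous_map := by
    have h : ∀ τ, δ + awayTime τ * turnRadius i z ≠ 0 := fun τ =>
      (add_pos_of_pos_of_nonneg hδ (mul_nonneg (awayTime_nonneg τ) (turnRadius_nonneg i z))).ne'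
    have h' : Continuous awayTime := by
      unfold awayTime
      fun_prop
    unfold closeMap ramp
    refine continuous_complex_mk ?_ ?_ <;> fun_prop (disch := exact fun q => h q.1)
  continuousOn_log := by
    have h : ∀ τ, δ + awayTime τ * turnRadius i z ≠ 0 := fun τ =>
      (add_pos_of_pos_of_nonneg hδ (mul_nonneg (awayTime_nonneg τ) (turnRadius_nonneg i z))).ne'
    have h' : Continuous awayTime := by
      unfold awayTime
      fun_prop
    have hc : Continuous fun q : unitInterval × ℂ => closeMap (turnCentre i z) (turnRadius i z) δ
        (awayTime q.1 * turnRadius i z) q.2 := by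
      unfold closeMap ramp
      refine continuous_complex_mk ?_ ?_ <;> fun_prop (disch := exact fun q => h q.1)
    have h1 : Continuous fun q : unitInterval × ℂ × ℂ => closeMap (turnCentre i z)
        (turnRadius i z) δ (awayTime q.1 * turnRadius i z) q.2.1 :=
      hc.comp (f := fun q : unitInterval × ℂ × ℂ => (q.1, q.2.1)) (by fun_prop)
    have h2 : Continuous fun q : unitInterval × ℂ × ℂ => closeMap (turnCentre i z)
        (turnRadius i z) δ (awayTime q.1 * turnRadius i z) q.2.2 :=
      hc.comp (f := fun q : unitInterval × ℂ × ℂ => (q.1, q.2.2)) (by fun_prop)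
    refine ContinuousOn.clog (ContinuousOn.div (h1.sub h2).continuousOn (by fun_prop)
      fun q hq => sub_ne_zero.2 hq) fun q hq => ?_
    exact closeMap_div_mem hδ (mul_nonneg (awayTime_nonneg _) (turnRadius_nonneg i z)) hq
  exp_log τ x y hxy := by
    have h := closeMap_div_mem (c := turnCentre i z) (r := turnRadius i z) hδ
      (mul_nonneg (awayTime_nonneg τ) (turnRadius_nonneg i z)) hxy
    rw [Complex.exp_log (Complex.slitPlane_ne_zero h), div_mul_cancel₀ _ (sub_ne_zero.2 hxy)]
  map_points τ p := by
    have ha := mul_nonneg (awayTime_nonneg τ) (turnRadius_nonneg i z)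
    have h3 := i.castSucc_lt_succ
    have hs : ∀ p, p = i.castSucc ∨ p = i.succ → awayDir i p = 0 := by
      rintro p (rfl | rfl)
      · simp [awayDir, h3.not_gt]
      · simp [awayDir, h3.not_gt]
    rcases or_assoc.2 (eq_or_lt_or_gt (i := i) p) with h | h | h
    · rw [movedPoints, hs p h, closeMap_of_mem hδ ha]
      · simp
      · simpa using (norm_exchangePath_sub i z h).le
    · have e := exchangePath_of_ne i z (turnTime τ) h.ne (h.trans h3).ne
      have e' : movedPoints i z τ p = z p - ((awayTime τ * turnRadius i z : ℝ) : ℂ) := by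
        rw [movedPoints, e, awayDir, if_pos h]
        push_cast
        ring
      rw [e', closeMap_of_left hδ ha (hl p h)]
      exact e
    · have e := exchangePath_of_ne i z (turnTime τ) (h3.trans h).ne' h.ne'
      have e' : movedPoints i z τ p = z p + ((awayTime τ * turnRadius i z : ℝ) : ℂ) := by
        rw [movedPoints, e, awayDir, if_neg (h3.trans h).not_gt, if_pos h, one_mul]
      rw [e', closeMap_of_right hδ ha (hg p h)]
      exact e
  le_im_map _ _ h := h

/-- The root is half the length of the chord of the disc at the height of `z p`. A point outside the
closed disc lies strictly beyond the end of this chord, on the side given by the order of the real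
parts, and finitely many strict inequalities leave a common margin. -/
theorem exists_margin
    (hre : ∀ p r, p < r → (z p).re < (z r).re)
    (hdisc : ∀ p, p ≠ i.castSucc → p ≠ i.succ → turnRadius i z < ‖z p - turnCentre i z‖) :
    ∃ δ : ℝ, 0 < δ ∧
    (∀ p, p < i.castSucc → √(turnRadius i z ^ 2 - ((z p).im - (turnCentre i z).im) ^ 2) + δ ≤
      -((z p).re - (turnCentre i z).re)) ∧
    ∀ p, i.succ < p → √(turnRadius i z ^ 2 - ((z p).im - (turnCentre i z).im) ^ 2) + δ ≤
      (z p).re - (turnCentre i z).re := by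
  have h3 := i.castSucc_lt_succ
  have hc : (turnCentre i z).re = ((z i.castSucc).re + (z i.succ).re) / 2 := by
    rw [turnCentre, Complex.div_ofNat_re, Complex.add_re]
  have h0 := hre _ _ h3
  have key : ∀ p, p ≠ i.castSucc → p ≠ i.succ → (z p).re - (turnCentre i z).re ≠ 0 →
      √(turnRadius i z ^ 2 - ((z p).im - (turnCentre i z).im) ^ 2) <
        |(z p).re - (turnCentre i z).re| := by
    intro p hp hp' hne
    rw [Real.sqrt_lt' (abs_pos.2 hne), sq_abs]
    have h1 : turnRadius i z ^ 2 < ‖z p - turnCentre i z‖ ^ 2 :=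
      pow_lt_pow_left₀ (hdisc p hp hp') (turnRadius_nonneg i z) two_ne_zero
    rw [Complex.sq_norm, Complex.normSq_apply, Complex.sub_re, Complex.sub_im] at h1
    linarith
  have h1 : ∀ᶠ δ in nhdsWithin (0 : ℝ) (Set.Ioi 0), ∀ p, p ≠ i.castSucc → p ≠ i.succ →
      (z p).re - (turnCentre i z).re ≠ 0 →
      δ < |(z p).re - (turnCentre i z).re| -
        √(turnRadius i z ^ 2 - ((z p).im - (turnCentre i z).im) ^ 2) := by
    refine Filter.eventually_all.2 fun p => ?_
    by_cases hp : p ≠ i.castSucc ∧ p ≠ i.succ ∧ (z p).re - (turnCentre i z).re ≠ 0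
    · filter_upwards [nhdsWithin_le_nhds (eventually_lt_nhds
        (sub_pos.2 (key p hp.1 hp.2.1 hp.2.2)))] with δ h _ _ _
      exact h
    · exact Filter.Eventually.of_forall fun _ h1 h2 h3 => absurd ⟨h1, h2, h3⟩ hp
  obtain ⟨δ, h2, hδ⟩ := (h1.and self_mem_nhdsWithin).exists
  refine ⟨δ, hδ, fun p hp => ?_, fun p hp => ?_⟩
  · have h4 : (z p).re - (turnCentre i z).re < 0 := by
      rw [hc]
      linarith [hre _ _ hp]
    have := h2 p hp.ne (hp.trans h3).ne h4.ne
    rw [abs_of_neg h4] at this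
    linarith
  · have h4 : 0 < (z p).re - (turnCentre i z).re := by
      rw [hc]
      linarith [hre _ _ hp]
    have := h2 p (h3.trans hp).ne' hp.ne' h4.ne'
    rw [abs_of_pos h4] at this
    linarith

end Motion

/-! ### Contours during the motion -/

section Moving

variable {n : ℕ} {i : Fin n} {z : Fin (n + 1) → ℂ} {R ε : ℝ} {ℓ : ℕ}

theorem movedPoints_of_mem (τ : unitInterval) {q : Fin (n + 1)}
    (hq : q = i.castSucc ∨ q = i.succ) :
    movedPoints i z τ q = exchangePath i z (turnTime τ) q := by
  have h3 := i.castSucc_lt_succ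
  rcases hq with rfl | rfl <;> simp [movedPoints, awayDir, h3.not_gt]

theorem movedPoints_of_lt (τ : unitInterval) {p : Fin (n + 1)} (h : p < i.castSucc) :
    movedPoints i z τ p = z p - ((awayTime τ * turnRadius i z : ℝ) : ℂ) := by
  rw [movedPoints, exchangePath_of_ne i z _ h.ne (h.trans i.castSucc_lt_succ).ne, awayDir,
    if_pos h]
  push_cast
  ring

theorem movedPoints_of_gt (τ : unitInterval) {p : Fin (n + 1)} (h : i.succ < p) :
    movedPoints i z τ p = z p + ((awayTime τ * turnRadius i z : ℝ) : ℂ) := by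
  have h3 := i.castSucc_lt_succ.trans h
  rw [movedPoints, exchangePath_of_ne i z _ h3.ne' h.ne', awayDir, if_neg h3.not_gt, if_pos h,
    one_mul]

theorem swapAt_mem {q : Fin (n + 1)} (hq : q = i.castSucc ∨ q = i.succ) :
    swapAt i q = i.castSucc ∨ swapAt i q = i.succ := by
  rcases hq with rfl | rfl <;> simp [swapAt]

theorem abs_exchangePath_re_sub (t : unitInterval) {q : Fin (n + 1)}
    (hq : q = i.castSucc ∨ q = i.succ) :
    |(exchangePath i z t q).re - (turnCentre i z).re| ≤ turnRadius i z := by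
  rw [← norm_exchangePath_sub i z hq, ← Complex.sub_re]
  exact Complex.abs_re_le_norm _

theorem turnCentre_re (i : Fin n) (z : Fin (n + 1) → ℂ) :
    (turnCentre i z).re = ((z i.castSucc).re + (z i.succ).re) / 2 := by
  rw [turnCentre, Complex.div_ofNat_re, Complex.add_re]

/-- When the other points are fully away, their shift by the radius makes up for the horizontal
deviation of the turning points from the centre. At all other times the turning points occupy the
places `z i`, `z (i + 1)` in some order. Only the turning pair itself can violate the gap. -/
theorem Admissible.gap_movedPoints (hz : Admissible z R ε) (τ : unitInterval) {p q : Fin (n + 1)}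
    (hpq : p < q) (hne : ¬(p = i.castSucc ∧ q = i.succ)) :
    (movedPoints i z τ p).re + 2 * ε ≤ (movedPoints i z τ q).re := by
  have h3 := i.castSucc_lt_succ
  have hc := turnCentre_re i z
  have hg := hz.gap _ _ h3
  have h0 := hz.pos
  have ha := mul_nonneg (awayTime_nonneg τ) (turnRadius_nonneg i z)
  have hor : ∀ {x : Fin (n + 1)}, x = i.castSucc ∨ x = i.succ →
      x ≤ i.succ ∧ i.castSucc ≤ x := by
    rintro x (rfl | rfl)
    exacts [⟨h3.le, le_rfl⟩, ⟨le_rfl, h3.le⟩]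
  have hleft : p < i.castSucc → (q = i.castSucc ∨ q = i.succ) →
      (movedPoints i z τ p).re + 2 * ε ≤ (movedPoints i z τ q).re := by
    intro hp hq
    have h1 := (abs_le.1 (abs_exchangePath_re_sub (z := z) (turnTime τ) hq)).1
    have h2 := hz.gap _ _ hp
    rw [movedPoints_of_lt τ hp, movedPoints_of_mem τ hq, Complex.sub_re, Complex.ofReal_re]
    rcases awayTime_or τ with h | h | h
    · rw [h]
      linarith
    · rw [h, exchangePath_zero]
      linarith [hz.gap _ _ hpq]
    · rw [h, exchangePath_one]
      linarith [hz.gap _ _ (hp.trans_le (hor (swapAt_mem hq)).2)]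
  have hright : (p = i.castSucc ∨ p = i.succ) → i.succ < q →
      (movedPoints i z τ p).re + 2 * ε ≤ (movedPoints i z τ q).re := by
    intro hp hq
    have h1 := (abs_le.1 (abs_exchangePath_re_sub (z := z) (turnTime τ) hp)).2
    have h2 := hz.gap _ _ hq
    rw [movedPoints_of_gt τ hq, movedPoints_of_mem τ hp, Complex.add_re, Complex.ofReal_re]
    rcases awayTime_or τ with h | h | h
    · rw [h]
      linarith
    · rw [h, exchangePath_zero]
      linarith [hz.gap _ _ hpq]
    · rw [h, exchangePath_one]
      linarith [hz.gap _ _ ((hor (swapAt_mem hp)).1.trans_lt hq)]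
  have hg' := hz.gap _ _ hpq
  rcases or_assoc.2 (eq_or_lt_or_gt (i := i) p) with hp | hp | hp <;>
  rcases or_assoc.2 (eq_or_lt_or_gt (i := i) q) with hq | hq | hq
  · exfalso
    rcases hp with rfl | rfl <;> rcases hq with rfl | rfl
    · exact lt_irrefl _ hpq
    · exact hne ⟨rfl, rfl⟩
    · exact hpq.not_gt h3
    · exact lt_irrefl _ hpq
  · exact absurd ((hor hp).2.trans_lt hpq) hq.not_gt
  · exact hright hp hq
  · exact hleft hp hq
  · rw [movedPoints_of_lt τ hp, movedPoints_of_lt τ hq]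
    simp only [Complex.sub_re, Complex.ofReal_re]
    linarith
  · rw [movedPoints_of_lt τ hp, movedPoints_of_gt τ hq]
    simp only [Complex.sub_re, Complex.add_re, Complex.ofReal_re]
    linarith
  · exact absurd (hp.trans_le (hpq.le.trans (hor hq).1)) (lt_irrefl _)
  · exact absurd ((h3.trans hp).trans (hpq.trans hq)) (lt_irrefl _)
  · rw [movedPoints_of_gt τ hp, movedPoints_of_gt τ hq]
    simp only [Complex.add_re, Complex.ofReal_re]
    linarith

theorem movedPoints_im (τ : unitInterval) (p : Fin (n + 1)) :
    (movedPoints i z τ p).im = (exchangePath i z (turnTime τ) p).im := by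
  simp [movedPoints]

/-- Turning the difference `f` of the two points back by `π t` gives `z (i + 1) - z i`, whence `f.re
cos (π t) + f.im sin (π t) ≥ 2 ε`. The first term is less than `ε`, so the second exceeds `ε`, and
`0 ≤ sin (π t) ≤ 1`. The right point therefore passes above the left one at more than the depth of a
contour. -/
theorem Admissible.crossing (hz : Admissible z R ε) (τ : unitInterval)
    (h : |(movedPoints i z τ i.succ - movedPoints i z τ i.castSucc).re| < ε) :
    ε < (movedPoints i z τ i.succ - movedPoints i z τ i.castSucc).im := by
  rw [movedPoints_of_mem τ (Or.inl rfl), movedPoints_of_mem τ (Or.inr rfl)] at h ⊢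
  set t := turnTime τ
  set f := exchangePath i z t i.succ - exchangePath i z t i.castSucc with hf
  have h1 : z i.succ - z i.castSucc = f * Complex.exp ((-(Real.pi * t) : ℝ) * Complex.I) := by
    have : Complex.exp (Real.pi * Complex.I * (t : ℝ)) *
        Complex.exp ((-(Real.pi * t) : ℝ) * Complex.I) = 1 := by
      rw [← Complex.exp_add, ← Complex.exp_zero]
      push_cast
      ring_nf
    rw [hf, exchangePath_castSucc, exchangePath_succ]
    linear_combination -(z i.succ - z i.castSucc) * this
  have h2 := congrArg Complex.re h1
  rw [Complex.mul_re, Complex.exp_ofReal_mul_I_re, Complex.exp_ofReal_mul_I_im, Real.cos_neg,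
    Real.sin_neg, Complex.sub_re] at h2
  have h3 := hz.gap _ _ i.castSucc_lt_succ
  have hs0 : 0 ≤ Real.sin (Real.pi * t) :=
    Real.sin_nonneg_of_nonneg_of_le_pi (mul_nonneg Real.pi_pos.le t.2.1)
      (mul_le_of_le_one_right Real.pi_pos.le t.2.2)
  have hs1 := Real.sin_le_one (Real.pi * t)
  have h4 : f.re * Real.cos (Real.pi * t) < ε := by
    refine (le_abs_self _).trans_lt ?_
    rw [abs_mul]
    exact (mul_le_of_le_one_right (abs_nonneg _) (Real.abs_cos_le_one _)).trans_lt h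
  have hε := hz.pos
  by_contra! hc
  nlinarith [mul_nonneg (sub_nonneg.2 hc) hs0, mul_nonneg hε.le (sub_nonneg.2 hs1)]

/-- Without the left turning point the strips never collide. This makes the results for fixed points
available at every time of the motion. -/
theorem Admissible.movedPoints_succAbove (hz : Admissible z R ε)
    (hR : ∀ t p, (exchangePath i z t p).im < R) (τ : unitInterval) :
    Admissible (movedPoints i z τ ∘ i.castSucc.succAbove) R ε where
  pos := hz.pos
  gap p q hpq := hz.gap_movedPoints τ (Fin.strictMono_succAbove _ hpq)
    fun h => Fin.succAbove_ne _ _ h.1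
  below p := by
    rw [Function.comp_apply, movedPoints_im]
    exact hR _ _

variable (hz : Admissible z R ε) (hR : ∀ t p, (exchangePath i z t p).im < R)
include hz hR

theorem offCut_moved_labelPt (τ : unitInterval) {e f : Fin (n + 1) × ℕ} (he : e.1 ≠ i.castSucc)
    (hf : f.1 ≠ i.castSucc) (hef : e ≠ f) (t t' : ℝ) :
    OffCut (if LabelLeft e f
      then labelPt (movedPoints i z τ) R ε f t' - labelPt (movedPoints i z τ) R ε e t
      else labelPt (movedPoints i z τ) R ε e t - labelPt (movedPoints i z τ) R ε f t') := by
  obtain ⟨p, b⟩ := e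
  obtain ⟨q, b'⟩ := f
  obtain ⟨p, rfl⟩ := Fin.exists_succAbove_eq he
  obtain ⟨q, rfl⟩ := Fin.exists_succAbove_eq hf
  have h := offCut_labelPt (hz.movedPoints_succAbove hR τ) (e := (p, b)) (f := (q, b'))
    (fun h => hef (by rw [Prod.mk.injEq] at h; rw [h.1, h.2])) t t'
  have hl : LabelLeft (i.castSucc.succAbove p, b) (i.castSucc.succAbove q, b') ↔
      LabelLeft (p, b) (q, b') := by
    simp [LabelLeft]
  simp only [hl]
  exact h

/-- The only new case is a contour around the point `i + 1` and the point `i`. When they meet in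
real part, `crossing` puts the point `i` lower than the bottom of the contour, so the difference
stays off the cut. -/
theorem offCut_moved_labelPt_point (τ : unitInterval) {e : Fin (n + 1) × ℕ}
    (he : e.1 ≠ i.castSucc) (p : Fin (n + 1)) (t : ℝ) :
    OffCut (if e.1 ≤ p then movedPoints i z τ p - labelPt (movedPoints i z τ) R ε e t
      else labelPt (movedPoints i z τ) R ε e t - movedPoints i z τ p) := by
  have hε := hz.pos
  obtain ⟨q, b⟩ := e
  have hb := width_lt hε b
  have hb0 := width_pos hε b
  have hx := contour_re_mem (movedPoints i z τ q) hb0.le R t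
  by_cases hp : p = i.castSucc
  · subst hp
    simp only at he
    rcases he.lt_or_gt with h | h
    · rw [if_pos h.le]
      have := hz.gap_movedPoints τ h fun h' => he h'.1
      left
      rw [Complex.sub_re, labelPt]
      refine (ne_of_lt ?_).symm
      linarith
    · rw [if_neg (not_le.2 h)]
      by_cases hq : q = i.succ
      · subst hq
        by_cases hre : (labelPt (movedPoints i z τ) R ε (i.succ, b) t -
            movedPoints i z τ i.castSucc).re = 0
        · right
          rw [Complex.sub_re, labelPt] at hre
          have h1 := hz.crossing (i := i) τ (by
            rw [Complex.sub_re, abs_lt]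
            simp only at hre
            constructor <;> linarith)
          have h2 := le_contour_im (movedPoints i z τ i.succ) (w := width ε b) (R := R) (by
            rw [movedPoints_im]
            linarith [hR (turnTime τ) i.succ]) t
          rw [Complex.sub_im] at h1 ⊢
          rw [labelPt]
          simp only
          linarith
        · exact Or.inl hre
      · have := hz.gap_movedPoints τ h fun h' => hq h'.2
        left
        rw [Complex.sub_re, labelPt]
        refine (ne_of_lt ?_).symm
        linarith
  · obtain ⟨q, rfl⟩ := Fin.exists_succAbove_eq he
    obtain ⟨p, rfl⟩ := Fin.exists_succAbove_eq hp
    have h := offCut_labelPt_point (hz.movedPoints_succAbove hR τ) (q, b) p t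
    have hl : i.castSucc.succAbove q ≤ i.castSucc.succAbove p ↔ q ≤ p := by simp
    simp only [hl]
    exact h

omit hR in
theorem offCut_moved_point (τ : unitInterval) {p q : Fin (n + 1)} (hpq : p < q) :
    OffCut (movedPoints i z τ q - movedPoints i z τ p) := by
  have hε := hz.pos
  by_cases h : p = i.castSucc ∧ q = i.succ
  · obtain ⟨rfl, rfl⟩ := h
    by_cases hre : (movedPoints i z τ i.succ - movedPoints i z τ i.castSucc).re = 0
    · right
      have := hz.crossing (i := i) τ (by simpa [hre] using hε)
      linarith
    · exact Or.inl hre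
  · have := hz.gap_movedPoints τ hpq h
    left
    rw [Complex.sub_re]
    refine (ne_of_lt ?_).symm
    linarith

variable {e : Fin ℓ → Fin (n + 1) × ℕ} (he : Function.Injective e)
  (hei : ∀ j, (e j).1 ≠ i.castSucc)

/-- The product of contours around the points during the motion, the first coordinate of the cube
being the time. -/
def movingCell : C(Cube (ℓ + 1), Config (movedPoints i z) ℓ) where
  toFun u := ⟨(u 0, fun j => labelPt (movedPoints i z (u 0)) R ε (e j) (u j.succ)),
    fun j l hjl => ne_of_offCut_ite
      (offCut_moved_labelPt hz hR (u 0) (hei j) (hei l) (he.ne hjl) _ _),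
    fun j p => ne_of_offCut_ite (offCut_moved_labelPt_point hz hR (u 0) (hei j) p _)⟩
  continuous_toFun := by
    refine Continuous.subtype_mk (Continuous.prodMk (by fun_prop) (continuous_pi fun j => ?_)) _
    exact continuous_contour _ _ ((continuous_movedPoints i z _).comp (continuous_apply 0))
      (by fun_prop)

/-- The order of subtraction is fixed by the labels during the whole motion, although the turning
points exchange sides; this is what continues the branch. -/
theorem isBranch_movingCell (κ : ℝ) (lam : Fin (n + 1) → ℂ) :
    IsBranch κ lam (movedPoints i z) (movingCell hz hR he hei) fun u =>
      labelSection κ lam (movedPoints i z (u 0)) R ε e (cubeTail ℓ u) :=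
  isBranch_of_offCut (Z := movedPoints i z) κ lam (continuous_movedPoints i z)
    (movingCell hz hR he hei) (fun j l => LabelLeft (e j) (e l)) (fun j p => (e j).1 ≤ p)
    (fun u j l hjl => offCut_moved_labelPt hz hR (u 0) (hei j) (hei l) (he.ne hjl.ne) _ _)
    (fun u j p => offCut_moved_labelPt_point hz hR (u 0) (hei j) p _)
    fun u _ _ h => offCut_moved_point hz (u 0) h

end Moving

/-! ### The half-turn without contours around the left point -/

section HalfTurn

variable {n : ℕ} {i : Fin n} {z : Fin (n + 1) → ℂ} {R ε : ℝ} {ℓ : ℕ}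

theorem swapAt_swapAt (i : Fin n) (p : Fin (n + 1)) : swapAt i (swapAt i p) = p := by
  simp [swapAt]

theorem swapAt_lt_swapAt {p q : Fin (n + 1)} (h : p < q)
    (hne : ¬(p = i.castSucc ∧ q = i.succ)) : swapAt i p < swapAt i q := by
  simp only [swapAt, Equiv.swap_apply_def]
  simp only [Fin.ext_iff, Fin.val_castSucc, Fin.val_succ] at hne
  split_ifs <;> simp only [Fin.ext_iff, Fin.lt_def, Fin.val_castSucc, Fin.val_succ] at * <;> omega

/-- The label of a contour after the half-turn. -/
def swapLabel (i : Fin n) (e : Fin (n + 1) × ℕ) : Fin (n + 1) × ℕ := (swapAt i e.1, e.2)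

theorem swapLabel_injective (i : Fin n) : Function.Injective (swapLabel i) := by
  rintro ⟨p, b⟩ ⟨q, c⟩ h
  simpa [swapLabel] using h

theorem LabelLeft.swapLabel {e f : Fin (n + 1) × ℕ} (he : e.1 ≠ i.castSucc) (h : LabelLeft e f) :
    LabelLeft (swapLabel i e) (swapLabel i f) := by
  rcases h with h | h
  · exact Or.inl (swapAt_lt_swapAt h fun h' => he h'.1)
  · exact Or.inr ⟨by rw [GomezSierra.swapLabel, h.1]; rfl, h.2⟩

/-- After the exchange the order by labels is the order from left to right except between the point
`i` and the point `i + 1` with its contours. By `brLog_neg` the pair of points gives `πi` with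
weight `lam i lam (i + 1) / (2 κ)`, and each contour gives `πi` with weight `-lam i / κ`. -/
theorem labelSection_comp_swapAt (κ : ℝ) (lam : Fin (n + 1) → ℂ) (hz : Admissible z R ε)
    {e : Fin ℓ → Fin (n + 1) × ℕ} (he : Function.Injective e)
    (hei : ∀ j, (e j).1 ≠ i.castSucc) (u : Cube ℓ) :
    labelSection κ lam (z ∘ swapAt i) R ε e u =
      qPow κ (lam i.castSucc * lam i.succ / 2 -
        ∑ j, if (e j).1 = i.succ then lam i.castSucc else 0) *
      labelSection κ (lam ∘ swapAt i) z R ε (swapLabel i ∘ e) u := by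
  have h3 := i.castSucc_lt_succ
  have hL : ∀ j, ∀ l ∈ Finset.Ioi j, (if LabelLeft (e j) (e l)
        then labelPt (z ∘ swapAt i) R ε (e l) (u l) - labelPt (z ∘ swapAt i) R ε (e j) (u j)
        else labelPt (z ∘ swapAt i) R ε (e j) (u j) - labelPt (z ∘ swapAt i) R ε (e l) (u l)) =
      if LabelLeft (swapLabel i (e j)) (swapLabel i (e l))
        then labelPt z R ε (swapLabel i (e l)) (u l) - labelPt z R ε (swapLabel i (e j)) (u j)
        else labelPt z R ε (swapLabel i (e j)) (u j) -
          labelPt z R ε (swapLabel i (e l)) (u l) := by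
    intro j l hl
    rcases labelLeft_or (he.ne (Finset.mem_Ioi.1 hl).ne) with h | h
    · rw [if_pos h, if_pos (h.swapLabel (hei j))]
      rfl
    · rw [if_neg h.asymm, if_neg (h.swapLabel (hei l)).asymm]
      rfl
  have hK : ∀ j p, brLog (if (e j).1 ≤ p
        then (z ∘ swapAt i) p - labelPt (z ∘ swapAt i) R ε (e j) (u j)
        else labelPt (z ∘ swapAt i) R ε (e j) (u j) - (z ∘ swapAt i) p) =
      brLog (if (swapLabel i (e j)).1 ≤ swapAt i p
        then z (swapAt i p) - labelPt z R ε (swapLabel i (e j)) (u j)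
        else labelPt z R ε (swapLabel i (e j)) (u j) - z (swapAt i p)) +
      if (e j).1 = i.succ ∧ p = i.castSucc then Real.pi * Complex.I else 0 := by
    intro j p
    have e1 : labelPt (z ∘ swapAt i) R ε (e j) (u j) =
      labelPt z R ε (swapLabel i (e j)) (u j) := rfl
    have e2 : (swapLabel i (e j)).1 = swapAt i (e j).1 := rfl
    rw [e1, Function.comp_apply]
    by_cases h : (e j).1 = i.succ ∧ p = i.castSucc
    · have e3 : swapAt i i.castSucc = i.succ := by simp [swapAt]
      have e4 : swapAt i i.succ = i.castSucc := by simp [swapAt]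
      rw [if_pos h, e2, h.1, h.2, if_neg (not_le.2 h3), e3, e4, if_pos h3.le, ← neg_sub, brLog_neg]
      have h4 := contour_re_mem (z i.castSucc) (width_pos hz.pos (e j).2).le R (u j)
      have h5 := hz.gap _ _ h3
      have h6 := width_lt hz.pos (e j).2
      have h7 := hz.pos
      rw [labelPt, e2, h.1, e4, Complex.sub_re]
      simp only [swapLabel]
      linarith
    · rw [if_neg h, add_zero, e2]
      rcases lt_trichotomy (e j).1 p with h' | h' | h'
      · rw [if_pos h'.le, if_pos (swapAt_lt_swapAt h' fun h'' => hei j h''.1).le]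
      · rw [if_pos h'.le, if_pos (by rw [h'])]
      · rw [if_neg (not_le.2 h'),
          if_neg (not_le.2 (swapAt_lt_swapAt h' fun h'' => h ⟨h''.2, h''.1⟩))]
  have hK' : ∀ j, ∑ p, -(lam p / (κ : ℂ)) * brLog (if (swapLabel i (e j)).1 ≤ swapAt i p
        then z (swapAt i p) - labelPt z R ε (swapLabel i (e j)) (u j)
        else labelPt z R ε (swapLabel i (e j)) (u j) - z (swapAt i p)) =
      ∑ p, -((lam ∘ swapAt i) p / (κ : ℂ)) * brLog (if (swapLabel i (e j)).1 ≤ p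
        then z p - labelPt z R ε (swapLabel i (e j)) (u j)
        else labelPt z R ε (swapLabel i (e j)) (u j) - z p) := by
    intro j
    rw [← Equiv.sum_comp (swapAt i) fun p => -((lam ∘ swapAt i) p / (κ : ℂ)) *
      brLog (if (swapLabel i (e j)).1 ≤ p
        then z p - labelPt z R ε (swapLabel i (e j)) (u j)
        else labelPt z R ε (swapLabel i (e j)) (u j) - z p)]
    simp only [Function.comp_apply, swapAt_swapAt]
  have hM : ∀ p, ∀ r ∈ Finset.Ioi p, brLog ((z ∘ swapAt i) r - (z ∘ swapAt i) p) =
      brLog (if swapAt i p < swapAt i r then z (swapAt i r) - z (swapAt i p)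
        else z (swapAt i p) - z (swapAt i r)) +
      if p = i.castSucc ∧ r = i.succ then Real.pi * Complex.I else 0 := by
    intro p r hr
    have hr := Finset.mem_Ioi.1 hr
    simp only [Function.comp_apply]
    by_cases h : p = i.castSucc ∧ r = i.succ
    · have e3 : swapAt i i.castSucc = i.succ := by simp [swapAt]
      have e4 : swapAt i i.succ = i.castSucc := by simp [swapAt]
      rw [if_pos h, h.1, h.2, e3, e4, if_neg h3.not_gt, ← neg_sub, brLog_neg]
      have h5 := hz.gap _ _ h3
      have h7 := hz.pos
      rw [Complex.sub_re]
      linarith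
    · rw [if_neg h, add_zero, if_pos (swapAt_lt_swapAt hr h)]
  have hM' := sum_pairs_perm (swapAt i) (fun p r => (lam ∘ swapAt i) p * (lam ∘ swapAt i) r /
    (2 * (κ : ℂ)) * brLog (if p < r then z r - z p else z p - z r)) (by
      intro p r
      rcases lt_trichotomy p r with h | h | h
      · rw [if_pos h, if_neg h.not_gt, mul_comm ((lam ∘ swapAt i) p)]
      · rw [h]
      · rw [if_pos h, if_neg h.not_gt, mul_comm ((lam ∘ swapAt i) p)])
  have hM'' : ∑ p, ∑ r ∈ Finset.Ioi p, (lam ∘ swapAt i) p * (lam ∘ swapAt i) r /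
      (2 * (κ : ℂ)) * brLog (if p < r then z r - z p else z p - z r) =
      ∑ p, ∑ r ∈ Finset.Ioi p, (lam ∘ swapAt i) p * (lam ∘ swapAt i) r /
      (2 * (κ : ℂ)) * brLog (z r - z p) := by
    refine Finset.sum_congr rfl fun p _ => Finset.sum_congr rfl fun r hr => ?_
    rw [if_pos (Finset.mem_Ioi.1 hr)]
  have s1 : ∑ j, ∑ p, -(lam p / (κ : ℂ)) *
      (if (e j).1 = i.succ ∧ p = i.castSucc then Real.pi * Complex.I else 0) =
      -(Real.pi * Complex.I / κ) * ∑ j, if (e j).1 = i.succ then lam i.castSucc else 0 := by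
    rw [Finset.mul_sum]
    refine Finset.sum_congr rfl fun j _ => ?_
    by_cases h : (e j).1 = i.succ
    · simp only [h, true_and, mul_ite, mul_zero, Finset.sum_ite_eq', Finset.mem_univ, if_true]
      ring
    · simp [h]
  have s2 : ∑ p, ∑ r ∈ Finset.Ioi p, lam p * lam r / (2 * (κ : ℂ)) *
      (if p = i.castSucc ∧ r = i.succ then Real.pi * Complex.I else 0) =
      Real.pi * Complex.I / κ * (lam i.castSucc * lam i.succ / 2) := by
    rw [Finset.sum_eq_single i.castSucc, Finset.sum_eq_single i.succ]
    · simp only [and_self, if_true]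
      ring
    · intro r _ hr
      simp [hr]
    · intro h
      exact absurd (Finset.mem_Ioi.2 h3) h
    · intro p _ hp
      exact Finset.sum_eq_zero fun r _ => by simp [hp]
    · simp
  unfold labelSection
  rw [qPow, ← Complex.exp_add]
  congr 1
  have t1 : ∑ j, ∑ l ∈ Finset.Ioi j, 2 / (κ : ℂ) * brLog (if LabelLeft (e j) (e l)
        then labelPt (z ∘ swapAt i) R ε (e l) (u l) - labelPt (z ∘ swapAt i) R ε (e j) (u j)
        else labelPt (z ∘ swapAt i) R ε (e j) (u j) - labelPt (z ∘ swapAt i) R ε (e l) (u l)) =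
      ∑ j, ∑ l ∈ Finset.Ioi j, 2 / (κ : ℂ) *
        brLog (if LabelLeft (swapLabel i (e j)) (swapLabel i (e l))
        then labelPt z R ε (swapLabel i (e l)) (u l) - labelPt z R ε (swapLabel i (e j)) (u j)
        else labelPt z R ε (swapLabel i (e j)) (u j) -
          labelPt z R ε (swapLabel i (e l)) (u l)) :=
    Finset.sum_congr rfl fun j _ => Finset.sum_congr rfl fun l hl => by rw [hL j l hl]
  have t2 : ∑ p, ∑ r ∈ Finset.Ioi p, lam p * lam r / (2 * (κ : ℂ)) *
      brLog ((z ∘ swapAt i) r - (z ∘ swapAt i) p) =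
      ∑ p, ∑ r ∈ Finset.Ioi p, (lam ∘ swapAt i) p * (lam ∘ swapAt i) r /
        (2 * (κ : ℂ)) * brLog (z r - z p) +
      Real.pi * Complex.I / κ * (lam i.castSucc * lam i.succ / 2) := by
    rw [← s2, ← hM'', ← hM', ← Finset.sum_add_distrib]
    refine Finset.sum_congr rfl fun p _ => ?_
    rw [← Finset.sum_add_distrib]
    refine Finset.sum_congr rfl fun r hr => ?_
    rw [hM p r hr, Function.comp_apply, Function.comp_apply, swapAt_swapAt, swapAt_swapAt]
    ring
  rw [t1, t2]
  simp only [hK, mul_add, Finset.sum_add_distrib, hK', s1]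
  simp only [Function.comp_apply]
  ring

/-- The moving product of contours, pushed to the true path by `closing`, is a homotopy in the
family between its two end faces. At both ends nothing is moved away, so `closing` is the identity
there with factor `1`. -/
theorem faceClass_movingCell (κ : ℝ) (lam : Fin (n + 1) → ℂ) (hz : Admissible z R ε)
    (hdisc : ∀ p, p ≠ i.castSucc → p ≠ i.succ → turnRadius i z < ‖z p - turnCentre i z‖)
    (hR : ∀ t p, (exchangePath i z t p).im < R)
    {e : Fin ℓ → Fin (n + 1) × ℕ} (he : Function.Injective e)
    (hei : ∀ j, (e j).1 ≠ i.castSucc) :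
    pushClass (isTwistedMap_start κ lam z R ℓ i) ℓ
        (cubeClass κ lam R (labelCell hz e he) (labelSection κ lam z R ε e)) =
      qPow κ (lam i.castSucc * lam i.succ / 2 -
        ∑ j, if (e j).1 = i.succ then lam i.castSucc else 0) •
      pushClass (isTwistedMap_end κ lam z R ℓ i) ℓ
        (cubeClass κ (lam ∘ swapAt i) R
          (labelCell hz (swapLabel i ∘ e) ((swapLabel_injective i).comp he))
          (labelSection κ (lam ∘ swapAt i) z R ε (swapLabel i ∘ e))) := by
  have hre : ∀ p r, p < r → (z p).re < (z r).re := fun p r h => by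
    linarith [hz.gap p r h, hz.pos]
  obtain ⟨δ, hδ, hl, hg⟩ := exists_margin hre hdisc
  let G : PlaneMap (movedPoints i z) (exchangePath i z) R := closing hδ hl hg
  have hmap : ∀ τ, awayTime τ = 0 → ∀ x, G.map τ x = x := fun τ h x => by
    simp only [G, closing, h, zero_mul, closeMap_zero]
  have hlog : ∀ τ, awayTime τ = 0 → ∀ x y, G.log τ x y = 0 := fun τ h x y => by
    simp only [G, closing, h, zero_mul, closeMap_zero]
    by_cases hxy : x = y
    · simp [hxy]
    · simp [div_self (sub_ne_zero.2 hxy)]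
  have key := faceClass_zero_eq (R := R) (G.isBranch (isBranch_movingCell hz hR he hei κ lam))
    fun a u hu => G.mem_infinity ⟨a, (contour_im_of_end _ _ _ hu).ge⟩
  have h0 : movedPoints i z 0 = z := funext (movedPoints_zero i z)
  have h1 : movedPoints i z 1 = z ∘ swapAt i := funext (movedPoints_one i z)
  rw [pushClass_cubeClass, pushClass_cubeClass, ← cubeClass_smul]
  unfold faceClass at key
  refine Eq.trans ?_ (key.symm.trans ?_)
  · congr 1
    · ext u : 1
      refine Subtype.ext (Prod.ext ?_ (funext fun j => ?_))
      · change (0 : unitInterval) = turnTime (faceIncl ℓ 0 0 u 0)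
        rw [faceIncl_self, turnTime_zero]
      · change labelPt z R ε (e j) (u j) = G.map (faceIncl ℓ 0 0 u 0)
          (labelPt (movedPoints i z (faceIncl ℓ 0 0 u 0)) R ε (e j) (faceIncl ℓ 0 0 u j.succ))
        rw [faceIncl_self, hmap 0 awayTime_zero, faceIncl_zero_succ, h0]
    · funext u
      rw [Function.comp_apply, Pi.mul_apply, faceIncl_self, h0, G.factor_eq_one, mul_one]
      · rfl
      · change ∀ x y, G.log (faceIncl ℓ 0 0 u 0) x y = 0
        rw [faceIncl_self]
        exact hlog 0 awayTime_zero
  · congr 1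
    · ext u : 1
      refine Subtype.ext (Prod.ext ?_ (funext fun j => ?_))
      · change turnTime (faceIncl ℓ 0 1 u 0) = (1 : unitInterval)
        rw [faceIncl_self, turnTime_one]
      · change G.map (faceIncl ℓ 0 1 u 0)
          (labelPt (movedPoints i z (faceIncl ℓ 0 1 u 0)) R ε (e j) (faceIncl ℓ 0 1 u j.succ)) =
          labelPt (z ∘ swapAt i) R ε (e j) (u j)
        rw [faceIncl_self, hmap 1 awayTime_one, faceIncl_zero_succ, h1]
    · funext u
      rw [Function.comp_apply, Pi.mul_apply, faceIncl_self, h1, G.factor_eq_one, mul_one,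
        labelSection_comp_swapAt κ lam hz he hei, Pi.smul_apply, smul_eq_mul]
      · rfl
      · change ∀ x y, G.log (faceIncl ℓ 0 1 u 0) x y = 0
        rw [faceIncl_self]
        exact hlog 1 awayTime_one

theorem antiClass_pushClass_start (κ : ℝ) (lam : Fin (n + 1) → ℂ) (k : ℕ)
    (c : ChainClass κ lam (fun _ : Unit => z) ℓ R k) :
    antiClass κ lam (exchangePath i z) ℓ R k
        (pushClass (isTwistedMap_start κ lam z R ℓ i) k c) =
      pushClass (isTwistedMap_start κ lam z R ℓ i) k
        (antiClass κ lam (fun _ : Unit => z) ℓ R k c) :=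
  LinearMap.congr_fun (antiClass_comp_pushClass (Z := fun _ : Unit => z) (Z' := exchangePath i z)
    (ContinuousMap.const Unit (0 : unitInterval)) 1
    (fun _ p => exchangePath_zero i z p) (fun _ => rfl) k) c

theorem antiClass_pushClass_end (κ : ℝ) (lam : Fin (n + 1) → ℂ) (k : ℕ)
    (c : ChainClass κ (lam ∘ swapAt i) (fun _ : Unit => z) ℓ R k) :
    antiClass κ lam (exchangePath i z) ℓ R k
        (pushClass (isTwistedMap_end κ lam z R ℓ i) k c) =
      pushClass (isTwistedMap_end κ lam z R ℓ i) k
        (antiClass κ (lam ∘ swapAt i) (fun _ : Unit => z) ℓ R k c) :=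
  LinearMap.congr_fun (antiClass_comp_pushClass (Z := fun _ : Unit => z) (Z' := exchangePath i z)
    (ContinuousMap.const Unit (1 : unitInterval)) (swapAt i)
    (fun _ p => exchangePath_one i z p) (fun p => by simp [swapAt]) k) c

/-- The half-turn of a chain without contours around the left one of the two points. -/
theorem pushClass_start_gsClass_of_eq_zero (κ : ℝ) (lam : Fin (n + 1) → ℂ)
    (hz : Admissible z R ε)
    (hdisc : ∀ p, p ≠ i.castSucc → p ≠ i.succ → turnRadius i z < ‖z p - turnCentre i z‖)
    (hR : ∀ t p, (exchangePath i z t p).im < R) (k k' : Fin (n + 1) → ℕ) (hk : ∑ p, k p = ℓ)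
    (hk' : ∑ p, k' p = ℓ) (hkk : k' = k ∘ swapAt i) (hki : k i.castSucc = 0) :
    pushClass (isTwistedMap_start κ lam z R ℓ i) ℓ (gsClass κ lam hz k hk) =
      qPow κ (lam i.castSucc * lam i.succ / 2 - lam i.castSucc * k i.succ) •
        pushClass (isTwistedMap_end κ lam z R ℓ i) ℓ (gsClass κ (lam ∘ swapAt i) hz k' hk') := by
  have hei : ∀ j, (gsLabel k hk j).1 ≠ i.castSucc := fun j h => by
    have := (label k hk j).2.2
    have h' : k (label k hk j).1 = 0 := by
      rw [← hki, ← h]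
      rfl
    omega
  have he := gsLabel_injective k hk
  have h1 := congrArg (antiClass κ lam (exchangePath i z) ℓ R ℓ)
    (faceClass_movingCell κ lam hz hdisc hR he hei)
  rw [map_smul] at h1
  rw [antiClass_pushClass_start, antiClass_pushClass_end] at h1
  have h4 : ∑ j, (if (gsLabel k hk j).1 = i.succ then lam i.castSucc else 0) =
      lam i.castSucc * k i.succ := by
    rw [sum_gsLabel k hk fun p => if p = i.succ then lam i.castSucc else 0]
    simp [mul_comm]
  have hr : Set.range (swapLabel i ∘ gsLabel k hk) = Set.range (gsLabel k' hk') := by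
    rw [range_gsLabel, Set.range_comp, range_gsLabel, hkk]
    ext ⟨p, b⟩
    constructor
    · rintro ⟨⟨q, c⟩, h, h'⟩
      simp only [swapLabel, Prod.mk.injEq] at h'
      obtain ⟨rfl, rfl⟩ := h'
      simpa [swapAt_swapAt] using h
    · intro h
      exact ⟨(swapAt i p, b), h, by simp [swapLabel, swapAt_swapAt]⟩
  have h5 := labelClass_congr κ (lam ∘ swapAt i) hz ((swapLabel_injective i).comp he)
    (gsLabel_injective k' hk') hr
  rw [labelClass] at h5
  rw [h5, h4] at h1
  exact h1

end HalfTurn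

/-! ### The action of `F` on the family over the half-turn -/

section Family

variable {n : ℕ} {i : Fin n} {z : Fin (n + 1) → ℂ} {R ε : ℝ} {ℓ : ℕ}

/-- A bound for the points during the half-turn and their contours. -/
def turnBound (i : Fin n) (z : Fin (n + 1) → ℂ) (ε : ℝ) : ℝ :=
  ‖turnCentre i z‖ + turnRadius i z + ∑ p, ‖z p‖ + ε

theorem turnBound_nonneg (hε : 0 < ε) : 0 ≤ turnBound i z ε := by
  have := turnRadius_nonneg i z
  unfold turnBound
  positivity

theorem norm_add_le_turnBound (p : Fin (n + 1)) : ‖z p‖ + ε ≤ turnBound i z ε := by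
  have h1 := turnRadius_nonneg i z
  have h2 := Finset.single_le_sum (f := fun p => ‖z p‖) (fun _ _ => norm_nonneg _)
    (Finset.mem_univ p)
  have h3 := norm_nonneg (turnCentre i z)
  unfold turnBound
  linarith

/-- One constant has to bound the points of the end fibres and of the whole family: the far curve
depends on it, so adding a contour commutes with the inclusions only for equal constants. -/
theorem norm_exchangePath_le (hε : 0 < ε) (t : unitInterval) (p : Fin (n + 1)) :
    ‖exchangePath i z t p‖ ≤ turnBound i z ε := by
  by_cases hp : p = i.castSucc ∨ p = i.succ
  · have h1 := norm_exchangePath_sub i z (t := t) hp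
    have h2 := norm_le_norm_add_norm_sub' (exchangePath i z t p) (turnCentre i z)
    have h3 : 0 ≤ ∑ p, ‖z p‖ := Finset.sum_nonneg fun _ _ => norm_nonneg _
    unfold turnBound
    linarith
  · rw [exchangePath_of_ne i z t (not_or.1 hp).1 (not_or.1 hp).2]
    linarith [norm_add_le_turnBound (i := i) (z := z) (ε := ε) p]

/-- Adding an outermost contour in the family over the half-turn, normalized and antisymmetrized. -/
def familyF (κ : ℝ) (lam : Fin (n + 1) → ℂ) (i : Fin n) (z : Fin (n + 1) → ℂ) (R : ℝ)
    (hε : 0 < ε) (ℓ : ℕ) :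
    ChainClass κ lam (exchangePath i z) ℓ R ℓ →ₗ[ℂ]
      ChainClass κ lam (exchangePath i z) (ℓ + 1) R (ℓ + 1) :=
  (ℓ.factorial : ℂ)⁻¹ • antiClass κ lam (exchangePath i z) (ℓ + 1) R (ℓ + 1) ∘ₗ
    addContourClass (norm_exchangePath_le hε) (turnBound_nonneg hε) (continuous_exchangePath i z)
      κ lam R ℓ ℓ

theorem pushClass_configMap_congr {B B' : Type} [TopologicalSpace B] [TopologicalSpace B']
    {κ : ℝ} {lam lam' : Fin n → ℂ} {Z : B → Fin n → ℂ} {Z' : B' → Fin n → ℂ} (β : C(B, B'))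
    {σ σ' : Equiv.Perm (Fin ℓ)} (hσ : σ = σ') (τ : Equiv.Perm (Fin n))
    (hZ : ∀ b p, Z' (β b) p = Z b (τ p)) (hlam : ∀ p, lam' p = lam (τ p)) (k : ℕ)
    (c : ChainClass κ lam Z ℓ R k) :
    pushClass (isTwistedMap_configMap β σ τ hZ hlam) k c =
      pushClass (isTwistedMap_configMap β σ' τ hZ hlam) k c := by
  subst hσ
  rfl

theorem decomposeFin_symm_zero_one :
    Equiv.Perm.decomposeFin.symm ((0 : Fin (ℓ + 1)), (1 : Equiv.Perm (Fin ℓ))) = 1 := by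
  rw [Equiv.Perm.decomposeFin_symm_of_one, Equiv.swap_self]
  rfl

theorem addContourClass_pushClass {B B' : Type} [TopologicalSpace B] [TopologicalSpace B']
    {κ : ℝ} {lam lam' : Fin n → ℂ} {Z : B → Fin n → ℂ} {Z' : B' → Fin n → ℂ} {C : ℝ}
    (hC : ∀ b p, ‖Z b p‖ ≤ C) (hC0 : 0 ≤ C) (hZ : ∀ p, Continuous fun b => Z b p)
    (hC' : ∀ b p, ‖Z' b p‖ ≤ C) (hZ' : ∀ p, Continuous fun b => Z' b p) (β : C(B, B'))
    (τ : Equiv.Perm (Fin n)) (hτ : ∀ b p, Z' (β b) p = Z b (τ p)) (hlam : ∀ p, lam' p = lam (τ p))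
    (k : ℕ) (c : ChainClass κ lam Z ℓ R k) :
    addContourClass hC' hC0 hZ' κ lam' R ℓ k
        (pushClass (isTwistedMap_configMap β 1 τ hτ hlam) k c) =
      pushClass (isTwistedMap_configMap β 1 τ hτ hlam) (k + 1)
        (addContourClass hC hC0 hZ κ lam R ℓ k c) :=
  (LinearMap.congr_fun
    (addContourClass_comp_pushClass hC hC0 hZ hC' hZ' β 1 τ hτ hlam k) c).trans
    (pushClass_configMap_congr β decomposeFin_symm_zero_one τ hτ hlam _ _)

theorem addContourClass_pushClass_start (κ : ℝ) (lam : Fin (n + 1) → ℂ) (hε : 0 < ε)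
    (hC' : ∀ (_ : Unit) p, ‖z p‖ ≤ turnBound i z ε)
    (c : ChainClass κ lam (fun _ : Unit => z) ℓ R ℓ) :
    addContourClass (norm_exchangePath_le hε) (turnBound_nonneg hε) (continuous_exchangePath i z)
        κ lam R ℓ ℓ (pushClass (isTwistedMap_start κ lam z R ℓ i) ℓ c) =
      pushClass (isTwistedMap_start κ lam z R (ℓ + 1) i) (ℓ + 1)
        (addContourClass hC' (turnBound_nonneg hε) (fun _ => continuous_const) κ lam R ℓ ℓ c) :=
  addContourClass_pushClass (Z := fun _ : Unit => z) (Z' := exchangePath i z) hC'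
    (turnBound_nonneg hε) (fun _ => continuous_const) (norm_exchangePath_le hε)
    (continuous_exchangePath i z) (ContinuousMap.const Unit (0 : unitInterval)) 1
    (fun _ p => exchangePath_zero i z p) (fun _ => rfl) ℓ c

theorem addContourClass_pushClass_end (κ : ℝ) (lam : Fin (n + 1) → ℂ) (hε : 0 < ε)
    (hC' : ∀ (_ : Unit) p, ‖z p‖ ≤ turnBound i z ε)
    (c : ChainClass κ (lam ∘ swapAt i) (fun _ : Unit => z) ℓ R ℓ) :
    addContourClass (norm_exchangePath_le hε) (turnBound_nonneg hε) (continuous_exchangePath i z)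
        κ lam R ℓ ℓ (pushClass (isTwistedMap_end κ lam z R ℓ i) ℓ c) =
      pushClass (isTwistedMap_end κ lam z R (ℓ + 1) i) (ℓ + 1)
        (addContourClass hC' (turnBound_nonneg hε) (fun _ => continuous_const) κ
          (lam ∘ swapAt i) R ℓ ℓ c) :=
  addContourClass_pushClass (Z := fun _ : Unit => z) (Z' := exchangePath i z) hC'
    (turnBound_nonneg hε) (fun _ => continuous_const) (norm_exchangePath_le hε)
    (continuous_exchangePath i z) (ContinuousMap.const Unit (1 : unitInterval)) (swapAt i)
    (fun _ p => exchangePath_one i z p) (fun p => by simp [swapAt]) ℓ c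

/-- Adding the contour in the family and adding it in the fibre agree, so the relation of the fibre
is transported. The normalization `1 / ℓ!` removes the factor due to `gsClass` being antisymmetrized
already. -/
theorem familyF_start (κ : ℝ) (lam : Fin (n + 1) → ℂ) (hz : Admissible z R ε)
    (k : Fin (n + 1) → ℕ) (hk : ∑ p, k p = ℓ) :
    familyF κ lam i z R hz.pos ℓ
        (pushClass (isTwistedMap_start κ lam z R ℓ i) ℓ (gsClass κ lam hz k hk)) =
      ∑ p, coproductCoeff κ lam k p • pushClass (isTwistedMap_start κ lam z R (ℓ + 1) i) (ℓ + 1)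
        (gsClass κ lam hz (k + Pi.single p 1) (sum_add_single hk p)) := by
  have hC' : ∀ (_ : Unit) p, ‖z p‖ ≤ turnBound i z ε := fun _ p => by
    linarith [norm_add_le_turnBound (i := i) (z := z) (ε := ε) p, hz.pos]
  rw [familyF, LinearMap.smul_apply, LinearMap.comp_apply,
    addContourClass_pushClass_start κ lam hz.pos hC', antiClass_pushClass_start,
    antiClass_addContourClass_gsClass κ lam hz norm_add_le_turnBound hC', map_smul, smul_smul,
    inv_mul_cancel₀ (Nat.cast_ne_zero.2 ℓ.factorial_ne_zero), one_smul, map_sum]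
  simp only [map_smul]

theorem familyF_end (κ : ℝ) (lam : Fin (n + 1) → ℂ) (hz : Admissible z R ε)
    (k : Fin (n + 1) → ℕ) (hk : ∑ p, k p = ℓ) :
    familyF κ lam i z R hz.pos ℓ
        (pushClass (isTwistedMap_end κ lam z R ℓ i) ℓ (gsClass κ (lam ∘ swapAt i) hz k hk)) =
      ∑ p, coproductCoeff κ (lam ∘ swapAt i) k p •
        pushClass (isTwistedMap_end κ lam z R (ℓ + 1) i) (ℓ + 1)
          (gsClass κ (lam ∘ swapAt i) hz (k + Pi.single p 1) (sum_add_single hk p)) := by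
  have hC' : ∀ (_ : Unit) p, ‖z p‖ ≤ turnBound i z ε := fun _ p => by
    linarith [norm_add_le_turnBound (i := i) (z := z) (ε := ε) p, hz.pos]
  rw [familyF, LinearMap.smul_apply, LinearMap.comp_apply,
    addContourClass_pushClass_end κ lam hz.pos hC', antiClass_pushClass_end,
    antiClass_addContourClass_gsClass κ _ hz norm_add_le_turnBound hC', map_smul, smul_smul,
    inv_mul_cancel₀ (Nat.cast_ne_zero.2 ℓ.factorial_ne_zero), one_smul, map_sum]
  simp only [map_smul]

/-- The class of a chain at the start of the half-turn in the family, zero if the number of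
contours is not `ℓ`. -/
def startClass (κ : ℝ) (lam : Fin (n + 1) → ℂ) (i : Fin n) (hz : Admissible z R ε) (ℓ : ℕ)
    (k : Fin (n + 1) → ℕ) : ChainClass κ lam (exchangePath i z) ℓ R ℓ :=
  if h : ∑ p, k p = ℓ then
    pushClass (isTwistedMap_start κ lam z R ℓ i) ℓ (gsClass κ lam hz k h) else 0

/-- The class of a chain at the end of the half-turn in the family, zero if the number of
contours is not `ℓ`. -/
def endClass (κ : ℝ) (lam : Fin (n + 1) → ℂ) (i : Fin n) (hz : Admissible z R ε) (ℓ : ℕ)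
    (k : Fin (n + 1) → ℕ) : ChainClass κ lam (exchangePath i z) ℓ R ℓ :=
  if h : ∑ p, k p = ℓ then
    pushClass (isTwistedMap_end κ lam z R ℓ i) ℓ (gsClass κ (lam ∘ swapAt i) hz k h) else 0

theorem familyF_startClass (κ : ℝ) (lam : Fin (n + 1) → ℂ) (hz : Admissible z R ε)
    (k : Fin (n + 1) → ℕ) (hk : ∑ p, k p = ℓ) :
    familyF κ lam i z R hz.pos ℓ (startClass κ lam i hz ℓ k) =
      ∑ p, coproductCoeff κ lam k p • startClass κ lam i hz (ℓ + 1) (k + Pi.single p 1) := by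
  rw [startClass, dif_pos hk, familyF_start]
  refine Finset.sum_congr rfl fun p _ => ?_
  rw [startClass, dif_pos (sum_add_single hk p)]

theorem familyF_endClass (κ : ℝ) (lam : Fin (n + 1) → ℂ) (hz : Admissible z R ε)
    (k : Fin (n + 1) → ℕ) (hk : ∑ p, k p = ℓ) :
    familyF κ lam i z R hz.pos ℓ (endClass κ lam i hz ℓ k) =
      ∑ p, coproductCoeff κ (lam ∘ swapAt i) k p •
        endClass κ lam i hz (ℓ + 1) (k + Pi.single p 1) := by
  rw [endClass, dif_pos hk, familyF_end]
  refine Finset.sum_congr rfl fun p _ => ?_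
  rw [endClass, dif_pos (sum_add_single hk p)]

end Family

/-! ### The matrix of the R-matrix -/

section RMatrix

theorem qPow_ne_zero (κ : ℝ) (a : ℂ) : qPow κ a ≠ 0 := Complex.exp_ne_zero _

/-- `q ^ (2 m) = 1` means that `m` is an integer multiple of the irrational number `κ`. Thus `q` is
not a root of unity: the factorials in `Ř` are invertible and the weights are separated. -/
theorem eq_zero_of_qPow_eq_one {κ : ℝ} (hκ : Irrational κ) {m : ℤ} (h : qPow κ (2 * m) = 1) :
    m = 0 := by
  have hk : (κ : ℂ) ≠ 0 := by exact_mod_cast hκ.ne_zero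
  rw [qPow, Complex.exp_eq_one_iff] at h
  obtain ⟨N, hN⟩ := h
  have hpi : (Real.pi : ℂ) ≠ 0 := by exact_mod_cast Real.pi_ne_zero
  have h2 : (m : ℂ) = N * κ := by
    rw [div_eq_iff hk] at hN
    have := mul_left_cancel₀ (mul_ne_zero (mul_ne_zero two_ne_zero hpi) Complex.I_ne_zero)
      (b := (m : ℂ)) (c := N * κ) (by linear_combination hN)
    exact this
  have h3 : (m : ℝ) = N * κ := by exact_mod_cast h2
  by_contra hm
  have hN0 : N ≠ 0 := by
    rintro rfl
    simp only [Int.cast_zero, zero_mul] at h3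
    exact hm (by exact_mod_cast h3)
  exact (hκ.intCast_mul hN0).ne_int m h3.symm

theorem qNum_ne_zero {κ : ℝ} (hκ : Irrational κ) (m : ℕ) : qNum κ ((m : ℂ) + 1) ≠ 0 := by
  refine div_ne_zero (fun h => ?_) (qPow_one_sub_ne_zero hκ)
  have h1 : qPow κ (2 * ((m + 1 : ℕ) : ℤ)) = 1 := by
    have e : (2 * (((m + 1 : ℕ) : ℤ) : ℂ)) = ((m : ℂ) + 1) + ((m : ℂ) + 1) := by
      push_cast
      ring
    rw [e, qPow_add]
    nth_rewrite 1 [sub_eq_zero.1 h]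
    rw [← qPow_add, neg_add_cancel, qPow_zero]
  have := eq_zero_of_qPow_eq_one hκ h1
  omega

theorem qPow_sub_mul (κ : ℝ) (x y : ℂ) :
    (qPow κ x - qPow κ (-x)) * (qPow κ y - qPow κ (-y)) =
      (qPow κ (x + y) + qPow κ (-(x + y))) - (qPow κ (x - y) + qPow κ (-(x - y))) := by
  have h1 := qPow_add κ x y
  have h2 : qPow κ (-(x + y)) = qPow κ (-x) * qPow κ (-y) := by
    rw [← qPow_add]
    congr 1
    ring
  have h3 : qPow κ (x - y) = qPow κ x * qPow κ (-y) := qPow_add κ x (-y)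
  have h4 : qPow κ (-(x - y)) = qPow κ (-x) * qPow κ y := by
    rw [← qPow_add]
    congr 1
    ring
  rw [h1, h2, h3, h4]
  ring

/-- This is the commutator of `E ^ (m + 1)` and `F` applied to `F ^ a v`, in coefficients. Turning
products of quantum numbers into sums, the terms with `l + 1` cancel. -/
theorem qNum_mul_sub (κ : ℝ) (a m l : ℂ) :
    qNum κ (a + 1) * qNum κ (l - a) - qNum κ (a - m) * qNum κ (l - a + m + 1) =
      qNum κ (m + 1) * qNum κ (l - 2 * a + m) := by
  have h1 := qPow_sub_mul κ (a + 1) (l - a)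
  have h2 := qPow_sub_mul κ (a - m) (l - a + m + 1)
  have h3 := qPow_sub_mul κ (m + 1) (l - 2 * a + m)
  rw [show a + 1 + (l - a) = l + 1 by ring, show a + 1 - (l - a) = 2 * a - l + 1 by ring] at h1
  rw [show a - m + (l - a + m + 1) = l + 1 by ring,
    show a - m - (l - a + m + 1) = -(l - 2 * a + 2 * m + 1) by ring, neg_neg] at h2
  rw [show m + 1 + (l - 2 * a + m) = l - 2 * a + 2 * m + 1 by ring,
    show m + 1 - (l - 2 * a + m) = 2 * a - l + 1 by ring] at h3
  simp only [qNum, div_mul_div_comm, ← sub_div]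
  congr 1
  rw [h1, h2, h3]
  ring

/-- The coefficient of `E ^ m ⊗ F ^ m` in `Θ`. -/
def thetaCoeff (κ : ℝ) (m : ℕ) : ℂ :=
  qPow κ ((m : ℂ) * ((m : ℂ) - 1) / 2) * (qPow κ 1 - qPow κ (-1)) ^ m / qFact κ m

/-- The coefficient of `E ^ m F ^ a v_l` with respect to `F ^ (a - m) v_l`. -/
def eCoeff (κ : ℝ) (l a : ℂ) (m : ℕ) : ℂ :=
  ∏ j ∈ Finset.range m, qNum κ (a - j) * qNum κ (l - a + j + 1)

/-- The coefficient of `Ř (F ^ a v ⊗ F ^ b v)` with respect to `F ^ (b + m) v ⊗ F ^ (a - m) v`. -/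
def rCoeff (κ : ℝ) (l₁ l₂ a b : ℂ) (m : ℕ) : ℂ :=
  thetaCoeff κ m * eCoeff κ l₁ a m * qPow κ ((l₁ - 2 * (a - m)) * (l₂ - 2 * (b + m)) / 2)

theorem thetaCoeff_succ {κ : ℝ} (hκ : Irrational κ) (m : ℕ) :
    thetaCoeff κ (m + 1) * qNum κ (m + 1) =
      thetaCoeff κ m * (qPow κ m * (qPow κ 1 - qPow κ (-1))) := by
  have h1 := qNum_ne_zero hκ m
  have h2 : qFact κ m ≠ 0 := Finset.prod_ne_zero_iff.2 fun j _ => qNum_ne_zero hκ j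
  have h3 : qFact κ (m + 1) = qFact κ m * qNum κ (m + 1) := Finset.prod_range_succ _ _
  have h4 : qPow κ (((m + 1 : ℕ) : ℂ) * (((m + 1 : ℕ) : ℂ) - 1) / 2) =
      qPow κ ((m : ℂ) * ((m : ℂ) - 1) / 2) * qPow κ m := by
    rw [← qPow_add]
    congr 1
    push_cast
    ring
  rw [thetaCoeff, thetaCoeff, h3, h4, pow_succ]
  field_simp

theorem eCoeff_succ (κ : ℝ) (l a : ℂ) (m : ℕ) :
    eCoeff κ l a (m + 1) = eCoeff κ l a m * (qNum κ (a - m) * qNum κ (l - a + m + 1)) :=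
  Finset.prod_range_succ _ _

theorem eCoeff_add_one (κ : ℝ) (l a : ℂ) (m : ℕ) :
    eCoeff κ l (a + 1) (m + 1) = qNum κ (a + 1) * qNum κ (l - a) * eCoeff κ l a m := by
  rw [eCoeff, Finset.prod_range_succ']
  rw [mul_comm]
  congr 1
  · congr 2 <;> push_cast <;> ring
  · refine Finset.prod_congr rfl fun j _ => ?_
    congr 2 <;> push_cast <;> ring

theorem eCoeff_eq_zero (κ : ℝ) (l : ℂ) {a m : ℕ} (h : a < m) : eCoeff κ l a m = 0 :=
  Finset.prod_eq_zero (Finset.mem_range.2 h) (by simp [qNum])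

theorem rCoeff_eq_zero (κ : ℝ) (l₁ l₂ : ℂ) {a : ℕ} (b : ℂ) {m : ℕ} (h : a < m) :
    rCoeff κ l₁ l₂ a b m = 0 := by
  rw [rCoeff, eCoeff_eq_zero κ l₁ h, mul_zero, zero_mul]

theorem rCoeff_zero (κ : ℝ) (l₁ l₂ a b : ℂ) :
    rCoeff κ l₁ l₂ a b 0 = qPow κ ((l₁ - 2 * a) * (l₂ - 2 * b) / 2) := by
  simp [rCoeff, thetaCoeff, eCoeff, qFact, qPow_zero]

theorem rCoeff_add_one_zero (κ : ℝ) (l₁ l₂ a b : ℂ) :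
    rCoeff κ l₁ l₂ (a + 1) b 0 = qPow κ (2 * b - l₂) * rCoeff κ l₁ l₂ a b 0 := by
  rw [rCoeff_zero, rCoeff_zero, ← qPow_add]
  congr 1
  ring

/-- The coefficient form of the intertwining of `Ř` with the coproduct of `F`, solved for `Ř (F ^ (a
+ 1) v ⊗ F ^ b v)`. The commutator `qNum_mul_sub` produces a factor `[m + 1]`, which
`thetaCoeff_succ` converts into `q ^ m (q - q⁻¹)`; expanding the remaining bracket gives the two
terms of index `m`. -/
theorem rCoeff_add_one_succ {κ : ℝ} (hκ : Irrational κ) (l₁ l₂ a b : ℂ) (m : ℕ) :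
    rCoeff κ l₁ l₂ (a + 1) b (m + 1) =
      rCoeff κ l₁ l₂ a b m + qPow κ (2 * (b + (m + 1)) - l₂) * rCoeff κ l₁ l₂ a b (m + 1) -
        qPow κ (2 * a - l₁) * rCoeff κ l₁ l₂ a (b + 1) m := by
  set X := qPow κ ((l₁ - 2 * (a - m)) * (l₂ - 2 * (b + m)) / 2) with hX
  set Y := qPow κ (-(l₁ - 2 * a + 2 * m)) with hY
  have e1 : rCoeff κ l₁ l₂ a (b + 1) m = thetaCoeff κ m * eCoeff κ l₁ a m * (X * Y) := by
    rw [rCoeff, hX, hY, ← qPow_add]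
    congr 2
    ring
  have e2 : rCoeff κ l₁ l₂ (a + 1) b (m + 1) =
      thetaCoeff κ (m + 1) * (qNum κ (a + 1) * qNum κ (l₁ - a) * eCoeff κ l₁ a m) * (X * Y) := by
    rw [rCoeff, eCoeff_add_one, hX, hY, ← qPow_add]
    congr 2
    push_cast
    ring
  have e3 : qPow κ (2 * (b + (m + 1)) - l₂) * rCoeff κ l₁ l₂ a b (m + 1) =
      thetaCoeff κ (m + 1) * (eCoeff κ l₁ a m * (qNum κ (a - m) * qNum κ (l₁ - a + m + 1))) *
        (X * Y) := by
    rw [rCoeff, eCoeff_succ, hX, hY, ← qPow_add, mul_left_comm, ← qPow_add]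
    congr 2
    push_cast
    ring
  have e4 : rCoeff κ l₁ l₂ a b m = thetaCoeff κ m * eCoeff κ l₁ a m * X := rfl
  have e5 := qNum_mul_sub κ a m l₁
  have e6 := thetaCoeff_succ hκ m
  have e7 : (qPow κ 1 - qPow κ (-1)) * qNum κ (l₁ - 2 * a + m) =
      qPow κ (l₁ - 2 * a + m) - qPow κ (-(l₁ - 2 * a + m)) :=
    mul_div_cancel₀ _ (qPow_one_sub_ne_zero hκ)
  have e8 : qPow κ m * qPow κ (l₁ - 2 * a + m) * Y = 1 := by
    rw [hY, ← qPow_add, ← qPow_add, ← qPow_zero κ]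
    congr 1
    ring
  have e9 : qPow κ m * qPow κ (-(l₁ - 2 * a + m)) = qPow κ (2 * a - l₁) := by
    rw [← qPow_add]
    congr 1
    ring
  rw [e1, e2, e3, e4]
  linear_combination (thetaCoeff κ (m + 1) * eCoeff κ l₁ a m * X * Y) * e5 +
    (eCoeff κ l₁ a m * X * Y * qNum κ (l₁ - 2 * a + m)) * e6 +
    (thetaCoeff κ m * eCoeff κ l₁ a m * X * Y * qPow κ m) * e7 +
    (thetaCoeff κ m * eCoeff κ l₁ a m * X) * e8 -
    (thetaCoeff κ m * eCoeff κ l₁ a m * X * Y) * e9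

theorem vermaE_pow_basis (κ : ℝ) (l : ℂ) (a m : ℕ) (h : m ≤ a) :
    (vermaE κ l ^ m) (vermaBasis κ l a) = eCoeff κ l a m • vermaBasis κ l (a - m) := by
  induction m with
  | zero => simp [eCoeff]
  | succ m ih =>
    rw [pow_succ', Module.End.mul_apply, ih (by omega), map_smul, vermaE, Basis.constr_basis,
      smul_smul, eCoeff_succ, Nat.cast_sub (by omega), Nat.sub_sub]
    congr 3
    ring_nf

theorem vermaF_pow_basis (κ : ℝ) (l : ℂ) (b m : ℕ) :
    (vermaF κ l ^ m) (vermaBasis κ l b) = vermaBasis κ l (b + m) := by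
  induction m with
  | zero => simp
  | succ m ih => rw [pow_succ', Module.End.mul_apply, ih, vermaF, Basis.constr_basis]; rfl

theorem rCheck_basis (κ : ℝ) (l₁ l₂ : ℂ) (a b : ℕ) :
    rCheck κ l₁ l₂ (vermaBasis κ l₁ a ⊗ₜ[ℂ] vermaBasis κ l₂ b) =
      ∑ m ∈ Finset.range (a + 1), rCoeff κ l₁ l₂ a b m •
        (vermaBasis κ l₂ (b + m) ⊗ₜ[ℂ] vermaBasis κ l₁ (a - m)) := by
  have hθ : theta κ l₁ l₂ (vermaBasis κ l₁ a ⊗ₜ[ℂ] vermaBasis κ l₂ b) =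
      ∑ m ∈ Finset.range (a + 1), thetaCoeff κ m •
        (((vermaE κ l₁ ^ m) (vermaBasis κ l₁ a)) ⊗ₜ[ℂ]
          ((vermaF κ l₂ ^ m) (vermaBasis κ l₂ b))) := by
    have := ((vermaBasis κ l₁).tensorProduct (vermaBasis κ l₂)).constr_basis ℂ
      (fun ab => ∑ k ∈ Finset.range (ab.1 + 1), thetaCoeff κ k •
        (((vermaE κ l₁ ^ k) (vermaBasis κ l₁ ab.1)) ⊗ₜ[ℂ]
          ((vermaF κ l₂ ^ k) (vermaBasis κ l₂ ab.2)))) (a, b)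
    rw [Basis.tensorProduct_apply] at this
    exact this
  have hC : ∀ a b : ℕ, cartan κ l₁ l₂ (vermaBasis κ l₁ a ⊗ₜ[ℂ] vermaBasis κ l₂ b) =
      qPow κ ((l₁ - 2 * a) * (l₂ - 2 * b) / 2) •
        (vermaBasis κ l₁ a ⊗ₜ[ℂ] vermaBasis κ l₂ b) := by
    intro a b
    have := ((vermaBasis κ l₁).tensorProduct (vermaBasis κ l₂)).constr_basis ℂ
      (fun ab => qPow κ ((l₁ - 2 * ab.1) * (l₂ - 2 * ab.2) / 2) •
        (vermaBasis κ l₁ ab.1 ⊗ₜ[ℂ] vermaBasis κ l₂ ab.2)) (a, b)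
    rw [Basis.tensorProduct_apply] at this
    exact this
  rw [rCheck, LinearMap.comp_apply, LinearMap.comp_apply, hθ, map_sum, map_sum]
  refine Finset.sum_congr rfl fun m hm => ?_
  have hm : m ≤ a := Nat.lt_succ_iff.1 (Finset.mem_range.1 hm)
  rw [vermaE_pow_basis κ l₁ a m hm, vermaF_pow_basis, ← TensorProduct.smul_tmul', smul_smul,
    map_smul, hC, smul_smul, map_smul, Nat.cast_sub hm, Nat.cast_add]
  rfl

variable {n : ℕ}

/-- The list `k` with the entries `x, y` in the places `i, i + 1`. -/
def setPair (i : Fin n) (k : Fin (n + 1) → ℕ) (x y : ℕ) : Fin (n + 1) → ℕ :=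
  Function.update (Function.update k i.castSucc x) i.succ y

theorem rCheckAt_basis (κ : ℝ) (lam : Fin (n + 1) → ℂ) (i : Fin n) (k : Fin (n + 1) → ℕ) :
    rCheckAt κ lam i (vermaTensorBasis κ lam k) =
      ∑ m ∈ Finset.range (k i.castSucc + 1),
        rCoeff κ (lam i.castSucc) (lam i.succ) (k i.castSucc) (k i.succ) m •
          vermaTensorBasis κ (lam ∘ swapAt i)
            (setPair i k (k i.succ + m) (k i.castSucc - m)) := by
  rw [rCheckAt, Basis.constr_basis, rCheck_basis, map_sum]
  refine Finset.sum_congr rfl fun m _ => ?_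
  rw [map_smul]
  congr 1
  have := ((vermaBasis κ ((lam ∘ swapAt i) i.castSucc)).tensorProduct
    (vermaBasis κ ((lam ∘ swapAt i) i.succ))).constr_basis ℂ (fun ab =>
      vermaTensorBasis κ (lam ∘ swapAt i)
        (Function.update (Function.update k i.castSucc ab.1) i.succ ab.2))
      (k i.succ + m, k i.castSucc - m)
  rw [Basis.tensorProduct_apply] at this
  exact this

end RMatrix

/-! ### The half-turn of the chains -/

section Recursion

/-- The recursion of the coefficients in summed form; `H x` stands for the vector with `x` in the
first of the two places, the second entry being determined by the total. -/
theorem sum_rCoeff_add_one {κ : ℝ} (hκ : Irrational κ) {V : Type*} [AddCommGroup V] [Module ℂ V]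
    (l₁ l₂ : ℂ) (a b : ℕ) (H : ℕ → V) :
    ∑ m ∈ Finset.range (a + 2), rCoeff κ l₁ l₂ (a + 1) b m • H (b + m) =
      ∑ m ∈ Finset.range (a + 1), rCoeff κ l₁ l₂ a b m •
        (H (b + m + 1) + qPow κ (2 * (b + m) - l₂) • H (b + m)) -
      qPow κ (2 * a - l₁) • ∑ m ∈ Finset.range (a + 1),
        rCoeff κ l₁ l₂ a (b + 1) m • H (b + m + 1) := by
  have h1 : ∑ m ∈ Finset.range (a + 1),
      (qPow κ (2 * (b + m) - l₂) * rCoeff κ l₁ l₂ a b m) • H (b + m) =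
      ∑ m ∈ Finset.range (a + 1), (qPow κ (2 * (b + (m + 1)) - l₂) *
        rCoeff κ l₁ l₂ a b (m + 1)) • H (b + m + 1) +
      (qPow κ (2 * b - l₂) * rCoeff κ l₁ l₂ a b 0) • H b := by
    -- The coefficient with `m = a + 1` vanishes, so the sum can be extended by it before the index
    -- is shifted.
    have h2 := Finset.sum_range_succ (fun m : ℕ =>
      (qPow κ (2 * (b + m) - l₂) * rCoeff κ l₁ l₂ a b m) • H (b + m)) (a + 1)
    rw [rCoeff_eq_zero κ l₁ l₂ b (Nat.lt_succ_self a), mul_zero, zero_smul, add_zero] at h2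
    rw [← h2, Finset.sum_range_succ']
    simp only [Nat.cast_add, Nat.cast_one, Nat.cast_zero, add_zero, ← add_assoc]
  rw [Finset.sum_range_succ']
  simp only [smul_add, smul_smul, Finset.sum_add_distrib, Finset.smul_sum, rCoeff_add_one_succ hκ,
    rCoeff_add_one_zero, add_smul, sub_smul, Finset.sum_sub_distrib, add_zero]
  simp only [mul_comm (rCoeff κ l₁ l₂ a b _), h1, ← add_assoc]
  abel

variable {n : ℕ} {i : Fin n}

theorem sum_eq_pair_add {s : Finset (Fin (n + 1))} {V : Type*} [AddCommGroup V]
    (h : i.castSucc ∈ s) (h' : i.succ ∈ s) (f : Fin (n + 1) → V) :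
    ∑ p ∈ s, f p = f i.castSucc + (f i.succ + ∑ p ∈ (s.erase i.castSucc).erase i.succ, f p) := by
  rw [Finset.add_sum_erase _ _ (Finset.mem_erase.2 ⟨i.castSucc_lt_succ.ne', h'⟩),
    Finset.add_sum_erase _ _ h]

theorem setPair_castSucc (k : Fin (n + 1) → ℕ) (x y : ℕ) : setPair i k x y i.castSucc = x := by
  simp [setPair, i.castSucc_lt_succ.ne]

theorem setPair_succ (k : Fin (n + 1) → ℕ) (x y : ℕ) : setPair i k x y i.succ = y := by
  simp [setPair]

theorem setPair_of_ne (k : Fin (n + 1) → ℕ) (x y : ℕ) {p : Fin (n + 1)} (h : p ≠ i.castSucc)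
    (h' : p ≠ i.succ) : setPair i k x y p = k p := by
  simp [setPair, h, h']

theorem eq_setPair {k k' : Fin (n + 1) → ℕ} {x y : ℕ} (h1 : k' i.castSucc = x)
    (h2 : k' i.succ = y) (h : ∀ p, p ≠ i.castSucc → p ≠ i.succ → k' p = k p) :
    k' = setPair i k x y := by
  funext p
  by_cases hp : p = i.castSucc
  · rw [hp, setPair_castSucc, h1]
  by_cases hp' : p = i.succ
  · rw [hp', setPair_succ, h2]
  · rw [setPair_of_ne k x y hp hp', h p hp hp']

theorem sum_setPair (k : Fin (n + 1) → ℕ) {x y : ℕ} (h : x + y = k i.castSucc + k i.succ) :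
    ∑ p, setPair i k x y p = ∑ p, k p := by
  have e : ∀ f : Fin (n + 1) → ℕ, ∑ p, f p = f i.castSucc + (f i.succ +
      ∑ p ∈ (Finset.univ.erase i.castSucc).erase i.succ, f p) := fun f => by
    rw [Finset.add_sum_erase _ _ (Finset.mem_erase.2 ⟨i.castSucc_lt_succ.ne', Finset.mem_univ _⟩),
      Finset.add_sum_erase _ _ (Finset.mem_univ _)]
  rw [e, e, setPair_castSucc, setPair_succ, ← add_assoc, ← add_assoc, h]
  congr 1
  refine Finset.sum_congr rfl fun p hp => ?_
  simp only [Finset.mem_erase] at hp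
  exact setPair_of_ne k x y hp.2.1 hp.1

theorem coproductCoeff_castSucc (κ : ℝ) (lam : Fin (n + 1) → ℂ) (k : Fin (n + 1) → ℕ) (x y : ℕ) :
    coproductCoeff κ (lam ∘ swapAt i) (setPair i k x y) i.castSucc =
      coproductCoeff κ lam k i.castSucc := by
  unfold coproductCoeff
  congr 1
  refine Finset.sum_congr rfl fun q hq => ?_
  have hq := Finset.mem_Iio.1 hq
  have hq' := (hq.trans i.castSucc_lt_succ).ne
  rw [setPair_of_ne k x y hq.ne hq', Function.comp_apply, swapAt,
    Equiv.swap_apply_of_ne_of_ne hq.ne hq']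

theorem coproductCoeff_succ (κ : ℝ) (lam : Fin (n + 1) → ℂ) (k : Fin (n + 1) → ℕ) :
    coproductCoeff κ lam k i.succ =
      coproductCoeff κ lam k i.castSucc * qPow κ (2 * k i.castSucc - lam i.castSucc) := by
  have h : Finset.Iio i.succ = insert i.castSucc (Finset.Iio i.castSucc) := by
    ext q
    simp only [Finset.mem_Iio, Finset.mem_insert, Fin.lt_def, Fin.ext_iff, Fin.val_succ,
      Fin.val_castSucc]
    omega
  rw [coproductCoeff, h, Finset.sum_insert (by simp), add_comm, qPow_add]
  rfl

/-- To the left of the pair the exponent does not see it. To the right it sees only the totals of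
contours and of weights over the pair, which are unchanged. -/
theorem coproductCoeff_of_ne (κ : ℝ) (lam : Fin (n + 1) → ℂ) (k : Fin (n + 1) → ℕ) {x y : ℕ}
    (h : x + y = k i.castSucc + k i.succ) {p : Fin (n + 1)} (hp : p ≠ i.castSucc)
    (hp' : p ≠ i.succ) :
    coproductCoeff κ (lam ∘ swapAt i) (setPair i k x y) p = coproductCoeff κ lam k p := by
  have hq : ∀ q, q ≠ i.castSucc → q ≠ i.succ →
      (2 * (setPair i k x y q : ℂ) - (lam ∘ swapAt i) q) = 2 * k q - lam q := fun q h1 h2 => by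
    rw [setPair_of_ne k x y h1 h2, Function.comp_apply, swapAt,
      Equiv.swap_apply_of_ne_of_ne h1 h2]
  unfold coproductCoeff
  congr 1
  rcases (eq_or_lt_or_gt (i := i) p).resolve_left hp |>.resolve_left hp' with h1 | h1
  · refine Finset.sum_congr rfl fun q hq' => hq q ?_ ?_
    · exact ((Finset.mem_Iio.1 hq').trans h1).ne
    · exact (((Finset.mem_Iio.1 hq').trans h1).trans i.castSucc_lt_succ).ne
  · have m1 := Finset.mem_Iio.2 (i.castSucc_lt_succ.trans h1)
    have m2 := Finset.mem_Iio.2 h1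
    rw [sum_eq_pair_add m1 m2, sum_eq_pair_add m1 m2, ← add_assoc, ← add_assoc]
    congr 1
    · have e : (x : ℂ) + y = k i.castSucc + k i.succ := by exact_mod_cast h
      simp only [setPair_castSucc, setPair_succ, Function.comp_apply, swapAt,
        Equiv.swap_apply_left, Equiv.swap_apply_right]
      linear_combination 2 * e
    · refine Finset.sum_congr rfl fun q hq' => ?_
      simp only [Finset.mem_erase] at hq'
      exact hq q hq'.2.1 hq'.1

variable {κ : ℝ}

/-- The recursion that expresses vectors `S' k` by vectors `E' k` through the R-matrix, when `W` acts
on both by the coproduct of `F`. -/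
theorem eq_sum_rCoeff_of_coproduct (hκ : Irrational κ) (lam : Fin (n + 1) → ℂ) {V V' : Type*}
    [AddCommGroup V] [Module ℂ V] [AddCommGroup V'] [Module ℂ V'] (W : V →ₗ[ℂ] V')
    (E : (Fin (n + 1) → ℕ) → V) (E' S' : (Fin (n + 1) → ℕ) → V') (k : Fin (n + 1) → ℕ) (a b : ℕ)
    (hka : k i.castSucc = a) (hkb : k i.succ = b)
    (hS : W (∑ m ∈ Finset.range (a + 1), rCoeff κ (lam i.castSucc) (lam i.succ) a b m •
        E (setPair i k (b + m) (a - m))) =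
      ∑ p, coproductCoeff κ lam k p • S' (k + Pi.single p 1))
    (hE : ∀ m ∈ Finset.range (a + 1), W (E (setPair i k (b + m) (a - m))) =
      ∑ p, coproductCoeff κ (lam ∘ swapAt i) (setPair i k (b + m) (a - m)) p •
        E' (setPair i k (b + m) (a - m) + Pi.single p 1))
    (ih : ∀ k' : Fin (n + 1) → ℕ, (∃ p, k' = k + Pi.single p 1) → k' i.castSucc = a →
      S' k' = ∑ m ∈ Finset.range (a + 1),
        rCoeff κ (lam i.castSucc) (lam i.succ) a (k' i.succ) m •
          E' (setPair i k' (k' i.succ + m) (a - m))) :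
    S' (k + Pi.single i.castSucc 1) =
      ∑ m ∈ Finset.range (a + 2), rCoeff κ (lam i.castSucc) (lam i.succ) (a + 1) b m •
        E' (setPair i k (b + m) (a + 1 - m)) := by
  have hne := i.castSucc_lt_succ.ne
  -- After one more contour around the pair, its two entries have sum `a + b + 1`, so the first
  -- entry determines the list.
  let H : ℕ → V' := fun x => E' (setPair i k x (a + b + 1 - x))
  set c := fun (b : ℂ) m => rCoeff κ (lam i.castSucc) (lam i.succ) a b m with hc
  set A := coproductCoeff κ lam k i.castSucc with hA
  have hsm : ∀ m ∈ Finset.range (a + 1), b + m + (a - m) = k i.castSucc + k i.succ := by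
    intro m hm
    have := Finset.mem_range.1 hm
    rw [hka, hkb]
    omega
  -- The new contour goes to the first point of the pair, to the second one, or to a point off the
  -- pair.
  have h2 : ∀ m ∈ Finset.range (a + 1), W (E (setPair i k (b + m) (a - m))) =
      A • H (b + m + 1) + ((A * qPow κ (2 * (b + m) - lam i.succ)) • H (b + m) +
        ∑ p ∈ (Finset.univ.erase i.castSucc).erase i.succ, coproductCoeff κ lam k p •
          E' (setPair i k (b + m) (a - m) + Pi.single p 1)) := by
    intro m hm
    have hma := Finset.mem_range.1 hm
    rw [hE m hm, sum_eq_pair_add (Finset.mem_univ i.castSucc) (Finset.mem_univ i.succ),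
      coproductCoeff_succ, coproductCoeff_castSucc, setPair_castSucc]
    have e1 : setPair i k (b + m) (a - m) + Pi.single i.castSucc 1 =
        setPair i k (b + m + 1) (a + b + 1 - (b + m + 1)) := by
      refine eq_setPair ?_ ?_ fun p h h' => ?_
      · simp [setPair_castSucc]
      · rw [Pi.add_apply, setPair_succ, Pi.single_eq_of_ne hne.symm]
        omega
      · simp [setPair_of_ne _ _ _ h h', h]
    have e2 : setPair i k (b + m) (a - m) + Pi.single i.succ 1 =
        setPair i k (b + m) (a + b + 1 - (b + m)) := by
      refine eq_setPair ?_ ?_ fun p h h' => ?_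
      · simp [setPair_castSucc, hne]
      · rw [Pi.add_apply, setPair_succ, Pi.single_eq_same]
        omega
      · simp [setPair_of_ne _ _ _ h h', h']
    have e3 : (lam ∘ swapAt i) i.castSucc = lam i.succ := by simp [swapAt]
    rw [e1, e2, e3, Nat.cast_add]
    congr 2
    refine Finset.sum_congr rfl fun p hp => ?_
    simp only [Finset.mem_erase] at hp
    rw [coproductCoeff_of_ne κ lam k (hsm m hm) hp.2.1 hp.1]
  have h3 : S' (k + Pi.single i.succ 1) =
      ∑ m ∈ Finset.range (a + 1), c (b + 1) m • H (b + m + 1) := by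
    have e : (k + Pi.single i.succ 1 : Fin (n + 1) → ℕ) i.succ = b + 1 := by simp [hkb]
    rw [ih _ ⟨_, rfl⟩ (by simp [hka, hne]), e]
    refine Finset.sum_congr rfl fun m hm => ?_
    have hma := Finset.mem_range.1 hm
    rw [Nat.cast_add, Nat.cast_one]
    congr 2
    refine eq_setPair ?_ ?_ fun p h h' => ?_
    · rw [setPair_castSucc]
      omega
    · rw [setPair_succ]
      omega
    · rw [setPair_of_ne _ _ _ h h']
      simp [h']
  have h4 : ∀ p ∈ (Finset.univ.erase i.castSucc).erase i.succ,
      coproductCoeff κ lam k p • S' (k + Pi.single p 1) =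
      ∑ m ∈ Finset.range (a + 1), c b m • coproductCoeff κ lam k p •
        E' (setPair i k (b + m) (a - m) + Pi.single p 1) := by
    intro p hp
    simp only [Finset.mem_erase] at hp
    have e : (k + Pi.single p 1 : Fin (n + 1) → ℕ) i.succ = b := by simp [hkb, hp.1.symm]
    rw [ih _ ⟨_, rfl⟩ (by simp [hka, hp.2.1.symm]), e, Finset.smul_sum]
    refine Finset.sum_congr rfl fun m hm => ?_
    rw [smul_comm]
    congr 3
    refine (eq_setPair ?_ ?_ fun q h h' => ?_).symm
    · simp [setPair_castSucc, hp.2.1.symm]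
    · simp [setPair_succ, hp.1.symm]
    · simp [setPair_of_ne _ _ _ h h']
  have h5 : ∑ m ∈ Finset.range (a + 1), c b m • (A • H (b + m + 1) +
      ((A * qPow κ (2 * (b + m) - lam i.succ)) • H (b + m) +
        ∑ p ∈ (Finset.univ.erase i.castSucc).erase i.succ, coproductCoeff κ lam k p •
          E' (setPair i k (b + m) (a - m) + Pi.single p 1))) =
      A • S' (k + Pi.single i.castSucc 1) + ((A * qPow κ (2 * a - lam i.castSucc)) •
        ∑ m ∈ Finset.range (a + 1), c (b + 1) m • H (b + m + 1) +
        ∑ m ∈ Finset.range (a + 1), c b m •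
          ∑ p ∈ (Finset.univ.erase i.castSucc).erase i.succ, coproductCoeff κ lam k p •
            E' (setPair i k (b + m) (a - m) + Pi.single p 1)) := by
    have e := hS
    rw [map_sum, sum_eq_pair_add (Finset.mem_univ i.castSucc) (Finset.mem_univ i.succ), h3,
      Finset.sum_congr rfl h4, coproductCoeff_succ, hka, Finset.sum_comm] at e
    simp only [← Finset.smul_sum] at e
    rw [← e]
    refine Finset.sum_congr rfl fun m hm => ?_
    rw [map_smul, h2 m hm]
  -- The terms for points off the pair occur on both sides and cancel. What is left is the summed
  -- recursion of the coefficients, multiplied by the power `A` of `q`, which is cancelled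
  -- afterwards.
  have h7 : A • S' (k + Pi.single i.castSucc 1) = A • ∑ m ∈ Finset.range (a + 2),
      rCoeff κ (lam i.castSucc) (lam i.succ) (a + 1) b m • H (b + m) := by
    rw [sum_rCoeff_add_one hκ (lam i.castSucc) (lam i.succ) a b H, smul_sub, smul_smul,
      Finset.smul_sum, eq_sub_iff_add_eq]
    simp only [smul_add, Finset.sum_add_distrib, ← add_assoc] at h5
    refine (add_right_cancel h5).symm.trans ?_
    rw [← Finset.sum_add_distrib]
    refine Finset.sum_congr rfl fun m _ => ?_
    simp only [smul_add, smul_smul, hc]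
    congr 2 <;> ring
  rw [smul_right_injective V' (qPow_ne_zero κ _ : A ≠ 0) h7]
  refine Finset.sum_congr rfl fun m _ => ?_
  have e : a + b + 1 - (b + m) = a + 1 - m := by omega
  simp only [H, e]

variable {z : Fin (n + 1) → ℂ} {R ε : ℝ}

/-- The half-turn acts on the chains by the R-matrix. -/
theorem startClass_eq_sum (hκ : Irrational κ) (lam : Fin (n + 1) → ℂ) (hz : Admissible z R ε)
    (hdisc : ∀ p, p ≠ i.castSucc → p ≠ i.succ → turnRadius i z < ‖z p - turnCentre i z‖)
    (hR : ∀ t p, (exchangePath i z t p).im < R) (a : ℕ) :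
    ∀ (ℓ : ℕ) (k : Fin (n + 1) → ℕ), ∑ p, k p = ℓ → k i.castSucc = a →
      startClass κ lam i hz ℓ k =
        ∑ m ∈ Finset.range (a + 1), rCoeff κ (lam i.castSucc) (lam i.succ) a (k i.succ) m •
          endClass κ lam i hz ℓ (setPair i k (k i.succ + m) (a - m)) := by
  induction a with
  | zero =>
    intro ℓ k hk ha
    have hk' : setPair i k (k i.succ + 0) (0 - 0) = k ∘ swapAt i :=
      (eq_setPair (by simp [swapAt]) (by simp [swapAt, ha]) fun p h h' => by
        rw [Function.comp_apply, swapAt, Equiv.swap_apply_of_ne_of_ne h h']).symm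
    have hs : ∑ p, (k ∘ swapAt i) p = ℓ := (Equiv.sum_comp (swapAt i) k).trans hk
    rw [Finset.sum_range_one, hk', startClass, dif_pos hk, endClass, dif_pos hs,
      pushClass_start_gsClass_of_eq_zero κ lam hz hdisc hR k _ hk hs rfl ha, rCoeff_zero]
    congr 2
    push_cast
    ring
  | succ a ih =>
    intro ℓ k hk ha
    obtain ⟨ℓ, rfl⟩ : ∃ ℓ', ℓ = ℓ' + 1 := by
      refine ⟨ℓ - 1, ?_⟩
      have := Finset.single_le_sum (f := k) (fun _ _ => Nat.zero_le _)
        (Finset.mem_univ i.castSucc)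
      omega
    have hne := i.castSucc_lt_succ.ne
    -- One contour around the left point is removed; the class for `k` is then recovered by adding a
    -- contour around everything to the one for `k₀`.
    obtain ⟨k₀, hk₀⟩ : ∃ k₀ : Fin (n + 1) → ℕ, k = k₀ + Pi.single i.castSucc 1 := by
      refine ⟨Function.update k i.castSucc a, funext fun p => ?_⟩
      by_cases hp : p = i.castSucc
      · rw [hp, Pi.add_apply, Function.update_self, Pi.single_eq_same, ha]
      · rw [Pi.add_apply, Function.update_of_ne hp, Pi.single_eq_of_ne hp, add_zero]
    have hk₀c : k₀ i.castSucc = a := by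
      rw [hk₀] at ha
      simpa using ha
    have hk₀s : k₀ i.succ = k i.succ := by simp [hk₀, hne.symm]
    have hsum : ∑ p, k₀ p = ℓ := by
      rw [hk₀] at hk
      simpa [Finset.sum_add_distrib] using hk
    have hset : ∀ x y, setPair i k x y = setPair i k₀ x y := fun x y =>
      eq_setPair (setPair_castSucc _ _ _) (setPair_succ _ _ _) fun p h h' => by
        rw [setPair_of_ne _ _ _ h h']
        simp [hk₀, h]
    have key := eq_sum_rCoeff_of_coproduct hκ lam (familyF κ lam i z R hz.pos ℓ)
      (endClass κ lam i hz ℓ) (endClass κ lam i hz (ℓ + 1)) (startClass κ lam i hz (ℓ + 1)) k₀ a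
      (k i.succ) hk₀c hk₀s ?_ ?_ ?_
    · rw [← hk₀] at key
      rw [key]
      simp only [hset, Nat.cast_add, Nat.cast_one]
    · rw [← familyF_startClass κ lam hz k₀ hsum, ih ℓ k₀ hsum hk₀c, hk₀s]
    · intro m hm
      have hma := Finset.mem_range.1 hm
      refine familyF_endClass κ lam hz _ ((sum_setPair k₀ ?_).trans hsum)
      rw [hk₀c, hk₀s]
      omega
    -- The other terms still have `a` contours around the left point but `ℓ + 1` contours in all,
    -- hence the induction over `a` with `ℓ` and `k` arbitrary.
    · rintro k' ⟨p, rfl⟩ hk'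
      exact ih (ℓ + 1) _ (sum_add_single hsum p) hk'

end Recursion

/-! ### Homology and classes of chains -/

section HomologyClasses

variable {B B' : Type} [TopologicalSpace B] [TopologicalSpace B'] {n : ℕ}
  {κ : ℝ} {lam lam' : Fin n → ℂ} {Z : B → Fin n → ℂ} {Z' : B' → Fin n → ℂ} {ℓ : ℕ} {R : ℝ}

/-- The inclusion of the homology in the classes of chains. -/
def toChainClass (κ : ℝ) (lam : Fin n → ℂ) (Z : B → Fin n → ℂ) (ℓ : ℕ) (R : ℝ) (k : ℕ) :
    Homology κ lam Z ℓ R k →ₗ[ℂ] ChainClass κ lam Z ℓ R k :=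
  Submodule.mapQ _ _ (cycles κ lam Z ℓ R k).subtype fun _ h => h

theorem toChainClass_injective (k : ℕ) : Function.Injective (toChainClass κ lam Z ℓ R k) := by
  rw [← LinearMap.ker_eq_bot, LinearMap.ker_eq_bot']
  intro c
  refine Submodule.Quotient.induction_on _ c fun c hc => ?_
  have hc' : (boundaries κ lam Z ℓ R k).mkQ (c : PreChain Z ℓ k) = 0 := hc
  rw [Submodule.mkQ_apply, Submodule.Quotient.mk_eq_zero] at hc'
  exact (Submodule.Quotient.mk_eq_zero _).2 hc'

theorem toChainClass_homologyMap {g : C(Config Z ℓ, Config Z' ℓ)}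
    (hg : IsTwistedMap κ lam lam' Z Z' ℓ R g) (k : ℕ) (c : Homology κ lam Z ℓ R k) :
    toChainClass κ lam' Z' ℓ R k (homologyMap hg k c) =
      pushClass hg k (toChainClass κ lam Z ℓ R k c) :=
  Submodule.Quotient.induction_on _ c fun _ => rfl

end HomologyClasses

/-! ### Gomez-Sierra homology classes as classes of chains -/

section Monodromy

variable {n : ℕ} {z : Fin n → ℂ} {R ε : ℝ} {ℓ : ℕ}

theorem toChainClass_antisymmetrize (κ : ℝ) (lam : Fin n → ℂ)
    (c : Homology κ lam (fun _ : Unit => z) ℓ R ℓ) :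
    toChainClass κ lam (fun _ : Unit => z) ℓ R ℓ (antisymmetrize κ lam z R ℓ c) =
      antiClass κ lam (fun _ : Unit => z) ℓ R ℓ
        (toChainClass κ lam (fun _ : Unit => z) ℓ R ℓ c) := by
  simp only [antisymmetrize, antiClass, LinearMap.sum_apply, LinearMap.smul_apply, map_sum,
    map_smul]
  refine Finset.sum_congr rfl fun σ _ => ?_
  congr 1
  exact toChainClass_homologyMap (isTwistedMap_perm κ lam (fun _ : Unit => z) R σ) ℓ c

theorem toChainClass_gsChain (κ : ℝ) (lam : Fin n → ℂ) (hz : Admissible z R ε) (r : Fin n → ℕ)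
    (hr : ∑ p, r p = ℓ) :
    toChainClass κ lam (fun _ : Unit => z) ℓ R ℓ (gsChain κ lam hz r hr) =
      gsClass κ lam hz r hr := by
  rw [gsChain, toChainClass_antisymmetrize]
  rfl

end Monodromy

/-! ### Weight spaces -/

section Weights

variable {n : ℕ} {κ : ℝ}

theorem vermaK_tensor_basis (κ : ℝ) (lam : Fin n → ℂ) (k : Fin n → ℕ) :
    PiTensorProduct.map (fun p => vermaK κ (lam p)) (vermaTensorBasis κ lam k) =
      qPow κ (∑ p, lam p - 2 * ((∑ p, k p : ℕ) : ℂ)) • vermaTensorBasis κ lam k := by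
  have h1 : ∀ s : Finset (Fin n), ∏ p ∈ s, qPow κ (lam p - 2 * k p) =
      qPow κ (∑ p ∈ s, (lam p - 2 * k p)) := by
    intro s
    simp only [qPow, ← Complex.exp_sum, Finset.mul_sum, Finset.sum_div]
  have h2 : ∀ p, vermaK κ (lam p) (vermaBasis κ (lam p) (k p)) =
      qPow κ (lam p - 2 * k p) • vermaBasis κ (lam p) (k p) := fun p =>
    (vermaBasis κ (lam p)).constr_basis ℂ _ _
  rw [vermaTensorBasis, Basis.piTensorProduct_apply, PiTensorProduct.map_tprod]
  simp only [h2]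
  rw [MultilinearMap.map_smul_univ, h1, Finset.sum_sub_distrib, ← Finset.mul_sum]
  push_cast
  rfl

theorem vermaTensorBasis_mem_weightSpace (κ : ℝ) (lam : Fin n → ℂ) {ℓ : ℕ} {k : Fin n → ℕ}
    (hk : ∑ p, k p = ℓ) : vermaTensorBasis κ lam k ∈ weightSpace κ lam ℓ := by
  rw [weightSpace, LinearMap.mem_eqLocus, vermaK_tensor_basis, hk]
  rfl

/-- The basis vectors are eigenvectors, and since `q` is not a root of unity the eigenvalue `q ^ (∑
lam - 2 ∑ k)` determines `∑ k`. -/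
theorem repr_eq_zero_of_mem_weightSpace (hκ : Irrational κ) (lam : Fin n → ℂ) {ℓ : ℕ}
    {v : VermaTensor κ lam} (hv : v ∈ weightSpace κ lam ℓ) {k : Fin n → ℕ}
    (hk : ∑ p, k p ≠ ℓ) : (vermaTensorBasis κ lam).repr v k = 0 := by
  rw [weightSpace, LinearMap.mem_eqLocus] at hv
  have key : ∀ v, (vermaTensorBasis κ lam).repr
      (PiTensorProduct.map (fun p => vermaK κ (lam p)) v) k =
      qPow κ (∑ p, lam p - 2 * ((∑ p, k p : ℕ) : ℂ)) * (vermaTensorBasis κ lam).repr v k := by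
    intro v
    have : (Finsupp.lapply k ∘ₗ (vermaTensorBasis κ lam).repr.toLinearMap) ∘ₗ
        PiTensorProduct.map (fun p => vermaK κ (lam p)) =
        qPow κ (∑ p, lam p - 2 * ((∑ p, k p : ℕ) : ℂ)) •
          (Finsupp.lapply k ∘ₗ (vermaTensorBasis κ lam).repr.toLinearMap) := by
      refine (vermaTensorBasis κ lam).ext fun k' => ?_
      rw [LinearMap.comp_apply, vermaK_tensor_basis, map_smul, LinearMap.smul_apply]
      by_cases h : k' = k
      · rw [h]
      · simp [h]
    exact LinearMap.congr_fun this v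
  have h1 := key v
  rw [hv, LinearMap.smul_apply, LinearMap.id_apply, map_smul, Finsupp.smul_apply, smul_eq_mul,
    ← sub_eq_zero, ← sub_mul] at h1
  refine (mul_eq_zero.1 h1).resolve_left fun h => hk ?_
  have h2 : qPow κ (2 * (((∑ p, k p : ℕ) : ℤ) - ℓ : ℤ)) = 1 := by
    have e : (2 * ((((∑ p, k p : ℕ) : ℤ) - ℓ : ℤ) : ℂ)) =
        (∑ p, lam p - 2 * (ℓ : ℂ)) + -(∑ p, lam p - 2 * ((∑ p, k p : ℕ) : ℂ)) := by
      push_cast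
      ring
    rw [e, qPow_add, sub_eq_zero.1 h, ← qPow_add, add_neg_cancel, qPow_zero]
  have := eq_zero_of_qPow_eq_one hκ h2
  omega

/-- Each term of `Ř` moves `m` powers of `F` from one factor to the other and preserves their total
number. -/
theorem rCheckAt_mem_weightSpace (hκ : Irrational κ) (lam : Fin (n + 1) → ℂ) (i : Fin n) {ℓ : ℕ}
    {v : VermaTensor κ lam} (hv : v ∈ weightSpace κ lam ℓ) :
    rCheckAt κ lam i v ∈ weightSpace κ (lam ∘ swapAt i) ℓ := by
  rw [← (vermaTensorBasis κ lam).linearCombination_repr v, Finsupp.linearCombination_apply,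
    Finsupp.sum, map_sum]
  refine Submodule.sum_mem _ fun k hk => ?_
  rw [map_smul]
  refine Submodule.smul_mem _ _ ?_
  have hk' : ∑ p, k p = ℓ := by
    by_contra h
    exact Finsupp.mem_support_iff.1 hk (repr_eq_zero_of_mem_weightSpace hκ lam hv h)
  rw [rCheckAt_basis]
  refine Submodule.sum_mem _ fun m hm => Submodule.smul_mem _ _
    (vermaTensorBasis_mem_weightSpace _ _ ((sum_setPair k ?_).trans hk'))
  have := Finset.mem_range.1 hm
  omega

end Weights

/-! ### The monodromy -/

section Result

variable {n : ℕ} {i : Fin n} {z : Fin (n + 1) → ℂ} {R ε : ℝ} {κ : ℝ}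

/-- The map `φ_z` on the whole tensor product, zero on the other weight spaces. -/
def phiTotal {n : ℕ} {z : Fin n → ℂ} (κ : ℝ) (lam : Fin n → ℂ) (hz : Admissible z R ε) (ℓ : ℕ) :
    VermaTensor κ lam →ₗ[ℂ] contourSpace κ lam hz ℓ :=
  (vermaTensorBasis κ lam).constr ℂ fun k =>
    if h : ∑ p, k p = ℓ then
      (⟨gsChain κ lam hz k h, Submodule.subset_span ⟨k, h, rfl⟩⟩ : contourSpace κ lam hz ℓ)
    else 0

theorem toChainClass_inclStart (lam : Fin (n + 1) → ℂ) (hz : Admissible z R ε) (ℓ : ℕ)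
    (k : Fin (n + 1) → ℕ) :
    toChainClass κ lam (exchangePath i z) ℓ R ℓ (inclStart κ lam z R ℓ i
      (phiTotal κ lam hz ℓ (vermaTensorBasis κ lam k))) = startClass κ lam i hz ℓ k := by
  rw [phiTotal, Basis.constr_basis, startClass]
  split_ifs with h
  · refine (toChainClass_homologyMap (isTwistedMap_start κ lam z R ℓ i) ℓ _).trans ?_
    rw [toChainClass_gsChain]
  · simp

theorem toChainClass_inclEnd (lam : Fin (n + 1) → ℂ) (hz : Admissible z R ε) (ℓ : ℕ)
    (k : Fin (n + 1) → ℕ) :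
    toChainClass κ lam (exchangePath i z) ℓ R ℓ (inclEnd κ lam z R ℓ i
      (phiTotal κ (lam ∘ swapAt i) hz ℓ (vermaTensorBasis κ (lam ∘ swapAt i) k))) =
      endClass κ lam i hz ℓ k := by
  rw [phiTotal, Basis.constr_basis, endClass]
  split_ifs with h
  · refine (toChainClass_homologyMap (isTwistedMap_end κ lam z R ℓ i) ℓ _).trans ?_
    rw [toChainClass_gsChain]
  · simp

/-- Compared on basis vectors and inside the classes of chains. For a list of total different from
`ℓ` both sides are zero, since `Ř` preserves the total. -/
theorem inclStart_phiTotal (hκ : Irrational κ) (lam : Fin (n + 1) → ℂ) (hz : Admissible z R ε)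
    (hdisc : ∀ p, p ≠ i.castSucc → p ≠ i.succ → turnRadius i z < ‖z p - turnCentre i z‖)
    (hR : ∀ t p, (exchangePath i z t p).im < R) (ℓ : ℕ) (v : VermaTensor κ lam) :
    inclStart κ lam z R ℓ i (phiTotal κ lam hz ℓ v) =
      inclEnd κ lam z R ℓ i (phiTotal κ (lam ∘ swapAt i) hz ℓ (rCheckAt κ lam i v)) := by
  have key : inclStart κ lam z R ℓ i ∘ₗ (contourSpace κ lam hz ℓ).subtype ∘ₗ
      phiTotal κ lam hz ℓ = inclEnd κ lam z R ℓ i ∘ₗ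
        (contourSpace κ (lam ∘ swapAt i) hz ℓ).subtype ∘ₗ
        phiTotal κ (lam ∘ swapAt i) hz ℓ ∘ₗ rCheckAt κ lam i := by
    refine (vermaTensorBasis κ lam).ext fun k => toChainClass_injective ℓ ?_
    refine (toChainClass_inclStart lam hz ℓ k).trans ?_
    simp only [LinearMap.comp_apply, rCheckAt_basis, map_sum, map_smul]
    have hE : ∀ k, toChainClass κ lam (exchangePath i z) ℓ R ℓ (inclEnd κ lam z R ℓ i
        ((contourSpace κ (lam ∘ swapAt i) hz ℓ).subtype
          (phiTotal κ (lam ∘ swapAt i) hz ℓ (vermaTensorBasis κ (lam ∘ swapAt i) k)))) =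
        endClass κ lam i hz ℓ k := toChainClass_inclEnd lam hz ℓ
    simp only [hE]
    by_cases hk : ∑ p, k p = ℓ
    · exact startClass_eq_sum hκ lam hz hdisc hR _ ℓ k hk rfl
    · rw [startClass, dif_neg hk]
      refine (Finset.sum_eq_zero fun m hm => ?_).symm
      rw [endClass, dif_neg, smul_zero]
      rw [sum_setPair k]
      · exact hk
      · have := Finset.mem_range.1 hm
        omega
  exact LinearMap.congr_fun key v

theorem inclEnd_injective (lam : Fin (n + 1) → ℂ) (ℓ : ℕ)
    (hre : (z i.castSucc).re < (z i.succ).re)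
    (hdisc : ∀ p, p ≠ i.castSucc → p ≠ i.succ → turnRadius i z < ‖z p - turnCentre i z‖)
    (hR : ∀ t p, (exchangePath i z t p).im < R) :
    Function.Injective (inclEnd κ lam z R ℓ i) := by
  intro c c' h
  refine toChainClass_injective ℓ (pushClass_end_injective κ lam ℓ ℓ hre hdisc hR ?_)
  have h' := congrArg (toChainClass κ lam (exchangePath i z) ℓ R ℓ) h
  exact (toChainClass_homologyMap (isTwistedMap_end κ lam z R ℓ i) ℓ c).symm.trans
    (h'.trans (toChainClass_homologyMap (isTwistedMap_end κ lam z R ℓ i) ℓ c'))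

/-- No general lifting of homology along the path is used: the R-matrix formula itself exhibits each
generator at the start as a combination of chains at the end. -/
theorem exists_inclEnd_eq (hκ : Irrational κ) (lam : Fin (n + 1) → ℂ) (hz : Admissible z R ε)
    (hdisc : ∀ p, p ≠ i.castSucc → p ≠ i.succ → turnRadius i z < ‖z p - turnCentre i z‖)
    (hR : ∀ t p, (exchangePath i z t p).im < R) (ℓ : ℕ) (c : contourSpace κ lam hz ℓ) :
    ∃ c' : contourSpace κ (lam ∘ swapAt i) hz ℓ,
      inclEnd κ lam z R ℓ i c' = inclStart κ lam z R ℓ i c := by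
  have key : contourSpace κ lam hz ℓ ≤ ((contourSpace κ (lam ∘ swapAt i) hz ℓ).map
      (inclEnd κ lam z R ℓ i)).comap (inclStart κ lam z R ℓ i) := by
    refine Submodule.span_le.2 ?_
    rintro _ ⟨r, hr, rfl⟩
    have h := inclStart_phiTotal hκ lam hz hdisc hR ℓ (vermaTensorBasis κ lam r)
    have h' : (phiTotal κ lam hz ℓ (vermaTensorBasis κ lam r) :
        Homology κ lam (fun _ : Unit => z) ℓ R ℓ) = gsChain κ lam hz r hr := by
      rw [phiTotal, Basis.constr_basis, dif_pos hr]
    rw [h'] at h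
    exact ⟨_, Subtype.property _, h.symm⟩
  obtain ⟨c', h, h'⟩ := key c.2
  exact ⟨⟨c', h⟩, h'⟩

/-- The monodromy along the half-turn. -/
theorem exists_monodromy (hκ : Irrational κ) (lam : Fin (n + 1) → ℂ) (hz : Admissible z R ε)
    (hre : (z i.castSucc).re < (z i.succ).re)
    (hdisc : ∀ p, p ≠ i.castSucc → p ≠ i.succ → turnRadius i z < ‖z p - turnCentre i z‖)
    (hR : ∀ t p, (exchangePath i z t p).im < R) (ℓ : ℕ) :
    ∃ A : contourSpace κ lam hz ℓ →ₗ[ℂ] contourSpace κ (lam ∘ swapAt i) hz ℓ,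
      IsMonodromy i A := by
  have hinj := inclEnd_injective (κ := κ) lam ℓ hre hdisc hR
  choose f hf using exists_inclEnd_eq hκ lam hz hdisc hR ℓ
  -- The chosen transports are unique because `inclEnd` is injective, so they depend linearly on the
  -- class.
  refine ⟨{ toFun := f, map_add' := fun c d => ?_, map_smul' := fun a c => ?_ }, hf⟩
  · refine Subtype.ext (hinj ?_)
    rw [hf, Submodule.coe_add, Submodule.coe_add, map_add, map_add, hf, hf]
  · refine Subtype.ext (hinj ?_)
    rw [hf, RingHom.id_apply, Submodule.coe_smul, Submodule.coe_smul, map_smul, map_smul, hf]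

end Result

end

end GomezSierra

theorem proposition4 {n : ℕ} (i : Fin n) (ℓ : ℕ) (κ : ℝ) (hκ : Irrational κ)
    (lam z : Fin (n + 1) → ℂ)
    (hre : ∀ p r, p < r → (z p).re < (z r).re)
    (hdisc : ∀ p, p ≠ i.castSucc → p ≠ i.succ →
      ‖z i.castSucc - z i.succ‖ / 2 < ‖z p - (z i.castSucc + z i.succ) / 2‖)
    (R ε : ℝ) (hz : GomezSierra.Admissible z R ε)
    (hR : ∀ t p, (GomezSierra.exchangePath i z t p).im < R) :
    ∃ A : GomezSierra.contourSpace κ lam hz ℓ →ₗ[ℂ]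
        GomezSierra.contourSpace κ (lam ∘ GomezSierra.swapAt i) hz ℓ,
      GomezSierra.IsMonodromy i A ∧
      (∀ A', GomezSierra.IsMonodromy i A' → A' = A) ∧
      ∀ v : GomezSierra.weightSpace κ lam ℓ,
        ∃ hv : GomezSierra.rCheckAt κ lam i v ∈
            GomezSierra.weightSpace κ (lam ∘ GomezSierra.swapAt i) ℓ,
          A (GomezSierra.phi κ lam hz ℓ v) =
            GomezSierra.phi κ (lam ∘ GomezSierra.swapAt i) hz ℓ
              ⟨GomezSierra.rCheckAt κ lam i v, hv⟩ := by
  have h0 := hre _ _ i.castSucc_lt_succ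
  -- Injectivity reduces both the uniqueness of `A` and the formula to equalities in the homology of
  -- the family, where the defining property of a monodromy replaces `A c` by the class of `c` at
  -- the start.
  have hinj := GomezSierra.inclEnd_injective (κ := κ) lam ℓ h0 hdisc hR
  obtain ⟨A, hA⟩ := GomezSierra.exists_monodromy hκ lam hz h0 hdisc hR ℓ
  refine ⟨A, hA, fun A' hA' => LinearMap.ext fun c => Subtype.ext (hinj ?_), fun v =>
    ⟨GomezSierra.rCheckAt_mem_weightSpace hκ lam i v.2, Subtype.ext (hinj ?_)⟩⟩
  · rw [hA', hA]
  · rw [hA]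
    exact GomezSierra.inclStart_phiTotal hκ lam hz hdisc hR ℓ v
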